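/- Let $d\ge 2$ be an integer and let $L>2^{100}$. Write $\widehat f(\xi)=\int_{\mathbb R} f(x)e^{-2\pi i\xi x}\,dx$ for the Fourier transform, $\check f$ for the inverse Fourier transform, and $\langle F,G\rangle=\int_{\mathbb R} F\,\overline{G}$. Fix the following functions. * $\rho_1:\mathbb R\to\mathbb R$ is $C^\infty$ and supported in $[1/2,2]$, and $\rho(t)=\rho_1(t)\mathbf 1_{\{t>0\}}-\rho_1(-t)\mathbf 1_{\{t<0\}}$. * $\Phi_1$ is a Schwartz function on $\mathbb R$ with $\widehat{\Phi_1}(\xi)=1$ for $3/8\le|\xi|\le 17/8$ and $\widehat{\Phi_1}$ supported in $1/8\le|\xi|\le 19/8$; $R_{\Phi_1}$ is the Fourier multiplier $\widehat{R_{\Phi_1}f}=\widehat f\,\widehat{\Phi_1}$, i.e. $R_{\Phi_1}f=f*\Phi_1$. * $\phi\ge 0$ is a Schwartz function on $\mathbb R$ with $\widehat\phi$ supported in $[-1/100,1/100]$ and $\widehat\phi(0)=1$. For $k,n\in\mathbb Z$ put $\phi_k(x)=2^{-k}\phi(2^{-k}x)$, $I_{k,n}=[2^kn,2^k(n+1)]$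 and $\mathbf 1^*_{k,n}=\mathbf 1_{I_{k,n}}*\phi_k$. For $j,n\in\mathbb Z$ and an integer $m\ge 0$ define, if $j>0$, $$\mathcal B_{j,m,n}(f,g)(x)=2^{-\frac{(d-1)j}{2}}\Big(\int_{\mathbb R} R_{\Phi_1}f\big(2^{-(d-1)j}x-2^mt\big)\,R_{\Phi_1}g\big(x-2^mt^d\big)\,\rho(t)\,dt\Big)\,\mathbf 1^*_{(d-1)j+m,\,n}(x),$$ and, if $j\le 0$, $$\mathcal B_{j,m,n}(f,g)(x)=2^{\frac{(d-1)j}{2}}\Big(\int_{\mathbb R} R_{\Phi_1}f\big(x-2^mt\big)\,R_{\Phi_1}g\big(2^{(d-1)j}x-2^mt^d\big)\,\rho(t)\,dt\Big)\,\mathbf 1^*_{(d-1)|j|+m,\,n}(x).$$ For functions $f_1,f_2,f_3\in L^2(\mathbb R)$ supported on $\{\xi: 1/16\le|\xi|\le 39/16\}$ put $$\Lambda_{j,m,n}(f_1,f_2,f_3)=\big\langle \mathcal B_{j,m,n}(\check f_1,\check f_2),\check f_3\big\rangle .$$ Theorem. There is a constant $C$, independent of $j$, $m$, $n$ and of $f_1,f_2,f_3$,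 such that for all $j,n\in\mathbb Z$ and all integers $m\ge 0$ with $L\le |j|\le \frac{m}{d-1}$, and all $f_1,f_2,f_3\in L^2(\mathbb R)$ supported on $1/16\le|\xi|\le 39/16$, the integral defining $\Lambda_{j,m,n}(f_1,f_2,f_3)$ converges absolutely and $$\big|\Lambda_{j,m,n}(f_1,f_2,f_3)\big|\le C\,2^{\frac{-(d-1)|j|-m}{2}}\,2^{-\frac{m-(d-1)|j|}{6}}\,\|f_1\|_2\,\|f_2\|_2\,\|f_3\|_2 .$$ -/

import Mathlib

open scoped FourierTransform SchwartzMap ContDiff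

noncomputable section

namespace CurveTrilinear

/-- The odd extension of the bump function `ρ₁` (which lives on `[1/2, 2]`). -/
def rho (ρ₁ : ℝ → ℝ) (t : ℝ) : ℝ :=
  if 0 < t then ρ₁ t else if t < 0 then -ρ₁ (-t) else 0

/-- The smooth Fourier restriction `R_Φ f`, i.e. the Fourier multiplier with symbol `𝓕 Φ`,
`(R_Φ f)^ = f^ · Φ^`, realised as the (absolutely convergent) convolution `f * Φ`. -/
def R (Φ : 𝓢(ℝ, ℂ)) (f : ℝ → ℂ) (x : ℝ) : ℂ :=
  ∫ y : ℝ, f y * Φ (x - y)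

/-- `R_Φ` is the Fourier multiplier with symbol `𝓕 Φ`: on `fˇ` with `f` integrable it is
the inverse Fourier transform of `f · 𝓕 Φ`. -/
theorem R_fourierInv (Φ : 𝓢(ℝ, ℂ)) (f : ℝ → ℂ) (hf : MeasureTheory.Integrable f) (x : ℝ) :
    R Φ (𝓕⁻ f) x = 𝓕⁻ (fun ξ => f ξ * 𝓕 (Φ : ℝ → ℂ) ξ) x := by
  have e : ∀ ξ y : ℝ, (Real.fourierChar (ξ * y) : Circle) • f ξ * Φ (x - y)
      = Complex.exp (2 * Real.pi * Complex.I * (ξ * y)) * f ξ * Φ (x - y) := by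
    intro ξ y
    rw [Circle.smul_def, Real.fourierChar_apply, smul_eq_mul]; congr 3; push_cast; ring
  have hΦ : MeasureTheory.Integrable (fun y => Φ (x - y)) := (Φ.integrable (μ := MeasureTheory.volume)).comp_sub_left x
  have hI : MeasureTheory.Integrable (fun p : ℝ × ℝ =>
      Complex.exp (2 * Real.pi * Complex.I * (p.2 * p.1)) * (f p.2 * Φ (x - p.1)))
      (MeasureTheory.volume.prod MeasureTheory.volume) := by
    have h0 : MeasureTheory.Integrable (fun p : ℝ × ℝ => f p.2 * Φ (x - p.1)) (MeasureTheory.volume.prod MeasureTheory.volume) := by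
      simpa [mul_comm] using hΦ.mul_prod hf
    refine h0.bdd_mul (c := 1) (by fun_prop) (Filter.Eventually.of_forall fun p => ?_)
    rw [show (2 * Real.pi * Complex.I * (p.2 * p.1) : ℂ)
      = ((2 * Real.pi * (p.2 * p.1) : ℝ) : ℂ) * Complex.I by push_cast; ring,
      Complex.norm_exp_ofReal_mul_I]
  simp only [R, Real.fourierInv_eq', Real.fourier_eq', ← MeasureTheory.integral_mul_const]
  rw [MeasureTheory.integral_integral_swap]
  · congr 1; ext ξ
    rw [← MeasureTheory.integral_const_mul, smul_eq_mul, ← MeasureTheory.integral_const_mul,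
      ← MeasureTheory.integral_sub_left_eq_self (μ := MeasureTheory.volume) _ x]
    congr 1; ext y
    simp only [smul_eq_mul, sub_sub_cancel]
    have : Complex.exp (2 * Real.pi * (inner ℝ ξ (x-y)) * Complex.I)
       = Complex.exp (2 * Real.pi * (inner ℝ ξ x) * Complex.I) * Complex.exp (-2 * Real.pi * (inner ℝ y ξ) * Complex.I) := by
      rw [← Complex.exp_add]; congr 1
      simp; ring
    push_cast at *
    simp at this ⊢
    rw [this]; ring
  · refine hI.congr (Filter.Eventually.of_forall fun p => ?_)
    simp [Function.uncurry]; ring_nf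

/-- The `L¹`-normalised dilate `φ_k(x) = 2^{-k} φ(2^{-k} x)`. -/
def dil (φ : 𝓢(ℝ, ℝ)) (k : ℤ) (x : ℝ) : ℝ :=
  (2 : ℝ) ^ (-k) * φ ((2 : ℝ) ^ (-k) * x)

/-- The interval `I_{k,n} = [2^k n, 2^k (n+1)]`. -/
def dyadic (k n : ℤ) : Set ℝ :=
  Set.Icc ((2 : ℝ) ^ k * n) ((2 : ℝ) ^ k * (n + 1))

/-- The smooth truncation `1*_{k,n} = 1_{I_{k,n}} * φ_k`. -/
def smoothInd (φ : 𝓢(ℝ, ℝ)) (k n : ℤ) (x : ℝ) : ℝ :=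
  ∫ y in dyadic k n, dil φ k (x - y)

/-- The truncated bilinear Fourier restriction operator `B_{j,m,n}(f,g)`. -/
def B (d : ℕ) (ρ₁ : ℝ → ℝ) (Φ₁ : 𝓢(ℝ, ℂ)) (φ : 𝓢(ℝ, ℝ)) (j : ℤ) (m : ℕ) (n : ℤ)
    (f g : ℝ → ℂ) (x : ℝ) : ℂ :=
  if 0 < j then
    (((2 : ℝ) ^ (-(((d : ℝ) - 1) * j / 2)) : ℝ) : ℂ) *
      (∫ t : ℝ, R Φ₁ f ((2 : ℝ) ^ (-(((d : ℝ) - 1) * j)) * x - 2 ^ m * t) *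
        R Φ₁ g (x - 2 ^ m * t ^ d) * (rho ρ₁ t : ℂ)) *
      (smoothInd φ (((d : ℤ) - 1) * |j| + m) n x : ℂ)
  else
    (((2 : ℝ) ^ (((d : ℝ) - 1) * j / 2) : ℝ) : ℂ) *
      (∫ t : ℝ, R Φ₁ f (x - 2 ^ m * t) *
        R Φ₁ g ((2 : ℝ) ^ (((d : ℝ) - 1) * j) * x - 2 ^ m * t ^ d) * (rho ρ₁ t : ℂ)) *
      (smoothInd φ (((d : ℤ) - 1) * |j| + m) n x : ℂ)

/-- The integrand of the pairing `⟨B_{j,m,n}(f₁ˇ, f₂ˇ), f₃ˇ⟩`, where `fˇ = 𝓕⁻ f`. -/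
def LambdaIntegrand (d : ℕ) (ρ₁ : ℝ → ℝ) (Φ₁ : 𝓢(ℝ, ℂ)) (φ : 𝓢(ℝ, ℝ))
    (j : ℤ) (m : ℕ) (n : ℤ) (f₁ f₂ f₃ : ℝ → ℂ) (x : ℝ) : ℂ :=
  B d ρ₁ Φ₁ φ j m n (𝓕⁻ f₁) (𝓕⁻ f₂) x * (starRingEnd ℂ) (𝓕⁻ f₃ x)

/-- The trilinear form `Λ_{j,m,n}(f₁,f₂,f₃) = ⟨B_{j,m,n}(f₁ˇ, f₂ˇ), f₃ˇ⟩`. -/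
def Lambda (d : ℕ) (ρ₁ : ℝ → ℝ) (Φ₁ : 𝓢(ℝ, ℂ)) (φ : 𝓢(ℝ, ℝ))
    (j : ℤ) (m : ℕ) (n : ℤ) (f₁ f₂ f₃ : ℝ → ℂ) : ℂ :=
  ∫ x : ℝ, LambdaIntegrand d ρ₁ Φ₁ φ j m n f₁ f₂ f₃ x

/-- The annulus `1/16 ≤ |ξ| ≤ 39/16` carrying the functions `f₁, f₂, f₃`. -/
def annulus : Set ℝ := {ξ | 1 / 16 ≤ |ξ| ∧ |ξ| ≤ 39 / 16}

end CurveTrilinear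

end

open scoped FourierTransform SchwartzMap ContDiff

noncomputable section

namespace CurveTrilinear

open MeasureTheory Set Complex
open scoped ENNReal ComplexConjugate

/-! Put K = (d-1)|j|, lam = 2^m and ε = 2^{-K}. On the Fourier side (`integral_curveAvg_mul`) the
form for j > 0 is 2^{-K/2} times the double integral of F(ξ) G(η) H(η + εξ) m(ξ,η), and for j ≤ 0
the argument of H is ξ + εη. Here F and G are f₁ and f₂ multiplied by the symbol of R_{Φ₁}, m(ξ,η)
is the integral of ρ(t) e^{-2πi lam (ξt + ηt^d)}, and H is the inverse transform of the cutoff times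
the conjugate of f₃ˇ. Since the cutoff lies between 0 and 1, Plancherel gives ‖H‖₂ ≤ ‖f₃‖₂. It
remains to gain lam^{-1/2} (lam ε)^{-1/6} from m.

Stationary phase supplies the factor lam^{-1/2}. Split into t > 0 and t < 0 and into signs of ξ and
η. If the two frequencies of a branch have the same sign there is no critical point and the symbol
is O(1/lam) (`exists_symb_nonstationary`). Otherwise, up to O(1/lam), the symbol is lam^{-1/2} times
a smooth amplitude times exp(i c lam ξ^{1+β} η^{-β}) with β = 1/(d-1) (`exists_symb_leading`).
Errors O(1/lam) are harmless, because lam ≥ 1 and ε ≤ 1 make 1/lam smaller than the target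
(`inv_le_decay`). The amplitude is ξ^{-1/2} times a Schwartz function of a combination of log ξ and
log η; Fourier inversion writes the latter as a superposition of products of unimodular functions of
ξ and of η, which are absorbed into F and G (`exists_amplitude_bound`).

The factor (lam ε)^{-1/6} comes from the model phase lam x^a y^b (`exists_model_bound`).
Cauchy-Schwarz in y removes G; expanding the square and shearing by v = y + εx, x' = x + τ leaves
H(v), H(v + ετ) and an inner x-integral with phase lam ((x+τ)^a - x^a)(v - εx)^b. A second
Cauchy-Schwarz in (τ,v) costs ε^{-1/2} and reduces matters to the v-integral of a difference of two
such phases. Its v-derivative has size lam |τ| |x - x'|, provided a is neither 0 nor 1, b ≠ 0 and ε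
is small, so two integrations by parts give an integrable kernel (`exists_kernel_bound`). The range
|τ| > τ₀ contributes (lam ε τ₀)^{-1/2} and the range |τ| ≤ τ₀ contributes τ₀. Balancing gives τ₀ =
(lam ε)^{-1/3}, and the square root of this is the gain. -/

/-! ### Integration by parts against oscillating exponentials -/

/-- The unimodular exponential `e^{iθ}` of a real number. -/
def osc (θ : ℝ) : ℂ := Complex.exp ((θ : ℂ) * Complex.I)

lemma norm_osc (θ : ℝ) : ‖osc θ‖ = 1 := Complex.norm_exp_ofReal_mul_I θ

lemma osc_add (s t : ℝ) : osc (s + t) = osc s * osc t := by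
  rw [osc, osc, osc, ← Complex.exp_add]; push_cast; ring_nf

lemma conj_osc (s : ℝ) : (starRingEnd ℂ) (osc s) = osc (-s) := by
  rw [osc, osc, ← Complex.exp_conj]; simp

lemma continuous_osc : Continuous osc := by unfold osc; fun_prop

lemma measurable_osc : Measurable osc := continuous_osc.measurable

lemma hasDerivAt_osc_comp {Ψ : ℝ → ℝ} {p v : ℝ} (h : HasDerivAt Ψ p v) :
    HasDerivAt (fun t => osc (Ψ t)) (osc (Ψ v) * ((p : ℂ) * Complex.I)) v := by
  unfold osc
  exact ((h.ofReal_comp).mul_const Complex.I).cexp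

/-- Integration by parts against an oscillating exponential. -/
lemma integral_mul_deriv_osc {a b : ℝ} {q q' Ψ Ψ' : ℝ → ℝ}
    (hq : ∀ v ∈ uIcc a b, HasDerivAt q (q' v) v) (hΨ : ∀ v ∈ uIcc a b, HasDerivAt Ψ (Ψ' v) v)
    (hq' : ContinuousOn q' (uIcc a b)) (hΨ' : ContinuousOn Ψ' (uIcc a b)) :
    ∫ v in a..b, ((q v * Ψ' v : ℝ) : ℂ) * osc (Ψ v)
      = -Complex.I * (q b * osc (Ψ b) - q a * osc (Ψ a))
        + Complex.I * ∫ v in a..b, (q' v : ℂ) * osc (Ψ v) := by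
  have hc : ContinuousOn Ψ (uIcc a b) := fun v hv => (hΨ v hv).continuousAt.continuousWithinAt
  have ho : ContinuousOn (fun v => osc (Ψ v)) (uIcc a b) := continuous_osc.comp_continuousOn hc
  have key := intervalIntegral.integral_mul_deriv_eq_deriv_mul (a := a) (b := b)
    (u := fun v => ((q v : ℝ) : ℂ)) (u' := fun v => ((q' v : ℝ) : ℂ))
    (v := fun v => osc (Ψ v)) (v' := fun v => osc (Ψ v) * ((Ψ' v : ℂ) * Complex.I))
    (fun v hv => (hq v hv).ofReal_comp) (fun v hv => hasDerivAt_osc_comp (hΨ v hv))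
    (ContinuousOn.intervalIntegrable (Complex.continuous_ofReal.comp_continuousOn hq'))
    (ContinuousOn.intervalIntegrable
      (ho.mul ((Complex.continuous_ofReal.comp_continuousOn hΨ').mul continuousOn_const)))
  have e : ∫ v in a..b, ((q v * Ψ' v : ℝ) : ℂ) * osc (Ψ v)
      = -Complex.I * ∫ v in a..b, ((q v : ℝ) : ℂ) * (osc (Ψ v) * ((Ψ' v : ℂ) * Complex.I)) := by
    rw [← intervalIntegral.integral_const_mul]
    congr 1; ext v; push_cast
    linear_combination ((q v : ℂ) * Ψ' v * osc (Ψ v)) * Complex.I_mul_I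
  rw [e, key]; ring

lemma norm_integral_mul_osc_le {a b M : ℝ} (hab : a ≤ b) {q Ψ : ℝ → ℝ}
    (h : ∀ v ∈ Icc a b, |q v| ≤ M) :
    ‖∫ v in a..b, (q v : ℂ) * osc (Ψ v)‖ ≤ M * (b - a) := by
  have := intervalIntegral.norm_integral_le_of_norm_le_const (a := a) (b := b) (C := M)
    (f := fun v => (q v : ℂ) * osc (Ψ v)) (fun v hv => by
      rw [uIoc_of_le hab] at hv
      rw [norm_mul, norm_osc, mul_one, Complex.norm_real]
      exact h v ⟨hv.1.le, hv.2⟩)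
  rwa [abs_of_nonneg (sub_nonneg.2 hab)] at this

/-- Second order non-stationary phase estimate. -/
lemma norm_integral_osc_le_inv_sq {a b M N D : ℝ} (hab : a ≤ b) (hN : 0 < N)
    (hD : 0 ≤ D) {χ χ₁ χ₂ Ψ Ψ₁ Ψ₂ Ψ₃ : ℝ → ℝ}
    (hχ : ∀ v ∈ Icc a b, HasDerivAt χ (χ₁ v) v) (hχ₁ : ∀ v ∈ Icc a b, HasDerivAt χ₁ (χ₂ v) v)
    (hχ₂ : ContinuousOn χ₂ (Icc a b))
    (hΨ : ∀ v ∈ Icc a b, HasDerivAt Ψ (Ψ₁ v) v) (hΨ₁ : ∀ v ∈ Icc a b, HasDerivAt Ψ₁ (Ψ₂ v) v)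
    (hΨ₂ : ∀ v ∈ Icc a b, HasDerivAt Ψ₂ (Ψ₃ v) v) (hΨ₃ : ContinuousOn Ψ₃ (Icc a b))
    (ha : χ a = 0) (hb : χ b = 0) (ha' : χ₁ a = 0) (hb' : χ₁ b = 0)
    (hM : ∀ v ∈ Icc a b, |χ v| ≤ M ∧ |χ₁ v| ≤ M ∧ |χ₂ v| ≤ M)
    (hlow : ∀ v ∈ Icc a b, N ≤ |Ψ₁ v|)
    (hup : ∀ v ∈ Icc a b, |Ψ₂ v| ≤ D * N ∧ |Ψ₃ v| ≤ D * N) :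
    ‖∫ v in a..b, (χ v : ℂ) * osc (Ψ v)‖ ≤ M * (1 + 4 * D + 3 * D ^ 2) / N ^ 2 * (b - a) := by
  have hu : uIcc a b = Icc a b := uIcc_of_le hab
  have hne : ∀ v ∈ Icc a b, Ψ₁ v ≠ 0 := fun v hv h0 => by
    have := hlow v hv; rw [h0, abs_zero] at this; linarith
  set p : ℝ → ℝ := fun v => (Ψ₁ v)⁻¹ with hp
  set p₁ : ℝ → ℝ := fun v => -Ψ₂ v * p v ^ 2 with hp1
  set p₂ : ℝ → ℝ := fun v => -Ψ₃ v * p v ^ 2 - Ψ₂ v * (2 * p v * p₁ v) with hp2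
  -- Each integration by parts divides the amplitude by Ψ₁. The second is applied to q₁ = (χ/Ψ₁)',
  -- whose quotient r = q₁/Ψ₁ also vanishes at the endpoints because both χ and χ₁ do.
  have dp : ∀ v ∈ Icc a b, HasDerivAt p (p₁ v) v := fun v hv => by
    have := (hΨ₁ v hv).inv (hne v hv)
    convert! this using 1
    simp only [hp1, hp]; field_simp
  have dp1 : ∀ v ∈ Icc a b, HasDerivAt p₁ (p₂ v) v := fun v hv => by
    have := ((hΨ₂ v hv).neg).mul ((dp v hv).pow 2)
    convert! this using 1
    simp only [hp2]; simp; ring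
  have cont : ∀ {F F' : ℝ → ℝ}, (∀ v ∈ Icc a b, HasDerivAt F (F' v) v) → ContinuousOn F (Icc a b) :=
    fun h v hv => (h v hv).continuousAt.continuousWithinAt
  set q : ℝ → ℝ := fun v => χ v * p v with hq
  set q₁ : ℝ → ℝ := fun v => χ₁ v * p v + χ v * p₁ v with hq1
  set r : ℝ → ℝ := fun v => q₁ v * p v with hr
  set r₁ : ℝ → ℝ := fun v => ((χ₂ v * p v + χ₁ v * p₁ v) + (χ₁ v * p₁ v + χ v * p₂ v)) * p v
      + q₁ v * p₁ v with hr1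
  have dq : ∀ v ∈ Icc a b, HasDerivAt q (q₁ v) v := fun v hv => (hχ v hv).mul (dp v hv)
  have dq1 : ∀ v ∈ Icc a b, HasDerivAt q₁
      ((χ₂ v * p v + χ₁ v * p₁ v) + (χ₁ v * p₁ v + χ v * p₂ v)) v := fun v hv =>
    ((hχ₁ v hv).mul (dp v hv)).add ((hχ v hv).mul (dp1 v hv))
  have dr : ∀ v ∈ Icc a b, HasDerivAt r (r₁ v) v := fun v hv => (dq1 v hv).mul (dp v hv)
  have cp := cont dp
  have cp1 := cont dp1
  have cp2 : ContinuousOn p₂ (Icc a b) :=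
    ((hΨ₃.neg).mul (cp.pow 2)).sub ((cont hΨ₂).mul ((continuousOn_const.mul cp).mul cp1))
  have cr1 : ContinuousOn r₁ (Icc a b) :=
    ((((hχ₂.mul cp).add ((cont hχ₁).mul cp1)).add (((cont hχ₁).mul cp1).add
      ((cont hχ).mul cp2))).mul cp).add ((cont dq1).mul cp1)
  have i1 := integral_mul_deriv_osc (a := a) (b := b) (hu ▸ dq) (hu ▸ hΨ) (hu ▸ cont dq1)
    (hu ▸ cont hΨ₁)
  have i2 := integral_mul_deriv_osc (a := a) (b := b) (hu ▸ dr) (hu ▸ hΨ) (hu ▸ cr1)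
    (hu ▸ cont hΨ₁)
  have e1 : ∫ v in a..b, (χ v : ℂ) * osc (Ψ v)
      = ∫ v in a..b, ((q v * Ψ₁ v : ℝ) : ℂ) * osc (Ψ v) := by
    apply intervalIntegral.integral_congr
    intro v hv
    rw [hu] at hv
    have := hne v hv
    simp only [hq, hp]
    rw [mul_assoc, inv_mul_cancel₀ this, mul_one]
  have e2 : ∫ v in a..b, (q₁ v : ℂ) * osc (Ψ v)
      = ∫ v in a..b, ((r v * Ψ₁ v : ℝ) : ℂ) * osc (Ψ v) := by
    apply intervalIntegral.integral_congr
    intro v hv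
    rw [hu] at hv
    have := hne v hv
    simp only [hr, hp]
    rw [mul_assoc, inv_mul_cancel₀ this, mul_one]
  rw [e1, i1, e2, i2]
  have qa : q a = 0 := by simp [hq, ha]
  have qb : q b = 0 := by simp [hq, hb]
  have ra : r a = 0 := by simp [hr, hq1, ha, ha']
  have rb : r b = 0 := by simp [hr, hq1, hb, hb']
  simp only [qa, qb, ra, rb, Complex.ofReal_zero, zero_mul, sub_zero, mul_zero, zero_add, norm_mul,
    Complex.norm_I, one_mul]
  apply norm_integral_mul_osc_le hab
  intro v hv
  obtain ⟨m0, m1, m2⟩ := hM v hv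
  obtain ⟨u2, u3⟩ := hup v hv
  have hM0 : 0 ≤ M := (abs_nonneg _).trans m0
  have b0 : |p v| ≤ N⁻¹ := by
    simp only [hp, abs_inv]; exact inv_anti₀ hN (hlow v hv)
  have hN1 : 0 ≤ N⁻¹ := by positivity
  have b1 : |p₁ v| ≤ D * N⁻¹ := by
    simp only [hp1, abs_mul, abs_neg, abs_pow]
    calc |Ψ₂ v| * |p v| ^ 2 ≤ (D * N) * (N⁻¹) ^ 2 := by gcongr
      _ = D * N⁻¹ := by field_simp
  have b2 : |p₂ v| ≤ (D + 2 * D ^ 2) * N⁻¹ := by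
    calc |p₂ v| ≤ |-Ψ₃ v * p v ^ 2| + |Ψ₂ v * (2 * p v * p₁ v)| := abs_sub _ _
      _ = |Ψ₃ v| * |p v| ^ 2 + |Ψ₂ v| * (2 * |p v| * |p₁ v|) := by
        simp only [abs_mul, abs_neg, abs_pow, Nat.abs_ofNat]
      _ ≤ (D * N) * (N⁻¹) ^ 2 + (D * N) * (2 * N⁻¹ * (D * N⁻¹)) := by gcongr
      _ = (D + 2 * D ^ 2) * N⁻¹ := by field_simp
  have bq1 : |q₁ v| ≤ M * N⁻¹ + M * (D * N⁻¹) := by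
    calc |q₁ v| ≤ |χ₁ v * p v| + |χ v * p₁ v| := abs_add_le _ _
      _ ≤ M * N⁻¹ + M * (D * N⁻¹) := by
        rw [abs_mul, abs_mul]; gcongr
  calc |r₁ v| ≤ ((|χ₂ v| * |p v| + |χ₁ v| * |p₁ v|) + (|χ₁ v| * |p₁ v| + |χ v| * |p₂ v|)) * |p v|
        + |q₁ v| * |p₁ v| := by
        simp only [hr1]
        refine (abs_add_le _ _).trans ?_
        rw [abs_mul, abs_mul]
        gcongr
        refine (abs_add_le _ _).trans ?_
        gcongr
        · exact (abs_add_le _ _).trans_eq (congrArg₂ (· + ·) (abs_mul _ _) (abs_mul _ _))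
        · exact (abs_add_le _ _).trans_eq (congrArg₂ (· + ·) (abs_mul _ _) (abs_mul _ _))
    _ ≤ ((M * N⁻¹ + M * (D * N⁻¹)) + (M * (D * N⁻¹) + M * ((D + 2 * D ^ 2) * N⁻¹))) * N⁻¹
        + (M * N⁻¹ + M * (D * N⁻¹)) * (D * N⁻¹) := by gcongr
    _ ≤ M * (1 + 4 * D + 3 * D ^ 2) / N ^ 2 := by
        rw [div_eq_mul_inv, ← inv_pow]
        apply le_of_eq; ring

/-! ### The differenced model phase and its kernel bound -/

/-- `u(x)(v-εx)^e` with `u(x) = (x+τ)^a - x^a`. -/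
def phaseTerm (a e ε τ v x : ℝ) : ℝ := ((x + τ) ^ a - x ^ a) * (v - ε * x) ^ e

lemma rpow_bounds {z e : ℝ} (n : ℕ) (hz : z ∈ Icc (1 / 40 : ℝ) 40) (he : |e| ≤ n) :
    ((40 : ℝ) ^ n)⁻¹ ≤ z ^ e ∧ z ^ e ≤ 40 ^ n := by
  have hz0 : 0 < z := lt_of_lt_of_le (by norm_num) hz.1
  obtain ⟨he1, he2⟩ := abs_le.1 he
  have hlog : |Real.log z| ≤ Real.log 40 := by
    rw [abs_le]; constructor
    · rw [← Real.log_inv]; apply Real.log_le_log (by norm_num); simpa using hz.1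
    · exact Real.log_le_log hz0 hz.2
  have key : |Real.log z * e| ≤ Real.log 40 * n := by
    rw [abs_mul]; gcongr
  have h40 : (40 : ℝ) ^ n = Real.exp (Real.log 40 * n) := by
    rw [← Real.rpow_def_of_pos (by norm_num), Real.rpow_natCast]
  obtain ⟨k1, k2⟩ := abs_le.1 key
  rw [Real.rpow_def_of_pos hz0, h40, ← Real.exp_neg]
  exact ⟨Real.exp_le_exp.2 k1, Real.exp_le_exp.2 k2⟩

/-- Two applications of the mean value theorem, first in x and then across the shift τ, extract the
factor (x' - x)τ. The term with a - 1 is the genuine mixed derivative; the term with ε comes from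
the shear and acts as a perturbation. All intermediate points stay in [1/40, 40], since v ≥ 1/20 and
|ε p| ≤ 19/800. -/
lemma phaseTerm_sub_eq {a e ε τ v x x' : ℝ} (hε : |ε| ≤ 1 / 100)
    (hx : x ∈ Icc (1 / 8 : ℝ) (19 / 8)) (hx' : x' ∈ Icc (1 / 8 : ℝ) (19 / 8))
    (hxτ : x + τ ∈ Icc (1 / 8 : ℝ) (19 / 8)) (hxτ' : x' + τ ∈ Icc (1 / 8 : ℝ) (19 / 8))
    (hv : v ∈ Icc (1 / 20 : ℝ) (51 / 20)) :
    ∃ z z' y : ℝ, z ∈ Icc (1 / 40 : ℝ) 40 ∧ z' ∈ Icc (1 / 40 : ℝ) 40 ∧ y ∈ Icc (1 / 40 : ℝ) 40 ∧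
      phaseTerm a e ε τ v x' - phaseTerm a e ε τ v x = ((x' - x) * τ * a) *
        ((a - 1) * z ^ (a - 2) * y ^ e - ε * e * z' ^ (a - 1) * y ^ (e - 1)) := by
  have mvt : ∀ {s t c : ℝ}, s ∈ Icc (1 / 8 : ℝ) (19 / 8) → t ∈ Icc (1 / 8 : ℝ) (19 / 8) →
      ∃ z ∈ Icc (1 / 8 : ℝ) (19 / 8), t ^ c - s ^ c = (t - s) * (c * z ^ (c - 1)) := by
    have aux : ∀ {s t c : ℝ}, s ∈ Icc (1 / 8 : ℝ) (19 / 8) → t ∈ Icc (1 / 8 : ℝ) (19 / 8) → s < t →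
      ∃ z ∈ Icc (1 / 8 : ℝ) (19 / 8), t ^ c - s ^ c = (t - s) * (c * z ^ (c - 1)) := by
      intro s t c hs ht hst
      have hd : ∀ y ∈ Icc s t, HasDerivAt (fun y : ℝ => y ^ c) (c * y ^ (c - 1)) y := fun y hy =>
        Real.hasDerivAt_rpow_const (Or.inl (by have := hs.1; have := hy.1; intro h; linarith))
      obtain ⟨z, hz, hz'⟩ := exists_hasDerivAt_eq_slope (fun y : ℝ => y ^ c)
        (fun y => c * y ^ (c - 1)) hst
        (fun y hy => (hd y hy).continuousAt.continuousWithinAt) (fun y hy => hd y ⟨hy.1.le, hy.2.le⟩)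
      refine ⟨z, ⟨hs.1.trans hz.1.le, hz.2.le.trans ht.2⟩, ?_⟩
      rw [hz']; field_simp [(sub_pos.2 hst).ne']
    intro s t c hs ht
    rcases lt_trichotomy s t with h | h | h
    · exact aux hs ht h
    · subst h; exact ⟨s, hs, by ring⟩
    · obtain ⟨z, hz, e⟩ := aux ht hs h (c := c)
      exact ⟨z, hz, by linarith⟩
  have hsub : ∀ {z : ℝ}, z ∈ Icc (1 / 8 : ℝ) (19 / 8) → z ∈ Icc (1 / 40 : ℝ) 40 := fun h =>
    ⟨by linarith [h.1], by linarith [h.2]⟩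
  have hy : ∀ {p : ℝ}, p ∈ Icc (1 / 8 : ℝ) (19 / 8) → v - ε * p ∈ Icc (1 / 40 : ℝ) 40 := by
    intro p hp
    have : |ε * p| ≤ 1 / 100 * (19 / 8) := by
      rw [abs_mul, abs_of_nonneg (by linarith [hp.1] : (0 : ℝ) ≤ p)]
      have := hp.2
      have := hp.1
      gcongr
    obtain ⟨h1, h2⟩ := abs_le.1 this
    exact ⟨by linarith [hv.1], by linarith [hv.2]⟩
  have dterm : ∀ p, p ∈ Icc (1 / 8 : ℝ) (19 / 8) → p + τ ∈ Icc (1 / 8 : ℝ) (19 / 8) →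
      HasDerivAt (phaseTerm a e ε τ v)
        ((a * (p + τ) ^ (a - 1) - a * p ^ (a - 1)) * (v - ε * p) ^ e
          + ((p + τ) ^ a - p ^ a) * (-ε * (e * (v - ε * p) ^ (e - 1)))) p := by
    intro p hp hpτ
    have h1 : HasDerivAt (fun p : ℝ => (p + τ) ^ a) (a * (p + τ) ^ (a - 1)) p := by
      have := ((hasDerivAt_id p).add_const τ).rpow_const (p := a)
        (Or.inl (by simp only [id]; linarith [hpτ.1]))
      convert! this using 1; simp
    have h2 : HasDerivAt (fun p : ℝ => p ^ a) (a * p ^ (a - 1)) p :=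
      Real.hasDerivAt_rpow_const (Or.inl (by linarith [hp.1]))
    have h3 : HasDerivAt (fun p : ℝ => (v - ε * p) ^ e) (-ε * (e * (v - ε * p) ^ (e - 1))) p := by
      have hl : HasDerivAt (fun p : ℝ => v - ε * p) (-ε) p := by
        simpa using ((hasDerivAt_id p).const_mul ε).const_sub v
      have := hl.rpow_const (p := e) (Or.inl (by linarith [(hy hp).1]))
      convert! this using 1; ring
    exact (h1.sub h2).mul h3
  have main : ∀ {x x' : ℝ}, x ∈ Icc (1 / 8 : ℝ) (19 / 8) → x' ∈ Icc (1 / 8 : ℝ) (19 / 8) →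
      x + τ ∈ Icc (1 / 8 : ℝ) (19 / 8) → x' + τ ∈ Icc (1 / 8 : ℝ) (19 / 8) → x ≤ x' →
      ∃ p, p ∈ Icc (1 / 8 : ℝ) (19 / 8) ∧ p + τ ∈ Icc (1 / 8 : ℝ) (19 / 8) ∧
      phaseTerm a e ε τ v x' - phaseTerm a e ε τ v x = (x' - x) *
        ((a * (p + τ) ^ (a - 1) - a * p ^ (a - 1)) * (v - ε * p) ^ e
          + ((p + τ) ^ a - p ^ a) * (-ε * (e * (v - ε * p) ^ (e - 1)))) := by
    intro x x' hx hx' hxτ hxτ' hle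
    rcases hle.eq_or_lt with h | h
    · subst h; exact ⟨x, hx, hxτ, by ring⟩
    have hin : ∀ p ∈ Icc x x', p ∈ Icc (1 / 8 : ℝ) (19 / 8) ∧ p + τ ∈ Icc (1 / 8 : ℝ) (19 / 8) :=
      fun p hp => ⟨⟨hx.1.trans hp.1, hp.2.trans hx'.2⟩,
        ⟨by linarith [hxτ.1, hp.1], by linarith [hxτ'.2, hp.2]⟩⟩
    obtain ⟨p, hp, hp'⟩ := exists_hasDerivAt_eq_slope (phaseTerm a e ε τ v) _ h
      (fun p hp => (dterm p (hin p hp).1 (hin p hp).2).continuousAt.continuousWithinAt)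
      (fun p hp => dterm p (hin p ⟨hp.1.le, hp.2.le⟩).1 (hin p ⟨hp.1.le, hp.2.le⟩).2)
    have := hin p ⟨hp.1.le, hp.2.le⟩
    refine ⟨p, this.1, this.2, ?_⟩
    rw [hp']; field_simp [(sub_pos.2 h).ne']
  have fin : ∃ p, p ∈ Icc (1 / 8 : ℝ) (19 / 8) ∧ p + τ ∈ Icc (1 / 8 : ℝ) (19 / 8) ∧
      phaseTerm a e ε τ v x' - phaseTerm a e ε τ v x = (x' - x) *
        ((a * (p + τ) ^ (a - 1) - a * p ^ (a - 1)) * (v - ε * p) ^ e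
          + ((p + τ) ^ a - p ^ a) * (-ε * (e * (v - ε * p) ^ (e - 1)))) := by
    rcases le_total x x' with h | h
    · exact main hx hx' hxτ hxτ' h
    · obtain ⟨p, h1, h2, h3⟩ := main hx' hx hxτ' hxτ h
      exact ⟨p, h1, h2, by linarith⟩
  obtain ⟨p, hp, hpτ, hE⟩ := fin
  obtain ⟨z, hz, ez⟩ := mvt hp hpτ (c := a - 1)
  obtain ⟨z', hz', ez'⟩ := mvt hp hpτ (c := a)
  refine ⟨z, z', v - ε * p, hsub hz, hsub hz', hy hp, ?_⟩
  rw [hE, ← mul_sub a, ez, ez']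
  rw [show a - 1 - 1 = a - 2 by ring]; ring

/-- A smooth bump equal to `1` on `[1/10, 5/2]` and vanishing outside `[1/20, 51/20]`. -/
def cutoff : ContDiffBump (13 / 10 : ℝ) where
  rIn := 6 / 5
  rOut := 5 / 4
  rIn_pos := by norm_num
  rIn_lt_rOut := by norm_num

lemma cutoff_contDiff {n : ℕ∞} : ContDiff ℝ n (cutoff : ℝ → ℝ) := cutoff.contDiff

lemma cutoff_eq_one {v : ℝ} (hv : v ∈ Icc (1 / 10 : ℝ) (5 / 2)) : cutoff v = 1 := by
  apply cutoff.one_of_mem_closedBall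
  rw [Metric.mem_closedBall, Real.dist_eq, abs_le]
  simp only [cutoff]
  exact ⟨by linarith [hv.1], by linarith [hv.2]⟩

lemma cutoff_eq_zero {v : ℝ} (hv : v ∉ Ioo (1 / 20 : ℝ) (51 / 20)) : cutoff v = 0 := by
  apply cutoff.zero_of_le_dist
  rw [Real.dist_eq]
  simp only [cutoff]
  by_contra h
  rw [not_le, abs_lt] at h
  exact hv ⟨by linarith [h.1], by linarith [h.2]⟩

lemma phaseTerm_hasDerivAt {a e ε τ v x : ℝ} (h : v - ε * x ≠ 0) :
    HasDerivAt (fun v => phaseTerm a e ε τ v x) (e * phaseTerm a (e - 1) ε τ v x) v := by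
  unfold phaseTerm
  have := (((hasDerivAt_id v).sub_const (ε * x)).rpow_const (p := e) (Or.inl h)).const_mul
    ((x + τ) ^ a - x ^ a)
  convert! this using 1; simp; ring

/-- Controls the second and third v-derivatives of the kernel phase, where the exponents b - 2 and b
- 3 occur; hence the range |e| ≤ 5. -/
lemma abs_phaseTerm_sub_le {a e ε τ v x x' : ℝ} (ha : |a| ≤ 2) (he : |e| ≤ 5) (hε : |ε| ≤ 1 / 100)
    (hx : x ∈ Icc (1 / 8 : ℝ) (19 / 8)) (hx' : x' ∈ Icc (1 / 8 : ℝ) (19 / 8))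
    (hxτ : x + τ ∈ Icc (1 / 8 : ℝ) (19 / 8)) (hxτ' : x' + τ ∈ Icc (1 / 8 : ℝ) (19 / 8))
    (hv : v ∈ Icc (1 / 20 : ℝ) (51 / 20)) :
    |phaseTerm a e ε τ v x' - phaseTerm a e ε τ v x| ≤ |(x' - x) * τ * a| * (4 * 40 ^ 9) := by
  obtain ⟨z, z', y, hz, hz', hy, h⟩ := phaseTerm_sub_eq (a := a) (e := e) hε hx hx' hxτ hxτ' hv
  rw [h, abs_mul]
  gcongr
  have pos : ∀ {z c : ℝ}, z ∈ Icc (1 / 40 : ℝ) 40 → 0 ≤ z ^ c := fun h =>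
    Real.rpow_nonneg (by linarith [h.1]) _
  obtain ⟨a1, a2⟩ := abs_le.1 ha
  obtain ⟨e1, e2⟩ := abs_le.1 he
  have b1 := (rpow_bounds (e := a - 2) 4 hz (abs_le.2 ⟨by norm_num; linarith, by norm_num; linarith⟩)).2
  have b2 := (rpow_bounds (e := e) 5 hy (by exact_mod_cast he)).2
  have b3 := (rpow_bounds (e := a - 1) 3 hz' (abs_le.2 ⟨by norm_num; linarith, by norm_num; linarith⟩)).2
  have b4 := (rpow_bounds (e := e - 1) 6 hy (abs_le.2 ⟨by norm_num; linarith, by norm_num; linarith⟩)).2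
  have c1 : |a - 1| ≤ 3 := abs_le.2 ⟨by linarith, by linarith⟩
  calc _ ≤ |(a - 1) * z ^ (a - 2) * y ^ e| + |ε * e * z' ^ (a - 1) * y ^ (e - 1)| := abs_sub _ _
    _ = |a - 1| * z ^ (a - 2) * y ^ e + |ε| * |e| * z' ^ (a - 1) * y ^ (e - 1) := by
      simp only [abs_mul, abs_of_nonneg (pos hz), abs_of_nonneg (pos hz'), abs_of_nonneg (pos hy)]
    _ ≤ 3 * 40 ^ 4 * 40 ^ 5 + 1 / 100 * 5 * 40 ^ 3 * 40 ^ 6 := by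
      have := pos hz (c := a - 2); have := pos hz' (c := a - 1)
      have := pos hy (c := e); have := pos hy (c := e - 1)
      gcongr
    _ ≤ 4 * 40 ^ 9 := by norm_num

/-- The mixed derivative term is at least |a-1| 40^{-7} and the shear term at most |ε||e| 40^7. The
smallness condition with the factor 2 · 40^14 says that the second is at most half of the first. -/
lemma le_abs_phaseTerm_sub {a e ε τ v x x' : ℝ} (ha : |a| ≤ 2) (he : |e| ≤ 3) (hε : |ε| ≤ 1 / 100)
    (hε' : |ε| * |e| * (2 * 40 ^ 14) ≤ |a - 1|)
    (hx : x ∈ Icc (1 / 8 : ℝ) (19 / 8)) (hx' : x' ∈ Icc (1 / 8 : ℝ) (19 / 8))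
    (hxτ : x + τ ∈ Icc (1 / 8 : ℝ) (19 / 8)) (hxτ' : x' + τ ∈ Icc (1 / 8 : ℝ) (19 / 8))
    (hv : v ∈ Icc (1 / 20 : ℝ) (51 / 20)) :
    |(x' - x) * τ * a| * (|a - 1| / (2 * 40 ^ 7)) ≤
      |phaseTerm a e ε τ v x' - phaseTerm a e ε τ v x| := by
  obtain ⟨z, z', y, hz, hz', hy, h⟩ := phaseTerm_sub_eq (a := a) (e := e) hε hx hx' hxτ hxτ' hv
  rw [h, abs_mul ((x' - x) * τ * a)]
  refine mul_le_mul_of_nonneg_left ?_ (abs_nonneg _)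
  have pos : ∀ {z c : ℝ}, z ∈ Icc (1 / 40 : ℝ) 40 → 0 ≤ z ^ c := fun h =>
    Real.rpow_nonneg (by linarith [h.1]) _
  obtain ⟨a1, a2⟩ := abs_le.1 ha
  obtain ⟨e1, e2⟩ := abs_le.1 he
  have b1 := (rpow_bounds (e := a - 2) 4 hz (abs_le.2 ⟨by norm_num; linarith, by norm_num; linarith⟩)).1
  have b2 := (rpow_bounds (e := e) 3 hy (by exact_mod_cast he)).1
  have b3 := (rpow_bounds (e := a - 1) 3 hz' (abs_le.2 ⟨by norm_num; linarith, by norm_num; linarith⟩)).2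
  have b4 := (rpow_bounds (e := e - 1) 4 hy (abs_le.2 ⟨by norm_num; linarith, by norm_num; linarith⟩)).2
  have p1 := pos hz (c := a - 2)
  have p2 := pos hz' (c := a - 1)
  have p3 := pos hy (c := e)
  have p4 := pos hy (c := e - 1)
  have l1 : |a - 1| * ((40 ^ 4)⁻¹ * (40 ^ 3)⁻¹) ≤ |(a - 1) * z ^ (a - 2) * y ^ e| := by
    simp only [abs_mul, abs_of_nonneg p1, abs_of_nonneg p3]
    rw [mul_assoc]
    gcongr
  have l2 : |ε * e * z' ^ (a - 1) * y ^ (e - 1)| ≤ |ε| * |e| * (40 ^ 3 * 40 ^ 4) := by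
    simp only [abs_mul, abs_of_nonneg p2, abs_of_nonneg p4]
    rw [mul_assoc (|ε| * |e|)]
    gcongr
  have l3 := abs_sub_abs_le_abs_sub ((a - 1) * z ^ (a - 2) * y ^ e) (ε * e * z' ^ (a - 1) * y ^ (e - 1))
  refine le_trans ?_ (le_trans (sub_le_sub l1 l2) l3)
  norm_num at hε' ⊢
  linarith

/-- The decay of the kernel obtained after two applications of Cauchy-Schwarz. -/
lemma exists_kernel_bound {a b : ℝ} (ha : |a| ≤ 2) (hb : |b| ≤ 2) (ha0 : a ≠ 0) (ha1 : a ≠ 1)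
    (hb0 : b ≠ 0) :
    ∃ C : ℝ, 0 < C ∧ ∀ lam ε τ x x' : ℝ, |ε| ≤ 1 / 100 →
      |ε| * |b - 1| * (2 * 40 ^ 14) ≤ |a - 1| →
      x ∈ Icc (1 / 8 : ℝ) (19 / 8) → x' ∈ Icc (1 / 8 : ℝ) (19 / 8) →
      x + τ ∈ Icc (1 / 8 : ℝ) (19 / 8) → x' + τ ∈ Icc (1 / 8 : ℝ) (19 / 8) →
      ‖∫ v, (cutoff v : ℂ) * osc (lam * (phaseTerm a b ε τ v x' - phaseTerm a b ε τ v x))‖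
        ≤ C / (1 + (lam * τ * (x' - x)) ^ 2) := by
  obtain ⟨b1, b2⟩ := abs_le.1 hb
  have d1 : Differentiable ℝ (cutoff : ℝ → ℝ) := (cutoff_contDiff (n := 1)).differentiable (by simp)
  have cd1 : ContDiff ℝ 2 (deriv (cutoff : ℝ → ℝ)) :=
    (contDiff_succ_iff_deriv.1 (cutoff_contDiff (n := 3) : ContDiff ℝ (2 + 1) _)).2.2
  have d2 : Differentiable ℝ (deriv (cutoff : ℝ → ℝ)) := cd1.differentiable (by simp)
  have c2 : Continuous (deriv (deriv (cutoff : ℝ → ℝ))) :=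
    (contDiff_succ_iff_deriv.1 (cd1.of_le (by norm_num) : ContDiff ℝ (0 + 1) _)).2.2.continuous
  obtain ⟨M, hM⟩ : ∃ M : ℝ, ∀ v ∈ Icc (1 / 20 : ℝ) (51 / 20), |cutoff v| ≤ M ∧
      |deriv (cutoff : ℝ → ℝ) v| ≤ M ∧ |deriv (deriv (cutoff : ℝ → ℝ)) v| ≤ M := by
    obtain ⟨M0, h0⟩ := isCompact_Icc.exists_bound_of_continuousOn
      (s := Icc (1 / 20 : ℝ) (51 / 20)) d1.continuous.continuousOn
    obtain ⟨M1, h1⟩ := isCompact_Icc.exists_bound_of_continuousOn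
      (s := Icc (1 / 20 : ℝ) (51 / 20)) d2.continuous.continuousOn
    obtain ⟨M2, h2⟩ := isCompact_Icc.exists_bound_of_continuousOn
      (s := Icc (1 / 20 : ℝ) (51 / 20)) c2.continuousOn
    exact ⟨max M0 (max M1 M2), fun v hv => ⟨(h0 v hv).trans (le_max_left _ _),
      (h1 v hv).trans ((le_max_left _ _).trans (le_max_right _ _)),
      (h2 v hv).trans ((le_max_right _ _).trans (le_max_right _ _))⟩⟩
  have hM0 : 0 ≤ M := (abs_nonneg _).trans (hM 1 (by constructor <;> norm_num)).1
  have z1 : ∀ v, v ∉ Ioo (1 / 20 : ℝ) (51 / 20) → deriv (cutoff : ℝ → ℝ) v = 0 := by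
    intro v hv
    have hmin : IsLocalMin (cutoff : ℝ → ℝ) v := by
      apply Filter.Eventually.of_forall
      intro w
      rw [cutoff_eq_zero hv]; exact cutoff.nonneg
    exact hmin.deriv_eq_zero
  set c0 : ℝ := |a - 1| / (2 * 40 ^ 7) with hc0
  have hc0p : 0 < c0 := by have := abs_pos.2 (sub_ne_zero.2 ha1); positivity
  -- The factor 12 = 3 · 4 bounds |b-1||b-2|, which appears in the third derivative of the phase.
  set D : ℝ := 12 * (4 * 40 ^ 9) / c0 with hD
  have hDp : 0 ≤ D := by positivity
  have hab : 0 < |a * b| := abs_pos.2 (mul_ne_zero ha0 hb0)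
  set A : ℝ := M * (1 + 4 * D + 3 * D ^ 2) / (|a * b| * c0) ^ 2 * (5 / 2) with hA
  have hA0 : 0 ≤ A := by positivity
  refine ⟨A + M * (5 / 2) + 1, by positivity, ?_⟩
  intro lam ε τ x x' hε hε' hx hx' hxτ hxτ'
  have hne : ∀ {p v : ℝ}, p ∈ Icc (1 / 8 : ℝ) (19 / 8) → v ∈ Icc (1 / 20 : ℝ) (51 / 20) →
      v - ε * p ≠ 0 := by
    intro p v hp hv
    have : |ε * p| ≤ 1 / 100 * (19 / 8) := by
      have := hp.1; have := hp.2
      rw [abs_mul, abs_of_nonneg (by linarith [hp.1] : (0 : ℝ) ≤ p)]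
      gcongr
    have := (abs_le.1 this).2
    have := hv.1
    intro h; linarith
  have eint : ∫ v, (cutoff v : ℂ) * osc (lam * (phaseTerm a b ε τ v x' - phaseTerm a b ε τ v x))
      = ∫ v in (1 / 20 : ℝ)..(51 / 20), ((cutoff v : ℝ) : ℂ) *
        osc (lam * (phaseTerm a b ε τ v x' - phaseTerm a b ε τ v x)) := by
    rw [intervalIntegral.integral_of_le (by norm_num), setIntegral_eq_integral_of_forall_compl_eq_zero]
    intro v hv
    rw [cutoff_eq_zero (fun h => hv ⟨h.1, h.2.le⟩)]; simp
  rw [eint]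
  have triv := norm_integral_mul_osc_le (a := 1 / 20) (b := 51 / 20) (by norm_num)
    (Ψ := fun v => lam * (phaseTerm a b ε τ v x' - phaseTerm a b ε τ v x)) (fun v hv => (hM v hv).1)
  set s := lam * τ * (x' - x) with hs
  -- The trivial bound M · 5/2 and the decay A/s² add up to a bound for (1 + s²) times the integral;
  -- s = 0 is separated because the decay estimate divides by s.
  by_cases hs0 : s = 0
  · rw [hs0]
    refine triv.trans ?_
    norm_num; linarith
  have hsp : 0 < |s| := abs_pos.2 hs0
  have hN : 0 < |s| * |a * b| * c0 := by positivity
  have key := norm_integral_osc_le_inv_sq (a := 1 / 20) (b := 51 / 20) (M := M)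
    (N := |s| * |a * b| * c0) (D := D) (by norm_num) hN hDp
    (χ := cutoff) (χ₁ := deriv cutoff) (χ₂ := deriv (deriv cutoff))
    (Ψ := fun v => lam * (phaseTerm a b ε τ v x' - phaseTerm a b ε τ v x))
    (Ψ₁ := fun v => lam * (b * (phaseTerm a (b - 1) ε τ v x' - phaseTerm a (b - 1) ε τ v x)))
    (Ψ₂ := fun v => lam * (b * ((b - 1) *
      (phaseTerm a (b - 1 - 1) ε τ v x' - phaseTerm a (b - 1 - 1) ε τ v x))))
    (Ψ₃ := fun v => lam * (b * ((b - 1) * ((b - 1 - 1) *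
      (phaseTerm a (b - 1 - 1 - 1) ε τ v x' - phaseTerm a (b - 1 - 1 - 1) ε τ v x)))))
    (fun v _ => (d1 v).hasDerivAt) (fun v _ => (d2 v).hasDerivAt) c2.continuousOn
    (fun v hv => by
      rw [mul_sub b]
      exact (((phaseTerm_hasDerivAt (hne hx' hv)).sub
        (phaseTerm_hasDerivAt (hne hx hv))).const_mul lam))
    (fun v hv => by
      rw [mul_sub (b - 1)]
      exact (((phaseTerm_hasDerivAt (hne hx' hv)).sub
        (phaseTerm_hasDerivAt (hne hx hv))).const_mul b).const_mul lam)
    (fun v hv => by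
      rw [mul_sub (b - 1 - 1)]
      exact ((((phaseTerm_hasDerivAt (hne hx' hv)).sub
        (phaseTerm_hasDerivAt (hne hx hv))).const_mul (b - 1)).const_mul b).const_mul lam)
    (fun v hv => by
      have := ((((((phaseTerm_hasDerivAt (a := a) (e := b - 1 - 1 - 1) (τ := τ) (hne hx' hv)).sub
        (phaseTerm_hasDerivAt (a := a) (e := b - 1 - 1 - 1) (τ := τ) (hne hx hv))).const_mul (b - 1 - 1)).const_mul (b - 1)).const_mul
          b).const_mul lam).continuousAt
      exact this.continuousWithinAt)
    (cutoff_eq_zero (by simp)) (cutoff_eq_zero (by simp)) (z1 _ (by simp)) (z1 _ (by simp)) hM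
    (fun v hv => by
      have := le_abs_phaseTerm_sub (e := b - 1) (v := v) ha
        (abs_le.2 ⟨by linarith, by linarith⟩) hε hε' hx hx' hxτ hxτ' hv
      rw [abs_mul lam, abs_mul b]
      calc |s| * |a * b| * c0 = |lam| * (|b| * (|(x' - x) * τ * a| * c0)) := by
            rw [hs]; simp only [abs_mul]; ring
        _ ≤ _ := by gcongr)
    (fun v hv => by
      have h2 := abs_phaseTerm_sub_le (e := b - 1 - 1) (v := v) ha
        (abs_le.2 ⟨by linarith, by linarith⟩) hε hx hx' hxτ hxτ' hv
      have h3 := abs_phaseTerm_sub_le (e := b - 1 - 1 - 1) (v := v) ha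
        (abs_le.2 ⟨by linarith, by linarith⟩) hε hx hx' hxτ hxτ' hv
      have hDN : D * (|s| * |a * b| * c0) =
          |lam| * (|b| * (12 * (|(x' - x) * τ * a| * (4 * 40 ^ 9)))) := by
        rw [hs, hD]; simp only [abs_mul]; field_simp
      have k1 : |b - 1| ≤ 3 := abs_le.2 ⟨by linarith, by linarith⟩
      have k2 : |b - 1 - 1| ≤ 4 := abs_le.2 ⟨by linarith, by linarith⟩
      rw [hDN]
      constructor
      · rw [abs_mul lam, abs_mul b, abs_mul (b - 1)]
        gcongr
        linarith
      · rw [abs_mul lam, abs_mul b, abs_mul (b - 1), abs_mul (b - 1 - 1), ← mul_assoc |b - 1|]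
        gcongr
        nlinarith [abs_nonneg (b - 1), abs_nonneg (b - 1 - 1)])
  have keyA : ‖∫ v in (1 / 20 : ℝ)..(51 / 20), ((cutoff v : ℝ) : ℂ) *
        osc (lam * (phaseTerm a b ε τ v x' - phaseTerm a b ε τ v x))‖ ≤ A / s ^ 2 := by
    refine key.trans (le_of_eq ?_)
    rw [hA, ← sq_abs s]
    rw [show (51 / 20 - 1 / 20 : ℝ) = 5 / 2 by norm_num]
    field_simp
  rw [le_div_iff₀ (by positivity)]
  rw [le_div_iff₀ (by positivity)] at keyA
  have : M * (51 / 20 - 1 / 20) = M * (5 / 2) := by norm_num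
  rw [this] at triv
  nlinarith

/-! ### Cauchy-Schwarz, convolution and T T* inequalities -/

/-- The square of the `L²` norm, as an extended nonnegative real. -/
def sqNorm (f : ℝ → ℂ) : ℝ≥0∞ := ∫⁻ x, ‖f x‖ₑ ^ 2

lemma sq_lintegral_mul_le {α : Type*} [MeasurableSpace α] (μ : Measure α) {u w : α → ℝ≥0∞}
    (hu : AEMeasurable u μ) (hw : AEMeasurable w μ) :
    (∫⁻ a, u a * w a ∂μ) ^ 2 ≤ (∫⁻ a, u a ^ 2 ∂μ) * ∫⁻ a, w a ^ 2 ∂μ := by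
  have h := ENNReal.lintegral_mul_le_Lp_mul_Lq μ Real.HolderConjugate.two_two hu hw
  simp only [Pi.mul_apply, ENNReal.rpow_two] at h
  calc _ ≤ ((∫⁻ a, u a ^ 2 ∂μ) ^ (1 / (2 : ℝ)) * (∫⁻ a, w a ^ 2 ∂μ) ^ (1 / (2 : ℝ))) ^ 2 := by
        gcongr
    _ = _ := by
      rw [mul_pow, ← ENNReal.rpow_two, ← ENNReal.rpow_two, ← ENNReal.rpow_mul, ← ENNReal.rpow_mul]
      norm_num

lemma lintegral_mul_le_of_sq_le {α : Type*} [MeasurableSpace α] (μ : Measure α) {u w : α → ℝ≥0∞}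
    (hu : AEMeasurable u μ) (hw : AEMeasurable w μ) {A : ℝ≥0∞} (h1 : ∫⁻ a, u a ^ 2 ∂μ ≤ A)
    (h2 : ∫⁻ a, w a ^ 2 ∂μ ≤ A) : ∫⁻ a, u a * w a ∂μ ≤ A := by
  rw [← ENNReal.pow_le_pow_left_iff two_ne_zero, sq A]
  exact (sq_lintegral_mul_le μ hu hw).trans (mul_le_mul' h1 h2)

lemma lintegral_mul_translate_le {u : ℝ → ℝ≥0∞} (hu : Measurable u) (s : ℝ) :
    ∫⁻ x, u x * u (x + s) ≤ ∫⁻ x, u x ^ 2 :=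
  lintegral_mul_le_of_sq_le _ hu.aemeasurable (by fun_prop) le_rfl
    (lintegral_add_right_eq_self (fun x => u x ^ 2) s).le

lemma lintegral_comp_add_mul {u : ℝ → ℝ≥0∞} (hu : Measurable u) {ε : ℝ} (hε : ε ≠ 0) (v : ℝ) :
    ∫⁻ t, u (v + ε * t) = ENNReal.ofReal |ε⁻¹| * ∫⁻ t, u t := by
  have h1 : ∫⁻ t, u (v + ε * t) = ∫⁻ s, u (v + s) ∂(Measure.map (ε * ·) volume) := by
    rw [lintegral_map (by fun_prop) (by fun_prop)]
  rw [h1, Real.map_volume_mul_left hε, lintegral_smul_measure, lintegral_add_left_eq_self u v]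
  rfl

lemma lintegral_translate_prod {u w : ℝ → ℝ≥0∞} (hu : Measurable u) (hw : Measurable w) {ε : ℝ}
    (hε : ε ≠ 0) :
    ∫⁻ t, ∫⁻ x, u x * w (x + ε * t) = ENNReal.ofReal |ε⁻¹| * ((∫⁻ x, u x) * ∫⁻ x, w x) := by
  rw [lintegral_lintegral_swap (by fun_prop)]
  have : ∀ x, ∫⁻ t, u x * w (x + ε * t) = ENNReal.ofReal |ε⁻¹| * (u x * ∫⁻ t, w t) := by
    intro x
    rw [lintegral_const_mul _ (by fun_prop), lintegral_comp_add_mul hw hε]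
    ring
  simp only [this]
  rw [lintegral_const_mul _ (by fun_prop), lintegral_mul_const _ hu]

/-- Young's inequality in bilinear form: after x' = x + s, each s contributes κ(s) times an
autocorrelation of u, and Cauchy-Schwarz bounds that by ‖u‖₂². -/
lemma lintegral_convolution_le {u κ : ℝ → ℝ≥0∞} (hu : Measurable u) (hκ : Measurable κ) :
    ∫⁻ x, ∫⁻ x', u x * u x' * κ (x' - x) ≤ (∫⁻ s, κ s) * ∫⁻ x, u x ^ 2 := by
  have e : ∀ x, ∫⁻ x', u x * u x' * κ (x' - x) = ∫⁻ s, κ s * (u x * u (x + s)) := by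
    intro x
    rw [← lintegral_add_left_eq_self (fun x' => u x * u x' * κ (x' - x)) x]
    congr 1; ext s; rw [add_sub_cancel_left]; ring
  simp only [e]
  rw [lintegral_lintegral_swap (by fun_prop), ← lintegral_mul_const _ hκ]
  refine lintegral_mono fun s => ?_
  dsimp only
  rw [lintegral_const_mul _ (by fun_prop)]
  exact mul_le_mul_right (lintegral_mul_translate_le hu s) _

lemma lintegral_lorentz {C A : ℝ} (hC : 0 ≤ C) (hA : A ≠ 0) :
    ∫⁻ s, ENNReal.ofReal (C / (1 + (A * s) ^ 2)) = ENNReal.ofReal (C * Real.pi / |A|) := by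
  have h1 : ∫⁻ s, ENNReal.ofReal (C / (1 + s ^ 2)) = ENNReal.ofReal (C * Real.pi) := by
    rw [← integral_univ_inv_one_add_sq, ← integral_const_mul,
      ofReal_integral_eq_lintegral_ofReal (integrable_inv_one_add_sq.const_mul C)]
    · rfl
    · exact Filter.Eventually.of_forall fun s => by positivity
  have h2 := lintegral_comp_add_mul (u := fun s => ENNReal.ofReal (C / (1 + s ^ 2)))
    (by fun_prop) hA 0
  simp only [zero_add] at h2
  rw [h2, h1, ← ENNReal.ofReal_mul (abs_nonneg _), abs_inv]
  congr 1; field_simp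

lemma enorm_conj_eq (z : ℂ) : ‖conj z‖ₑ = ‖z‖ₑ := by
  rw [← ofReal_norm, RCLike.norm_conj, ofReal_norm]

/-- The `T T*` expansion of a weighted `L²` norm. -/
lemma lintegral_weight_sq_le {F : ℝ → ℂ} (hF : Integrable F) (hFm : Measurable F)
    {W : ℝ → ℝ → ℂ}
    (hW : Measurable (Function.uncurry W)) (hW1 : ∀ x v, ‖W x v‖ ≤ 1) {χ : ℝ → ℝ}
    (hχ : Integrable χ) (hχm : Measurable χ) (hχ0 : ∀ v, 0 ≤ χ v) :
    ∫⁻ v, ENNReal.ofReal (χ v) * ‖∫ x, F x * W x v‖ₑ ^ 2 ≤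
      ∫⁻ x, ∫⁻ x', ‖F x‖ₑ * ‖F x'‖ₑ * ‖∫ v, (χ v : ℂ) * (W x v * conj (W x' v))‖ₑ := by
  set Z : ℝ × (ℝ × ℝ) → ℂ := fun q =>
    (χ q.1 : ℂ) * ((F q.2.1 * W q.2.1 q.1) * conj (F q.2.2 * W q.2.2 q.1)) with hZ
  have hWm : ∀ {α : Type} [MeasurableSpace α] {p q : α → ℝ}, Measurable p → Measurable q →
      Measurable (fun a => W (p a) (q a)) := fun hp hq => hW.comp (hp.prodMk hq)
  have hcm : Measurable (fun z : ℂ => conj z) := Complex.continuous_conj.measurable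
  have hZm : Measurable Z := by
    refine (Complex.measurable_ofReal.comp (hχm.comp measurable_fst)).mul
      (((hFm.comp (measurable_fst.comp measurable_snd)).mul
        (hWm (measurable_fst.comp measurable_snd) measurable_fst)).mul
        (hcm.comp ((hFm.comp (measurable_snd.comp measurable_snd)).mul
          (hWm (measurable_snd.comp measurable_snd) measurable_fst))))
  -- Joint integrability uses only F in L¹, χ in L¹ and |W| ≤ 1. It permits the v-integral to be
  -- done first, which exposes the kernel.
  have hZi : Integrable Z (volume.prod (volume.prod volume)) := by
    have hb : Integrable (fun q : ℝ × (ℝ × ℝ) => χ q.1 * (‖F q.2.1‖ * ‖F q.2.2‖))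
        (volume.prod (volume.prod volume)) :=
      hχ.mul_prod (hF.norm.mul_prod hF.norm)
    refine hb.mono hZm.aestronglyMeasurable (Filter.Eventually.of_forall fun q => ?_)
    simp only [hZ, norm_mul, Complex.norm_real, RCLike.norm_conj, norm_norm]
    gcongr
    · exact mul_le_of_le_one_right (norm_nonneg _) (hW1 _ _)
    · exact mul_le_of_le_one_right (norm_nonneg _) (hW1 _ _)
  set K : ℝ → ℂ := fun v => ∫ x, F x * W x v with hK
  have e1 : ∀ v, ∫ p : ℝ × ℝ, Z (v, p) = (χ v : ℂ) * (K v * conj (K v)) := by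
    intro v
    simp only [hZ]
    rw [integral_const_mul]
    congr 1
    rw [Measure.volume_eq_prod, integral_prod_mul (fun x => F x * W x v)
      (fun x => conj (F x * W x v)), integral_conj]
  have e2 : ∀ v, (χ v : ℂ) * (K v * conj (K v)) = ((χ v * ‖K v‖ ^ 2 : ℝ) : ℂ) := by
    intro v; rw [Complex.mul_conj, Complex.normSq_eq_norm_sq]; push_cast; ring
  have hInt : Integrable (fun v => χ v * ‖K v‖ ^ 2) := by
    have h := hZi.integral_prod_left
    have h' := h.norm
    refine h'.congr (Filter.Eventually.of_forall fun v => ?_)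
    have := e1 v
    simp only [Measure.volume_eq_prod] at this
    dsimp only
    rw [this, e2, Complex.norm_real, Real.norm_of_nonneg (by have := hχ0 v; positivity)]
  have e3 : ∫ q, Z q ∂(volume.prod (volume.prod volume)) = ((∫ v, χ v * ‖K v‖ ^ 2 : ℝ) : ℂ) := by
    rw [integral_prod _ hZi, ← integral_complex_ofReal]
    congr 1; ext v
    have := e1 v
    simp only [Measure.volume_eq_prod] at this
    rw [this, e2]
  have lhs : ∫⁻ v, ENNReal.ofReal (χ v) * ‖K v‖ₑ ^ 2
      = ‖∫ q, Z q ∂(volume.prod (volume.prod volume))‖ₑ := by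
    have : ∀ v, ENNReal.ofReal (χ v) * ‖K v‖ₑ ^ 2 = ENNReal.ofReal (χ v * ‖K v‖ ^ 2) := by
      intro v
      rw [ENNReal.ofReal_mul (hχ0 v), ENNReal.ofReal_pow (norm_nonneg _), ofReal_norm]
    simp only [this]
    rw [← ofReal_integral_eq_lintegral_ofReal hInt
      (Filter.Eventually.of_forall fun v => by have := hχ0 v; positivity), e3,
      ← ofReal_norm, Complex.norm_real, Real.norm_of_nonneg]
    exact integral_nonneg fun v => by have := hχ0 v; positivity
  rw [lhs, integral_prod_symm _ hZi]
  refine (enorm_integral_le_lintegral_enorm _).trans ?_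
  have hmeas : AEMeasurable (fun p : ℝ × ℝ => ‖∫ v, Z (v, p)‖ₑ) (volume.prod volume) :=
    hZi.swap.integral_prod_left.aestronglyMeasurable.enorm
  rw [lintegral_prod _ hmeas]
  refine lintegral_mono fun x => lintegral_mono fun x' => le_of_eq ?_
  simp only [hZ]
  rw [← enorm_conj_eq (F x'), ← enorm_mul, ← enorm_mul, ← integral_const_mul]
  congr 2; ext v
  simp only [map_mul]; ring

/-! ### Correlation integrals: small and large shifts -/

/-- The shear `((τ, v), x) ↦ (v - εx, (x, x + τ))` preserves Lebesgue measure. -/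
lemma measurePreserving_shear (ε : ℝ) :
    MeasurePreserving (fun q : (ℝ × ℝ) × ℝ => (q.1.2 - ε * q.2, (q.2, q.2 + q.1.1)))
      ((volume.prod volume).prod volume) (volume.prod (volume.prod volume)) := by
  have h1 : MeasurePreserving (Prod.swap : (ℝ × ℝ) × ℝ → ℝ × (ℝ × ℝ))
      ((volume.prod volume).prod volume) (volume.prod (volume.prod volume)) :=
    Measure.measurePreserving_swap
  have h2 : MeasurePreserving (fun p : ℝ × (ℝ × ℝ) => (p.1, (p.1 + p.2.1, p.2.2 - ε * p.1)))
      (volume.prod (volume.prod volume)) (volume.prod (volume.prod volume)) := by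
    refine (MeasurePreserving.id volume).skew_product
      (g := fun x (p : ℝ × ℝ) => (x + p.1, p.2 - ε * x)) ?_ ?_
    · simp only [Function.uncurry_def]; fun_prop
    · refine Filter.Eventually.of_forall fun x => ?_
      exact ((measurePreserving_add_left volume x).prod
        (measurePreserving_sub_right volume (ε * x))).map_eq
  have h3 : MeasurePreserving (MeasurableEquiv.prodAssoc : (ℝ × ℝ) × ℝ ≃ᵐ ℝ × ℝ × ℝ).symm
      (volume.prod (volume.prod volume)) ((volume.prod volume).prod volume) :=
    (measurePreserving_prodAssoc volume volume volume).symm _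
  have h4 : MeasurePreserving (Prod.swap : (ℝ × ℝ) × ℝ → ℝ × (ℝ × ℝ))
      ((volume.prod volume).prod volume) (volume.prod (volume.prod volume)) :=
    Measure.measurePreserving_swap
  exact ((h4.comp h3).comp h2).comp h1

/-- The correlation phase `E(x, v - εx) conj E(x + τ, v - εx)`. -/
def corrPhase (E : ℝ → ℝ → ℂ) (ε τ x v : ℝ) : ℂ := E x (v - ε * x) * conj (E (x + τ) (v - ε * x))

lemma integrable_mul_translate {f : ℝ → ℂ} (hf : Measurable f) (hf2 : sqNorm f < ⊤) (τ : ℝ) :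
    Integrable (fun x => f x * conj (f (x + τ))) := by
  have hcm : Measurable (fun z : ℂ => conj z) := Complex.continuous_conj.measurable
  refine ⟨(hf.mul (hcm.comp (hf.comp (measurable_id.add_const τ)))).aestronglyMeasurable, ?_⟩
  refine lt_of_le_of_lt ?_ hf2
  simp only [enorm_mul, enorm_conj_eq]
  exact lintegral_mul_translate_le hf.enorm τ

/-- The correlation integral appearing after the first application of Cauchy-Schwarz. -/
def corrIntegral (f : ℝ → ℂ) (E : ℝ → ℝ → ℂ) (ε τ v : ℝ) : ℂ :=
  ∫ x, f x * conj (f (x + τ)) * corrPhase E ε τ x v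

lemma measurable_corrPhase {E : ℝ → ℝ → ℂ} (hE : Measurable (Function.uncurry E)) (ε : ℝ) :
    Measurable (fun q : (ℝ × ℝ) × ℝ => corrPhase E ε q.1.1 q.2 q.1.2) := by
  have hEm : ∀ {α : Type} [MeasurableSpace α] {p q : α → ℝ}, Measurable p → Measurable q →
      Measurable (fun a => E (p a) (q a)) := fun hp hq => hE.comp (hp.prodMk hq)
  have hcm : Measurable (fun z : ℂ => conj z) := Complex.continuous_conj.measurable
  exact (hEm (by fun_prop) (by fun_prop)).mul (hcm.comp (hEm (by fun_prop) (by fun_prop)))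

lemma norm_corrPhase_le {E : ℝ → ℝ → ℂ} (hE1 : ∀ x y, ‖E x y‖ ≤ 1) (ε τ x v : ℝ) :
    ‖corrPhase E ε τ x v‖ ≤ 1 := by
  rw [corrPhase, norm_mul, RCLike.norm_conj]
  exact mul_le_one₀ (hE1 _ _) (norm_nonneg _) (hE1 _ _)

lemma measurable_corrIntegral {f : ℝ → ℂ} (hf : Measurable f) {E : ℝ → ℝ → ℂ}
    (hE : Measurable (Function.uncurry E)) (ε : ℝ) :
    Measurable (fun p : ℝ × ℝ => corrIntegral f E ε p.1 p.2) := by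
  have hcm : Measurable (fun z : ℂ => conj z) := Complex.continuous_conj.measurable
  have : StronglyMeasurable (fun q : (ℝ × ℝ) × ℝ =>
      f q.2 * conj (f (q.2 + q.1.1)) * corrPhase E ε q.1.1 q.2 q.1.2) :=
    (((hf.comp measurable_snd).mul (hcm.comp (hf.comp (by fun_prop)))).mul
      (measurable_corrPhase hE ε)).stronglyMeasurable
  exact (this.integral_prod_right (ν := volume)).measurable

/-- The first Cauchy-Schwarz step: expansion of the square and change of variables. -/
lemma lintegral_sq_le_corr {f h : ℝ → ℂ} (hf : Measurable f) (hh : Measurable h)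
    (hf1 : Integrable f) (hh2 : sqNorm h < ⊤)
    {E : ℝ → ℝ → ℂ} (hE : Measurable (Function.uncurry E)) (hE1 : ∀ x y, ‖E x y‖ ≤ 1) (ε : ℝ) :
    ∫⁻ y, ‖∫ x, f x * h (y + ε * x) * E x y‖ₑ ^ 2 ≤
      ∫⁻ τ, ∫⁻ v, ‖h v‖ₑ * ‖h (v + ε * τ)‖ₑ * ‖corrIntegral f E ε τ v‖ₑ := by
  have hEm : ∀ {α : Type} [MeasurableSpace α] {p q : α → ℝ}, Measurable p → Measurable q →
      Measurable (fun a => E (p a) (q a)) := fun hp hq => hE.comp (hp.prodMk hq)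
  have hcm : Measurable (fun z : ℂ => conj z) := Complex.continuous_conj.measurable
  set u : ℝ → ℝ → ℂ := fun y x => f x * h (y + ε * x) * E x y with hu
  set S : ℝ → ℂ := fun y => ∫ x, u y x with hS
  set Z : ℝ × (ℝ × ℝ) → ℂ := fun q => u q.1 q.2.1 * conj (u q.1 q.2.2) with hZ
  have hum : ∀ {α : Type} [MeasurableSpace α] {p q : α → ℝ}, Measurable p → Measurable q →
      Measurable (fun a => u (p a) (q a)) := fun hp hq =>
    ((hf.comp hq).mul (hh.comp (by fun_prop))).mul (hEm hq hp)
  have hZm : Measurable Z := (hum (by fun_prop) (by fun_prop)).mul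
    (hcm.comp (hum (by fun_prop) (by fun_prop)))
  -- Integrating in y first, Cauchy-Schwarz bounds the two copies of h by ‖h‖₂² uniformly in x and
  -- x'; the remaining factor is ‖f‖₁².
  have hZi : Integrable Z (volume.prod (volume.prod volume)) := by
    refine ⟨hZm.aestronglyMeasurable, ?_⟩
    rw [HasFiniteIntegral, lintegral_prod_symm _ hZm.enorm.aemeasurable]
    have hb : ∀ p : ℝ × ℝ, ∫⁻ y, ‖Z (y, p)‖ₑ ≤ (‖f p.1‖ₑ * ‖f p.2‖ₑ) * sqNorm h := by
      intro p
      have : ∀ y, ‖Z (y, p)‖ₑ ≤ (‖f p.1‖ₑ * ‖f p.2‖ₑ) * (‖h (y + ε * p.1)‖ₑ * ‖h (y + ε * p.2)‖ₑ) := by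
        intro y
        have e1 : ∀ x y, ‖E x y‖ₑ ≤ 1 := fun x y => by
          rw [← ofReal_norm]; exact ENNReal.ofReal_le_one.2 (hE1 x y)
        simp only [hZ, hu, enorm_mul, enorm_conj_eq]
        calc _ ≤ ‖f p.1‖ₑ * ‖h (y + ε * p.1)‖ₑ * 1 * (‖f p.2‖ₑ * ‖h (y + ε * p.2)‖ₑ * 1) := by
              gcongr <;> exact e1 _ _
          _ = _ := by ring
      refine (lintegral_mono this).trans ?_
      rw [lintegral_const_mul _ (by fun_prop)]
      gcongr
      exact lintegral_mul_le_of_sq_le _ (by fun_prop) (by fun_prop)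
        (lintegral_add_right_eq_self (fun x => ‖h x‖ₑ ^ 2) _).le
        (lintegral_add_right_eq_self (fun x => ‖h x‖ₑ ^ 2) _).le
    refine (lintegral_mono hb).trans_lt ?_
    rw [lintegral_mul_const _ (by fun_prop)]
    refine ENNReal.mul_lt_top ?_ hh2
    rw [lintegral_prod_mul (f := fun x => ‖f x‖ₑ) (g := fun x => ‖f x‖ₑ) (by fun_prop) (by fun_prop)]
    exact ENNReal.mul_lt_top hf1.2 hf1.2
  have e1 : ∀ y, ∫ p : ℝ × ℝ, Z (y, p) ∂(volume.prod volume) = ((‖S y‖ ^ 2 : ℝ) : ℂ) := by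
    intro y
    simp only [hZ]
    rw [integral_prod_mul (fun x => u y x) (fun x => conj (u y x)), integral_conj,
      Complex.mul_conj, Complex.normSq_eq_norm_sq]
  have hInt : Integrable (fun y => ‖S y‖ ^ 2) := by
    refine hZi.integral_prod_left.norm.congr (Filter.Eventually.of_forall fun y => ?_)
    dsimp only
    rw [e1, Complex.norm_real, Real.norm_of_nonneg (by positivity)]
  have e3 : ∫ q, Z q ∂(volume.prod (volume.prod volume)) = ((∫ y, ‖S y‖ ^ 2 : ℝ) : ℂ) := by
    rw [integral_prod _ hZi, ← integral_complex_ofReal]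
    congr 1; ext y; rw [e1]
  have lhs : ∫⁻ y, ‖S y‖ₑ ^ 2 = ‖∫ q, Z q ∂(volume.prod (volume.prod volume))‖ₑ := by
    have : ∀ y, ‖S y‖ₑ ^ 2 = ENNReal.ofReal (‖S y‖ ^ 2) := by
      intro y
      rw [ENNReal.ofReal_pow (norm_nonneg _), ofReal_norm]
    simp only [this]
    rw [← ofReal_integral_eq_lintegral_ofReal hInt
      (Filter.Eventually.of_forall fun v => by positivity), e3,
      ← ofReal_norm, Complex.norm_real, Real.norm_of_nonneg]
    exact integral_nonneg fun v => by positivity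
  -- In the sheared variables the arguments y + εx and y + εx' become v and v + ετ, free of x. The
  -- x-integral therefore acts only on f and the phase, and equals `corrIntegral`.
  have hT := measurePreserving_shear ε
  have e4 : ∫ q, Z q ∂(volume.prod (volume.prod volume)) = ∫ q : (ℝ × ℝ) × ℝ,
      Z (q.1.2 - ε * q.2, (q.2, q.2 + q.1.1)) ∂((volume.prod volume).prod volume) := by
    conv_lhs => rw [← hT.map_eq]
    rw [integral_map hT.aemeasurable hZm.aestronglyMeasurable]
  have hZi' : Integrable (fun q : (ℝ × ℝ) × ℝ => Z (q.1.2 - ε * q.2, (q.2, q.2 + q.1.1)))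
      ((volume.prod volume).prod volume) := hT.integrable_comp_of_integrable hZi
  have e5 : ∀ p : ℝ × ℝ, ∫ x, Z (p.2 - ε * x, (x, x + p.1)) =
      h p.2 * conj (h (p.2 + ε * p.1)) * corrIntegral f E ε p.1 p.2 := by
    intro p
    rw [corrIntegral, ← integral_const_mul]
    congr 1; ext x
    simp only [hZ, hu, corrPhase, map_mul]
    rw [sub_add_cancel, show p.2 - ε * x + ε * (x + p.1) = p.2 + ε * p.1 by ring]
    ring
  change ∫⁻ y, ‖S y‖ₑ ^ 2 ≤ _
  rw [lhs, e4, integral_prod _ hZi']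
  refine (enorm_integral_le_lintegral_enorm _).trans ?_
  simp only [e5]
  rw [lintegral_prod]
  · refine lintegral_mono fun τ => lintegral_mono fun v => le_of_eq ?_
    rw [enorm_mul, enorm_mul, enorm_conj_eq]
  · exact (((hh.comp measurable_snd).mul (hcm.comp (hh.comp (by fun_prop)))).mul
      (measurable_corrIntegral hf hE ε)).enorm.aemeasurable

/-- The part of the correlation sum with `|τ| ≤ τ₀`, estimated trivially. -/
lemma lintegral_corr_near {f h : ℝ → ℂ} (hf : Measurable f) (hh : Measurable h)
    {E : ℝ → ℝ → ℂ} (hE1 : ∀ x y, ‖E x y‖ ≤ 1) (ε τ₀ : ℝ) :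
    ∫⁻ τ in Icc (-τ₀) τ₀, ∫⁻ v, ‖h v‖ₑ * ‖h (v + ε * τ)‖ₑ * ‖corrIntegral f E ε τ v‖ₑ ≤
      ENNReal.ofReal (2 * τ₀) * (sqNorm f * sqNorm h) := by
  have hK : ∀ τ v, ‖corrIntegral f E ε τ v‖ₑ ≤ sqNorm f := by
    intro τ v
    refine (enorm_integral_le_lintegral_enorm _).trans ?_
    refine le_trans (lintegral_mono fun x => ?_) (lintegral_mul_translate_le hf.enorm τ)
    rw [enorm_mul, enorm_mul, enorm_conj_eq]
    refine mul_le_of_le_one_right' ?_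
    rw [← ofReal_norm]; exact ENNReal.ofReal_le_one.2 (norm_corrPhase_le hE1 _ _ _ _)
  have hb : ∀ τ, ∫⁻ v, ‖h v‖ₑ * ‖h (v + ε * τ)‖ₑ * ‖corrIntegral f E ε τ v‖ₑ ≤
      sqNorm f * sqNorm h := by
    intro τ
    calc _ ≤ ∫⁻ v, (‖h v‖ₑ * ‖h (v + ε * τ)‖ₑ) * sqNorm f :=
          lintegral_mono fun v => mul_le_mul_right (hK τ v) _
      _ = (∫⁻ v, ‖h v‖ₑ * ‖h (v + ε * τ)‖ₑ) * sqNorm f := lintegral_mul_const _ (by fun_prop)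
      _ ≤ sqNorm h * sqNorm f := by
          gcongr; exact lintegral_mul_translate_le hh.enorm _
      _ = _ := mul_comm _ _
  refine (lintegral_mono hb).trans ?_
  rw [setLIntegral_const, Real.volume_Icc, mul_comm]
  apply le_of_eq; congr 2; ring

/-- The part of the correlation sum with `|τ| > τ₀`, estimated by the kernel decay. -/
lemma sq_lintegral_corr_far {f h : ℝ → ℂ} (hf : Measurable f) (hh : Measurable h)
    (hf2 : sqNorm f < ⊤) {E : ℝ → ℝ → ℂ} (hE : Measurable (Function.uncurry E))
    (hE1 : ∀ x y, ‖E x y‖ ≤ 1) {ε τ₀ lam C : ℝ} (hε : ε ≠ 0) (hτ₀ : 0 < τ₀) (hlam : lam ≠ 0)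
    (hC : 0 ≤ C) {χ : ℝ → ℝ} (hχ : Integrable χ) (hχm : Measurable χ) (hχ0 : ∀ v, 0 ≤ χ v)
    (hχh : ∀ v, h v ≠ 0 → χ v = 1)
    (hker : ∀ τ x x', f x ≠ 0 → f (x + τ) ≠ 0 → f x' ≠ 0 → f (x' + τ) ≠ 0 →
      ‖∫ v, (χ v : ℂ) * (corrPhase E ε τ x v * conj (corrPhase E ε τ x' v))‖ ≤
        C / (1 + (lam * τ * (x' - x)) ^ 2)) :
    (∫⁻ τ in (Icc (-τ₀) τ₀)ᶜ, ∫⁻ v, ‖h v‖ₑ * ‖h (v + ε * τ)‖ₑ * ‖corrIntegral f E ε τ v‖ₑ) ^ 2 ≤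
      ENNReal.ofReal (C * Real.pi / (|lam| * |ε| * τ₀)) * (sqNorm f * sqNorm h) ^ 2 := by
  have hcm : Measurable (fun z : ℂ => conj z) := Complex.continuous_conj.measurable
  have hEm : ∀ {α : Type} [MeasurableSpace α] {p q : α → ℝ}, Measurable p → Measurable q →
      Measurable (fun a => E (p a) (q a)) := fun hp hq => hE.comp (hp.prodMk hq)
  have hKm := measurable_corrIntegral hf hE ε
  -- For fixed τ, T T* in v gives a convolution kernel of mass Cπ/(|lam||τ|), and |τ| > τ₀ makes
  -- this uniform. Integrating the remaining ‖f(x)f(x+τ)‖² over τ later gives ‖f‖₂⁴.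
  have hpt : ∀ τ, τ ∈ (Icc (-τ₀) τ₀)ᶜ →
      ∫⁻ v, ENNReal.ofReal (χ v) * ‖corrIntegral f E ε τ v‖ₑ ^ 2 ≤
        ENNReal.ofReal (C * Real.pi / (|lam| * τ₀)) * ∫⁻ x, ‖f x‖ₑ ^ 2 * ‖f (x + 1 * τ)‖ₑ ^ 2 := by
    intro τ hτ
    have hτ' : τ₀ < |τ| := by
      by_contra hcon
      exact hτ (abs_le.1 (not_lt.1 hcon))
    have hτ0 : τ ≠ 0 := abs_pos.1 (hτ₀.trans hτ')
    have h1 := lintegral_weight_sq_le (integrable_mul_translate hf hf2 τ)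
      (hf.mul (hcm.comp (hf.comp (measurable_id.add_const τ))))
      (W := fun x v => corrPhase E ε τ x v)
      ((hEm (by fun_prop) (by fun_prop)).mul (hcm.comp (hEm (by fun_prop) (by fun_prop))))
      (fun x v => norm_corrPhase_le hE1 _ _ _ _) hχ hχm hχ0
    refine h1.trans ?_
    have h2 : ∀ x x', ‖f x * conj (f (x + τ))‖ₑ * ‖f x' * conj (f (x' + τ))‖ₑ *
        ‖∫ v, (χ v : ℂ) * (corrPhase E ε τ x v * conj (corrPhase E ε τ x' v))‖ₑ ≤
        ‖f x * conj (f (x + τ))‖ₑ * ‖f x' * conj (f (x' + τ))‖ₑ *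
          ENNReal.ofReal (C / (1 + (lam * τ * (x' - x)) ^ 2)) := by
      intro x x'
      by_cases z1 : f x = 0
      · simp [z1]
      by_cases z2 : f (x + τ) = 0
      · simp [z2]
      by_cases z3 : f x' = 0
      · simp [z3]
      by_cases z4 : f (x' + τ) = 0
      · simp [z4]
      refine mul_le_mul_right ?_ _
      rw [← ofReal_norm]
      exact ENNReal.ofReal_le_ofReal (hker τ x x' z1 z2 z3 z4)
    refine (lintegral_mono fun x => lintegral_mono fun x' => h2 x x').trans ?_
    have h3 := lintegral_convolution_le (u := fun x => ‖f x * conj (f (x + τ))‖ₑ)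
      (κ := fun s => ENNReal.ofReal (C / (1 + (lam * τ * s) ^ 2)))
      (hf.mul (hcm.comp (hf.comp (measurable_id.add_const τ)))).enorm (by fun_prop)
    refine h3.trans ?_
    rw [lintegral_lorentz hC (mul_ne_zero hlam hτ0)]
    refine mul_le_mul' (ENNReal.ofReal_le_ofReal ?_) (lintegral_mono fun x => ?_)
    · have := abs_pos.2 hlam
      rw [abs_mul]
      have := Real.pi_pos
      gcongr
    · simp only [enorm_mul, enorm_conj_eq, mul_pow, one_mul]; exact le_rfl
  set A := (Icc (-τ₀) τ₀)ᶜ with hA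
  have hAm : MeasurableSet A := measurableSet_Icc.compl
  set ν : Measure (ℝ × ℝ) := (volume.restrict A).prod volume with hν
  set u : ℝ × ℝ → ENNReal := fun p => ‖h p.2‖ₑ * ‖h (p.2 + ε * p.1)‖ₑ with hu
  -- Inserting √χ changes nothing, because χ = 1 wherever h(v) is nonzero; after squaring it becomes
  -- the smooth weight that the T T* bound needs.
  set w : ℝ × ℝ → ENNReal := fun p =>
    ENNReal.ofReal (Real.sqrt (χ p.2)) * ‖corrIntegral f E ε p.1 p.2‖ₑ with hw
  have hum : Measurable u := by fun_prop
  have hwm : Measurable w := by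
    exact (ENNReal.measurable_ofReal.comp
      (Real.continuous_sqrt.measurable.comp (hχm.comp measurable_snd))).mul hKm.enorm
  have huwm : AEMeasurable (fun p => u p * w p) ν := (hum.mul hwm).aemeasurable
  have hw2m : AEMeasurable (fun p => w p ^ 2) ν := (hwm.pow_const 2).aemeasurable
  have step : ∫⁻ τ in A, ∫⁻ v, ‖h v‖ₑ * ‖h (v + ε * τ)‖ₑ * ‖corrIntegral f E ε τ v‖ₑ =
      ∫⁻ p, u p * w p ∂ν := by
    rw [hν, lintegral_prod _ huwm]
    refine lintegral_congr fun τ => lintegral_congr fun v => ?_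
    simp only [hu, hw]
    by_cases hv : h v = 0
    · simp [hv]
    · simp [hχh v hv]
  -- The change of variables τ ↦ v + ετ is the source of the loss |ε|⁻¹.
  have hu2 : ∫⁻ p, u p ^ 2 ∂ν ≤ ENNReal.ofReal |ε⁻¹| * (sqNorm h * sqNorm h) := by
    rw [hν, lintegral_prod _ (hum.pow_const 2).aemeasurable]
    simp only [hu, mul_pow]
    refine (setLIntegral_le_lintegral _ _).trans ?_
    rw [lintegral_translate_prod (u := fun v => ‖h v‖ₑ ^ 2) (w := fun v => ‖h v‖ₑ ^ 2)
      (by fun_prop) (by fun_prop) hε]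
    rfl
  have hw3 : ∫⁻ p, w p ^ 2 ∂ν ≤
      ENNReal.ofReal (C * Real.pi / (|lam| * τ₀)) * (sqNorm f * sqNorm f) := by
    rw [hν, lintegral_prod _ hw2m]
    have e : ∀ p : ℝ × ℝ, w p ^ 2 = ENNReal.ofReal (χ p.2) * ‖corrIntegral f E ε p.1 p.2‖ₑ ^ 2 := by
      intro p
      rw [hw, mul_pow, ← ENNReal.ofReal_pow (Real.sqrt_nonneg _), Real.sq_sqrt (hχ0 _)]
    simp only [e]
    refine (setLIntegral_mono' hAm hpt).trans ?_
    refine (setLIntegral_le_lintegral _ _).trans ?_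
    rw [lintegral_const_mul _ (by
      exact Measurable.lintegral_prod_right 
        (f := fun t x : ℝ => ‖f x‖ₑ ^ 2 * ‖f (x + 1 * t)‖ₑ ^ 2)
        (by simp only [Function.uncurry_def]; fun_prop)),
      lintegral_translate_prod (u := fun v => ‖f v‖ₑ ^ 2) (w := fun v => ‖f v‖ₑ ^ 2)
      (by fun_prop) (by fun_prop) one_ne_zero]
    simp [sqNorm]
  rw [step]
  calc _ ≤ _ := sq_lintegral_mul_le ν hum.aemeasurable hwm.aemeasurable
    _ ≤ _ := mul_le_mul' hu2 hw3
    _ = _ := by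
      rw [show C * Real.pi / (|lam| * |ε| * τ₀) = |ε⁻¹| * (C * Real.pi / (|lam| * τ₀)) by
        rw [abs_inv]; field_simp, ENNReal.ofReal_mul (abs_nonneg _)]
      ring

/-! ### Trilinear forms and the model estimate -/

/-- The `L²` norm as a real number. -/
def l2 (f : ℝ → ℂ) : ℝ := (eLpNorm f 2 volume).toReal

lemma l2_nonneg (f : ℝ → ℂ) : 0 ≤ l2 f := ENNReal.toReal_nonneg

lemma sqNorm_eq_sq (f : ℝ → ℂ) : sqNorm f = eLpNorm f 2 volume ^ 2 := by
  rw [sqNorm, eLpNorm_eq_lintegral_rpow_enorm_toReal (by norm_num) (by norm_num)]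
  simp only [ENNReal.toReal_ofNat, ENNReal.rpow_two]
  rw [← ENNReal.rpow_two, ← ENNReal.rpow_mul]; norm_num

lemma sqNorm_eq {f : ℝ → ℂ} (hf : MemLp f 2 volume) : sqNorm f = ENNReal.ofReal (l2 f ^ 2) := by
  rw [sqNorm_eq_sq, ENNReal.ofReal_pow (l2_nonneg f), l2, ENNReal.ofReal_toReal hf.2.ne]

lemma sqNorm_lt_top {f : ℝ → ℂ} (hf : MemLp f 2 volume) : sqNorm f < ⊤ := by
  rw [sqNorm_eq hf]; exact ENNReal.ofReal_lt_top

lemma l2_mono {f g : ℝ → ℂ} (hg : MemLp g 2 volume) (h : ∀ x, ‖f x‖ ≤ ‖g x‖) : l2 f ≤ l2 g :=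
  ENNReal.toReal_mono hg.2.ne (eLpNorm_mono h)

lemma l2_le_mul {f g : ℝ → ℂ} {c : ℝ} (hc : 0 ≤ c) (hg : MemLp g 2 volume)
    (h : ∀ x, ‖f x‖ ≤ c * ‖g x‖) : l2 f ≤ c * l2 g := by
  have : eLpNorm f 2 volume ≤ ENNReal.ofReal c * eLpNorm g 2 volume :=
    eLpNorm_le_mul_eLpNorm_of_ae_le_mul (Filter.Eventually.of_forall h) 2
  have h2 := ENNReal.toReal_mono (ENNReal.mul_ne_top ENNReal.ofReal_ne_top hg.2.ne) this
  rwa [ENNReal.toReal_mul, ENNReal.toReal_ofReal hc] at h2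

/-- The trilinear form with symbol `M`. -/
def triForm (ε : ℝ) (M : ℝ → ℝ → ℂ) (f g h : ℝ → ℂ) : ℂ :=
  ∫ q : ℝ × ℝ, f q.1 * g q.2 * h (q.2 + ε * q.1) * M q.1 q.2 ∂(volume.prod volume)

lemma lintegral_tri_le {f g h : ℝ → ℂ} (hf : Measurable f) (hg : Measurable g) (hh : Measurable h)
    (hf1 : Integrable f) (hg2 : MemLp g 2 volume) (hh2 : MemLp h 2 volume) (ε : ℝ) :
    ∫⁻ q : ℝ × ℝ, ‖f q.1‖ₑ * (‖g q.2‖ₑ * ‖h (q.2 + ε * q.1)‖ₑ) ∂(volume.prod volume) ≤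
      ENNReal.ofReal ((∫ x, ‖f x‖) * (l2 g * l2 h)) := by
  rw [lintegral_prod _ (by fun_prop), ENNReal.ofReal_mul (integral_nonneg fun x => norm_nonneg _),
    ofReal_integral_norm_eq_lintegral_enorm hf1, ← lintegral_mul_const _ (by fun_prop)]
  refine lintegral_mono fun x => ?_
  dsimp only
  rw [lintegral_const_mul _ (by fun_prop)]
  refine mul_le_mul_right ?_ _
  rw [← ENNReal.pow_le_pow_left_iff two_ne_zero]
  refine (sq_lintegral_mul_le _ (by fun_prop) (by fun_prop)).trans (le_of_eq ?_)
  rw [lintegral_add_right_eq_self (fun x => ‖h x‖ₑ ^ 2)]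
  change sqNorm g * sqNorm h = _
  rw [sqNorm_eq hg2, sqNorm_eq hh2, ← ENNReal.ofReal_mul (by positivity),
    ← ENNReal.ofReal_pow (mul_nonneg (l2_nonneg _) (l2_nonneg _))]
  congr 1; ring

lemma integrable_tri {f g h : ℝ → ℂ} (hf : Measurable f) (hg : Measurable g) (hh : Measurable h)
    (hf1 : Integrable f) (hg2 : MemLp g 2 volume) (hh2 : MemLp h 2 volume) (ε : ℝ) :
    Integrable (fun q : ℝ × ℝ => f q.1 * g q.2 * h (q.2 + ε * q.1)) (volume.prod volume) := by
  refine ⟨by fun_prop, lt_of_le_of_lt ?_ (lt_of_le_of_lt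
    (lintegral_tri_le hf hg hh hf1 hg2 hh2 ε) ENNReal.ofReal_lt_top)⟩
  refine lintegral_mono fun q => le_of_eq ?_
  rw [enorm_mul, enorm_mul, mul_assoc]

/-- Takes care of error symbols: for fixed x, Cauchy-Schwarz in y and translation invariance leave
only ‖f‖₁, with no dependence on ε. -/
lemma norm_triForm_le {f g h : ℝ → ℂ} (hf : Measurable f) (hg : Measurable g) (hh : Measurable h)
    (hf1 : Integrable f) (hg2 : MemLp g 2 volume) (hh2 : MemLp h 2 volume) (ε : ℝ)
    {M : ℝ → ℝ → ℂ} {B : ℝ} (hB : 0 ≤ B) (hM : ∀ x y, f x ≠ 0 → g y ≠ 0 → ‖M x y‖ ≤ B) :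
    ‖triForm ε M f g h‖ ≤ B * ((∫ x, ‖f x‖) * (l2 g * l2 h)) := by
  have h0 : 0 ≤ (∫ x, ‖f x‖) * (l2 g * l2 h) :=
    mul_nonneg (integral_nonneg fun x => norm_nonneg _) (mul_nonneg (l2_nonneg _) (l2_nonneg _))
  rw [← ENNReal.ofReal_le_ofReal_iff (by positivity), ofReal_norm]
  refine (enorm_integral_le_lintegral_enorm _).trans ?_
  rw [ENNReal.ofReal_mul hB]
  refine le_trans ?_ (mul_le_mul_right (lintegral_tri_le hf hg hh hf1 hg2 hh2 ε) _)
  rw [← lintegral_const_mul _ (by fun_prop)]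
  refine lintegral_mono fun q => ?_
  by_cases z1 : f q.1 = 0
  · simp [z1]
  by_cases z2 : g q.2 = 0
  · simp [z2]
  rw [enorm_mul, enorm_mul, enorm_mul, mul_comm, mul_assoc (‖f q.1‖ₑ)]
  refine mul_le_mul_left ?_ _
  rw [← ofReal_norm]
  exact ENNReal.ofReal_le_ofReal (hM _ _ z1 z2)

lemma integrable_of_support {f : ℝ → ℂ} {a b : ℝ} (hf2 : MemLp f 2 volume)
    (hs : Function.support f ⊆ Icc a b) : Integrable f := by
  rw [← integrableOn_iff_integrable_of_support_subset hs]
  exact (hf2.restrict _).integrable (by norm_num)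

/-- Cauchy-Schwarz on an interval of length 9/4, whose square root 3/2 is rounded up to 2. -/
lemma integral_norm_le {f : ℝ → ℂ} (hf2 : MemLp f 2 volume)
    (hs : Function.support f ⊆ Icc (1 / 8) (19 / 8)) : ∫ x, ‖f x‖ ≤ 2 * l2 f := by
  have hf1 := integrable_of_support hf2 hs
  have h0 := l2_nonneg f
  rw [← ENNReal.ofReal_le_ofReal_iff (by positivity), ofReal_integral_norm_eq_lintegral_enorm hf1,
    ← ENNReal.pow_le_pow_left_iff two_ne_zero]
  have e : ∫⁻ x, ‖f x‖ₑ = ∫⁻ x, ‖f x‖ₑ * (Icc (1 / 8 : ℝ) (19 / 8)).indicator 1 x := by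
    refine lintegral_congr fun x => ?_
    by_cases hx : x ∈ Icc (1 / 8 : ℝ) (19 / 8)
    · rw [indicator_of_mem hx, Pi.one_apply, mul_one]
    · have : f x = 0 := by
        by_contra h; exact hx (hs h)
      simp [this]
  have hm : Measurable ((Icc (1 / 8 : ℝ) (19 / 8)).indicator (1 : ℝ → ℝ≥0∞)) :=
    measurable_one.indicator measurableSet_Icc
  rw [e]
  refine (sq_lintegral_mul_le _ hf1.1.enorm hm.aemeasurable).trans ?_
  change sqNorm f * _ ≤ _
  have e2 : ∫⁻ x, (Icc (1 / 8 : ℝ) (19 / 8)).indicator (1 : ℝ → ℝ≥0∞) x ^ 2 =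
      ENNReal.ofReal (9 / 4) := by
    have : ∀ x, (Icc (1 / 8 : ℝ) (19 / 8)).indicator (1 : ℝ → ℝ≥0∞) x ^ 2 =
        (Icc (1 / 8 : ℝ) (19 / 8)).indicator (1 : ℝ → ℝ≥0∞) x := by
      intro x
      by_cases hx : x ∈ Icc (1 / 8 : ℝ) (19 / 8)
      · rw [indicator_of_mem hx, Pi.one_apply, one_pow]
      · rw [indicator_of_notMem hx, zero_pow two_ne_zero]
    simp only [this]
    rw [lintegral_indicator_one measurableSet_Icc, Real.volume_Icc]; norm_num
  rw [e2, sqNorm_eq hf2, ← ENNReal.ofReal_mul (by positivity), ← ENNReal.ofReal_pow (by positivity)]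
  apply ENNReal.ofReal_le_ofReal
  nlinarith [sq_nonneg (l2 f)]

/-- The model phase `x^a y^b`. -/
def modelPhase (a b lam x y : ℝ) : ℂ := osc (lam * (x ^ a * y ^ b))

lemma measurable_modelPhase (a b lam : ℝ) :
    Measurable (Function.uncurry (modelPhase a b lam)) := by
  unfold modelPhase
  simp only [Function.uncurry_def]
  exact measurable_osc.comp (by fun_prop)

/-- Identifies the kernel produced by T T* for the model phase with the one estimated in
`exists_kernel_bound`. -/
lemma corrPhase_modelPhase (a b lam ε τ x x' v : ℝ) :
    corrPhase (modelPhase a b lam) ε τ x v * conj (corrPhase (modelPhase a b lam) ε τ x' v) =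
      osc (lam * (phaseTerm a b ε τ v x' - phaseTerm a b ε τ v x)) := by
  simp only [corrPhase, modelPhase, conj_osc, ← osc_add]
  congr 1
  simp only [phaseTerm]; ring

/-- The main estimate for the model trilinear form. -/
theorem exists_model_bound {a b : ℝ} (ha : |a| ≤ 2) (hb : |b| ≤ 2) (ha0 : a ≠ 0) (ha1 : a ≠ 1)
    (hb0 : b ≠ 0) :
    ∃ C : ℝ, 0 < C ∧ ∀ (lam ε : ℝ) (f g h : ℝ → ℂ), lam ≠ 0 → ε ≠ 0 → |ε| ≤ 1 / 100 →
      |ε| * |b - 1| * (2 * 40 ^ 14) ≤ |a - 1| → Measurable f → Measurable g → Measurable h →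
      MemLp f 2 volume → MemLp g 2 volume → MemLp h 2 volume →
      Function.support f ⊆ Icc (1 / 8) (19 / 8) → Function.support g ⊆ Icc (1 / 8) (19 / 8) →
      ‖triForm ε (modelPhase a b lam) f g h‖ ≤
        C * (|lam| * |ε|) ^ (-(1 / 6) : ℝ) * (l2 f * l2 g * l2 h) := by
  obtain ⟨C, hC, hker⟩ := exists_kernel_bound ha hb ha0 ha1 hb0
  refine ⟨Real.sqrt (2 + Real.sqrt (C * Real.pi)), by positivity, ?_⟩
  intro lam ε f g h hlam hε hε1 hε2 hfm hgm hhm hf hg hh hfs hgs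
  -- On the supports of f and g the point y + εx lies within 19/800 of [1/8, 19/8], hence in [1/10,
  -- 5/2]. Truncating h there changes nothing and puts its support where `cutoff` equals 1.
  set h' : ℝ → ℂ := (Icc (1 / 10 : ℝ) (5 / 2)).indicator h with hh'
  have hhm' : Measurable h' := hhm.indicator measurableSet_Icc
  have hh2' : MemLp h' 2 volume := hh.indicator measurableSet_Icc
  have hl2' : l2 h' ≤ l2 h := l2_mono hh fun x => norm_indicator_le_norm_self _ _
  have hf1 := integrable_of_support hf hfs
  set E := modelPhase a b lam with hE
  have hEm : Measurable (Function.uncurry E) := measurable_modelPhase a b lam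
  have hE1 : ∀ x y, ‖E x y‖ ≤ 1 := fun x y => (norm_osc _).le
  have e1 : triForm ε E f g h = triForm ε E f g h' := by
    unfold triForm
    congr 1; ext q
    by_cases z1 : f q.1 = 0
    · simp [z1]
    by_cases z2 : g q.2 = 0
    · simp [z2]
    have m1 := hfs z1
    have m2 := hgs z2
    have : |ε * q.1| ≤ 1 / 100 * (19 / 8) := by
      have := m1.1; have := m1.2
      rw [abs_mul, abs_of_nonneg (by linarith : (0 : ℝ) ≤ q.1)]
      gcongr
    obtain ⟨k1, k2⟩ := abs_le.1 this
    have hm : q.2 + ε * q.1 ∈ Icc (1 / 10 : ℝ) (5 / 2) :=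
      ⟨by linarith [m2.1], by linarith [m2.2]⟩
    rw [hh', indicator_of_mem hm]
  -- With this choice |lam||ε| τ₀³ = 1. The small shifts contribute 2τ₀ and the large ones √(Cπ) τ₀,
  -- which are the two summands in the constant.
  set τ₀ : ℝ := (|lam| * |ε|) ^ (-(1 / 3) : ℝ) with hτ
  have hA : 0 < |lam| * |ε| := mul_pos (abs_pos.2 hlam) (abs_pos.2 hε)
  have hτ₀ : 0 < τ₀ := Real.rpow_pos_of_pos hA _
  set X : ℝ≥0∞ := sqNorm f * sqNorm h' with hX
  have hS : ∫⁻ y, ‖∫ x, f x * h' (y + ε * x) * E x y‖ₑ ^ 2 ≤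
      ENNReal.ofReal ((2 + Real.sqrt (C * Real.pi)) * τ₀) * X := by
    refine (lintegral_sq_le_corr hfm hhm' hf1 (sqNorm_lt_top hh2') hEm hE1 ε).trans ?_
    rw [← lintegral_add_compl _ (measurableSet_Icc (a := -τ₀) (b := τ₀)), add_mul,
      ENNReal.ofReal_add (by positivity) (by positivity), add_mul]
    refine add_le_add (lintegral_corr_near hfm hhm' hE1 ε τ₀) ?_
    rw [← ENNReal.pow_le_pow_left_iff two_ne_zero]
    refine (sq_lintegral_corr_far hfm hhm' (sqNorm_lt_top hf) hEm hE1 hε hτ₀ hlam hC.le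
      (χ := cutoff) ?_ ?_ (fun v => cutoff.nonneg) ?_ ?_).trans (le_of_eq ?_)
    · exact (cutoff_contDiff (n := 0)).continuous.integrable_of_hasCompactSupport
        cutoff.hasCompactSupport
    · exact (cutoff_contDiff (n := 0)).continuous.measurable
    · intro v hv
      exact cutoff_eq_one (mem_of_indicator_ne_zero hv)
    · intro τ x x' z1 z2 z3 z4
      simp only [hE, corrPhase_modelPhase]
      exact hker lam ε τ x x' hε1 hε2 (hfs z1) (hfs z3) (hfs z2) (hfs z4)
    · rw [← hX, mul_pow (ENNReal.ofReal _) X, ← ENNReal.ofReal_pow (by positivity),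
        mul_pow (Real.sqrt _) τ₀, Real.sq_sqrt (by positivity)]
      congr 2
      have : τ₀ ^ 3 = (|lam| * |ε|)⁻¹ := by
        rw [hτ, ← Real.rpow_natCast, ← Real.rpow_mul hA.le]
        norm_num
        rw [Real.rpow_neg_one, mul_inv, mul_comm]
      have h3 : (|lam| * |ε|) * τ₀ ^ 3 = 1 := by rw [this]; exact mul_inv_cancel₀ hA.ne'
      rw [div_eq_iff (by positivity)]
      linear_combination (-(C * Real.pi)) * h3
  have hSm : AEMeasurable (fun y => ‖∫ x, f x * h' (y + ε * x) * E x y‖ₑ) volume := by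
    have : StronglyMeasurable (fun q : ℝ × ℝ => f q.2 * h' (q.1 + ε * q.2) * E q.2 q.1) :=
      (((hfm.comp measurable_snd).mul (hhm'.comp (by fun_prop))).mul
        (hEm.comp measurable_swap)).stronglyMeasurable
    exact (this.integral_prod_right (ν := volume)).measurable.enorm.aemeasurable
  have hI : Integrable (fun q : ℝ × ℝ => f q.1 * g q.2 * h' (q.2 + ε * q.1) * E q.1 q.2)
      (volume.prod volume) :=
    (integrable_tri hfm hgm hhm' hf1 hg hh2' ε).mul_bdd (c := 1)
      hEm.aestronglyMeasurable (Filter.Eventually.of_forall fun q => hE1 _ _)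
  have e2 : triForm ε E f g h' = ∫ y, g y * ∫ x, f x * h' (y + ε * x) * E x y := by
    unfold triForm
    rw [integral_prod_symm _ hI]
    congr 1; ext y
    rw [← integral_const_mul]
    congr 1; ext x; ring
  have key : ‖triForm ε E f g h'‖ₑ ^ 2 ≤
      ENNReal.ofReal ((2 + Real.sqrt (C * Real.pi)) * τ₀ * (l2 f * l2 g * l2 h) ^ 2) := by
    rw [e2]
    calc _ ≤ (∫⁻ y, ‖g y‖ₑ * ‖∫ x, f x * h' (y + ε * x) * E x y‖ₑ) ^ 2 := by
          gcongr
          refine (enorm_integral_le_lintegral_enorm _).trans (le_of_eq ?_)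
          simp only [enorm_mul]
      _ ≤ sqNorm g * (ENNReal.ofReal ((2 + Real.sqrt (C * Real.pi)) * τ₀) * X) :=
          (sq_lintegral_mul_le _ hgm.enorm.aemeasurable hSm).trans (mul_le_mul_right hS _)
      _ ≤ _ := by
          rw [hX, sqNorm_eq hg, sqNorm_eq hf, sqNorm_eq hh2', ← ENNReal.ofReal_mul (by positivity),
            ← ENNReal.ofReal_mul (by positivity), ← ENNReal.ofReal_mul (by positivity)]
          apply ENNReal.ofReal_le_ofReal
          have := l2_nonneg h'
          calc l2 g ^ 2 * ((2 + Real.sqrt (C * Real.pi)) * τ₀ * (l2 f ^ 2 * l2 h' ^ 2))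
              ≤ l2 g ^ 2 * ((2 + Real.sqrt (C * Real.pi)) * τ₀ * (l2 f ^ 2 * l2 h ^ 2)) := by gcongr
            _ = _ := by ring
  rw [e1]
  rw [← ofReal_norm, ← ENNReal.ofReal_pow (norm_nonneg _),
    ENNReal.ofReal_le_ofReal_iff (by positivity)] at key
  have hl : 0 ≤ l2 f * l2 g * l2 h :=
    mul_nonneg (mul_nonneg (l2_nonneg _) (l2_nonneg _)) (l2_nonneg _)
  refine le_of_sq_le_sq ?_ (by positivity)
  refine key.trans (le_of_eq ?_)
  have hs : Real.sqrt (2 + Real.sqrt (C * Real.pi)) ^ 2 = 2 + Real.sqrt (C * Real.pi) :=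
    Real.sq_sqrt (by positivity)
  have hr : ((|lam| * |ε|) ^ (-(1 / 6) : ℝ)) ^ 2 = τ₀ := by
    rw [hτ, ← Real.rpow_natCast, ← Real.rpow_mul hA.le]
    norm_num
  rw [mul_pow _ (l2 f * l2 g * l2 h), mul_pow (Real.sqrt _), hs, hr]

/-! ### Stationary phase for amplitudes vanishing at the critical point -/

/-- Integration by parts away from the critical point, for an amplitude vanishing there. -/
lemma norm_integral_osc_off_critical {P S S₁ b b₁ : ℝ → ℝ} {α β M D μ : ℝ} (hαβ : α ≤ β)
    (h1 : ∀ u ∈ Icc α β, u ≠ 1) (hP : ∀ u ∈ Icc α β, HasDerivAt P ((u - 1) * S u) u)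
    (hS : ∀ u ∈ Icc α β, HasDerivAt S (S₁ u) u) (hS₁ : ContinuousOn S₁ (Icc α β))
    (hb : ∀ u ∈ Icc α β, HasDerivAt b (b₁ u) u) (hb₁ : ContinuousOn b₁ (Icc α β))
    (hS1 : ∀ u ∈ Icc α β, 1 ≤ S u) (hD : ∀ u ∈ Icc α β, |S₁ u| ≤ D)
    (hb0 : ∀ u ∈ Icc α β, |b u| ≤ M * |u - 1|)
    (hb1 : ∀ u ∈ Icc α β, |(u - 1) * b₁ u - b u| ≤ M * (u - 1) ^ 2) (hM : 0 ≤ M) (hμ : μ ≠ 0) :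
    ‖∫ u in α..β, (b u : ℂ) * osc (μ * P u)‖ ≤ M * (2 + (1 + D) * (β - α)) / |μ| := by
  have hu : uIcc α β = Icc α β := uIcc_of_le hαβ
  set W : ℝ → ℝ := fun u => (u - 1) * S u with hW
  set W₁ : ℝ → ℝ := fun u => S u + (u - 1) * S₁ u with hW₁
  have hWne : ∀ u ∈ Icc α β, W u ≠ 0 := fun u hu =>
    mul_ne_zero (sub_ne_zero.2 (h1 u hu)) (by linarith [hS1 u hu])
  have dW : ∀ u ∈ Icc α β, HasDerivAt W (W₁ u) u := fun u hu => by
    have := ((hasDerivAt_id u).sub_const 1).mul (hS u hu)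
    convert! this using 1; simp [hW₁]
  have cont : ∀ {F F' : ℝ → ℝ}, (∀ v ∈ Icc α β, HasDerivAt F (F' v) v) → ContinuousOn F (Icc α β) :=
    fun h v hv => (h v hv).continuousAt.continuousWithinAt
  have cW₁ : ContinuousOn W₁ (Icc α β) :=
    (cont hS).add ((continuousOn_id.sub continuousOn_const).mul hS₁)
  set q : ℝ → ℝ := fun u => b u / W u with hq
  set q₁ : ℝ → ℝ := fun u => (b₁ u * W u - b u * W₁ u) / W u ^ 2 with hq₁
  have dq : ∀ u ∈ Icc α β, HasDerivAt q (q₁ u) u := fun u hu => (hb u hu).div (dW u hu) (hWne u hu)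
  have cq₁ : ContinuousOn q₁ (Icc α β) :=
    ((hb₁.mul (cont dW)).sub ((cont hb).mul cW₁)).div ((cont dW).pow 2)
      fun u hu => pow_ne_zero 2 (hWne u hu)
  have i1 := integral_mul_deriv_osc (a := α) (b := β) (q := q) (q' := q₁) (Ψ := fun u => μ * P u)
    (Ψ' := fun u => μ * W u) (hu ▸ dq) (hu ▸ fun u hu => (hP u hu).const_mul μ) (hu ▸ cq₁)
    (hu ▸ continuousOn_const.mul (cont dW))
  have e1 : ∫ u in α..β, ((q u * (μ * W u) : ℝ) : ℂ) * osc (μ * P u) =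
      (μ : ℂ) * ∫ u in α..β, (b u : ℂ) * osc (μ * P u) := by
    rw [← intervalIntegral.integral_const_mul]
    apply intervalIntegral.integral_congr
    intro u huv
    rw [hu] at huv
    dsimp only
    rw [show q u * (μ * W u) = μ * b u by
      simp only [hq]; have := hWne u huv; field_simp]
    push_cast; ring
  rw [e1] at i1
  have bq : ∀ u ∈ Icc α β, |q u| ≤ M := fun u huv => by
    have h0 : 0 < |u - 1| := abs_pos.2 (sub_ne_zero.2 (h1 u huv))
    have hs := hS1 u huv
    simp only [hq, hW, abs_div, abs_mul]
    rw [abs_of_pos (by linarith : 0 < S u), div_le_iff₀ (by positivity)]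
    calc |b u| ≤ M * |u - 1| := hb0 u huv
      _ ≤ M * (|u - 1| * S u) := by
        gcongr; exact le_mul_of_one_le_right h0.le hs
  have bq₁ : ∀ u ∈ Icc α β, |q₁ u| ≤ M * (1 + D) := fun u huv => by
    have h0 : 0 < |u - 1| := abs_pos.2 (sub_ne_zero.2 (h1 u huv))
    have hs := hS1 u huv
    have hsp : 0 < S u := by linarith
    have hWp : 0 < W u ^ 2 := by have := hWne u huv; positivity
    have hDu := hD u huv
    have hD0 : 0 ≤ D := (abs_nonneg _).trans hDu
    simp only [hq₁]
    rw [abs_div, abs_of_pos hWp, div_le_iff₀ hWp]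
    -- The combination (u-1)b' - b vanishes to second order at 1. This cancels the denominator W²
    -- and keeps the derivative of b/W bounded up to the critical point.
    have e : b₁ u * W u - b u * W₁ u =
        S u * ((u - 1) * b₁ u - b u) - (u - 1) * b u * S₁ u := by
      simp only [hW, hW₁]; ring
    rw [e]
    calc _ ≤ |S u * ((u - 1) * b₁ u - b u)| + |(u - 1) * b u * S₁ u| := abs_sub _ _
      _ ≤ S u * (M * (u - 1) ^ 2) + |u - 1| * (M * |u - 1|) * D := by
        simp only [abs_mul, abs_of_pos hsp]
        gcongr
        · exact hb1 u huv
        · exact hb0 u huv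
      _ = M * (u - 1) ^ 2 * (S u + D) := by rw [← sq_abs (u - 1)]; ring
      -- S + D ≤ (1 + D)S² because S ≥ 1.
      _ ≤ M * (u - 1) ^ 2 * ((1 + D) * S u ^ 2) := by
        gcongr
        have h2 : S u ≤ S u ^ 2 := by nlinarith
        nlinarith [mul_nonneg hD0 (by nlinarith : 0 ≤ S u ^ 2 - 1)]
      _ = _ := by simp only [hW]; ring
  rw [le_div_iff₀ (abs_pos.2 hμ), mul_comm]
  have : |μ| * ‖∫ u in α..β, (b u : ℂ) * osc (μ * P u)‖ =
      ‖(μ : ℂ) * ∫ u in α..β, (b u : ℂ) * osc (μ * P u)‖ := by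
    rw [norm_mul, Complex.norm_real, Real.norm_eq_abs]
  rw [this, i1]
  have hβ := bq β (right_mem_Icc.2 hαβ)
  have hα := bq α (left_mem_Icc.2 hαβ)
  have hI := norm_integral_mul_osc_le hαβ (Ψ := fun u => μ * P u) bq₁
  calc _ ≤ ‖-I * ((q β : ℂ) * osc (μ * P β) - (q α : ℂ) * osc (μ * P α))‖ +
        ‖I * ∫ v in α..β, (q₁ v : ℂ) * osc (μ * P v)‖ := norm_add_le _ _
    _ ≤ (M + M) + M * (1 + D) * (β - α) := by
        gcongr
        · rw [norm_mul, norm_neg, Complex.norm_I, one_mul]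
          refine (norm_sub_le _ _).trans ?_
          simp only [norm_mul, norm_osc, mul_one, Complex.norm_real, Real.norm_eq_abs]
          gcongr
        · rw [norm_mul, Complex.norm_I, one_mul]; exact hI
    _ = _ := by ring

/-- First order stationary phase estimate for an amplitude vanishing at the critical point. -/
lemma norm_integral_osc_vanishing {P S S₁ b b₁ b₂ : ℝ → ℝ} {α β M D μ : ℝ} (hα : α < 1) (hβ : 1 < β)
    (hP : ∀ u ∈ Icc α β, HasDerivAt P ((u - 1) * S u) u)
    (hS : ∀ u ∈ Icc α β, HasDerivAt S (S₁ u) u) (hS₁ : ContinuousOn S₁ (Icc α β))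
    (hb : ∀ u ∈ Icc α β, HasDerivAt b (b₁ u) u) (hb₁ : ∀ u ∈ Icc α β, HasDerivAt b₁ (b₂ u) u)
    (hS1 : ∀ u ∈ Icc α β, 1 ≤ S u) (hD : ∀ u ∈ Icc α β, |S₁ u| ≤ D)
    (hM1 : ∀ u ∈ Icc α β, |b₁ u| ≤ M) (hM2 : ∀ u ∈ Icc α β, |b₂ u| ≤ M)
    (hb1 : b 1 = 0) (hμ : μ ≠ 0) :
    ‖∫ u in α..β, (b u : ℂ) * osc (μ * P u)‖ ≤ 2 * (M * (2 + (1 + D) * (β - α)) / |μ|) := by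
  have h1m : (1 : ℝ) ∈ Icc α β := ⟨hα.le, hβ.le⟩
  have hM : 0 ≤ M := (abs_nonneg _).trans (hM1 1 h1m)
  have hD0 : 0 ≤ D := (abs_nonneg _).trans (hD 1 h1m)
  have cont : ∀ {F F' : ℝ → ℝ}, (∀ v ∈ Icc α β, HasDerivAt F (F' v) v) → ContinuousOn F (Icc α β) :=
    fun h v hv => (h v hv).continuousAt.continuousWithinAt
  have hb0' : ∀ u ∈ Icc α β, |b u| ≤ M * |u - 1| := by
    intro u hu
    have := (convex_Icc α β).norm_image_sub_le_of_norm_hasDerivWithin_le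
      (fun x hx => (hb x hx).hasDerivWithinAt) hM1 h1m hu
    simpa [hb1] using this
  -- The derivative of (x-1)b'(x) - b(x) is (x-1)b''(x), which gives the quadratic bound.
  have hb1' : ∀ u ∈ Icc α β, |(u - 1) * b₁ u - b u| ≤ M * (u - 1) ^ 2 := by
    intro u hu
    have hsub : uIcc 1 u ⊆ Icc α β := (convex_Icc α β).ordConnected.uIcc_subset h1m hu
    have hd : ∀ x ∈ uIcc 1 u, HasDerivWithinAt (fun x => (x - 1) * b₁ x - b x)
        ((x - 1) * b₂ x) (uIcc 1 u) x := fun x hx => by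
      have h1 := ((((hasDerivAt_id x).sub_const 1).mul (hb₁ x (hsub hx))).sub (hb x (hsub hx)))
      convert! h1.hasDerivWithinAt using 1
      simp
    have hbd : ∀ x ∈ uIcc 1 u, ‖(x - 1) * b₂ x‖ ≤ |u - 1| * M := fun x hx => by
      rw [Real.norm_eq_abs, abs_mul]
      exact mul_le_mul (abs_sub_left_of_mem_uIcc hx) (hM2 x (hsub hx)) (abs_nonneg _) (abs_nonneg _)
    have := (convex_uIcc 1 u).norm_image_sub_le_of_norm_hasDerivWithin_le hd hbd
      left_mem_uIcc right_mem_uIcc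
    simp only [hb1, sub_self, zero_mul, sub_zero, Real.norm_eq_abs] at this
    refine this.trans (le_of_eq ?_)
    rw [← sq_abs (u - 1)]; ring
  have hcb : ContinuousOn (fun u => (b u : ℂ) * osc (μ * P u)) (Icc α β) :=
    (Complex.continuous_ofReal.comp_continuousOn (cont hb)).mul
      (continuous_osc.comp_continuousOn (continuousOn_const.mul (cont hP)))
  have hii : ∀ {x y}, x ∈ Icc α β → y ∈ Icc α β →
      IntervalIntegrable (fun u => (b u : ℂ) * osc (μ * P u)) volume x y := fun hx hy =>
    (hcb.mono ((convex_Icc α β).ordConnected.uIcc_subset hx hy)).intervalIntegrable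
  set B := M * (2 + (1 + D) * (β - α)) / |μ| with hB
  -- Excise (1-δ, 1+δ). The two outer bounds do not depend on δ, and the excised part is at most K ·
  -- 2δ ≤ e, so the excision disappears in the limit.
  refine le_of_forall_pos_le_add fun e he => ?_
  set K := M * (β - α) + 1 with hK
  have hKp : 0 < K := by have : 0 ≤ β - α := by linarith
                         positivity
  obtain ⟨δ, hδ, hδ1, hδ2, hδ3⟩ : ∃ δ : ℝ, 0 < δ ∧ δ < 1 - α ∧ δ < β - 1 ∧ K * (2 * δ) ≤ e := by
    refine ⟨min (min ((1 - α) / 2) ((β - 1) / 2)) (e / (2 * K)), ?_, ?_, ?_, ?_⟩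
    · have : 0 < 1 - α := by linarith
      have : 0 < β - 1 := by linarith
      positivity
    · refine lt_of_le_of_lt ((min_le_left _ _).trans (min_le_left _ _)) (by linarith)
    · refine lt_of_le_of_lt ((min_le_left _ _).trans (min_le_right _ _)) (by linarith)
    · have := min_le_right (min ((1 - α) / 2) ((β - 1) / 2)) (e / (2 * K))
      calc K * (2 * _) ≤ K * (2 * (e / (2 * K))) := by gcongr
        _ = e := by field_simp
  have m1 : 1 - δ ∈ Icc α β := ⟨by linarith, by linarith⟩
  have m2 : 1 + δ ∈ Icc α β := ⟨by linarith, by linarith⟩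
  have mα : α ∈ Icc α β := ⟨le_rfl, by linarith⟩
  have mβ : β ∈ Icc α β := ⟨by linarith, le_rfl⟩
  rw [← intervalIntegral.integral_add_adjacent_intervals (hii mα m2) (hii m2 mβ),
    ← intervalIntegral.integral_add_adjacent_intervals (hii mα m1) (hii m1 m2)]
  have mono : ∀ {x y : ℝ}, x ≤ y → α ≤ x → y ≤ β → (∀ u ∈ Icc x y, u ≠ 1) →
      ‖∫ u in x..y, (b u : ℂ) * osc (μ * P u)‖ ≤ B := by
    intro x y hxy hx hy hne
    have hsub : Icc x y ⊆ Icc α β := Icc_subset_Icc hx hy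
    refine (norm_integral_osc_off_critical hxy hne (fun u hu => hP u (hsub hu))
      (fun u hu => hS u (hsub hu)) (hS₁.mono hsub) (fun u hu => hb u (hsub hu))
      ((cont hb₁).mono hsub) (fun u hu => hS1 u (hsub hu)) (fun u hu => hD u (hsub hu))
      (fun u hu => hb0' u (hsub hu)) (fun u hu => hb1' u (hsub hu)) hM hμ).trans ?_
    rw [hB]
    gcongr
  have p1 := mono (x := α) (y := 1 - δ) m1.1 le_rfl m1.2 (fun u hu => by linarith [hu.2] : _)
  have p3 := mono (x := 1 + δ) (y := β) m2.2 m2.1 le_rfl (fun u hu h => by linarith [hu.1])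
  have p2 : ‖∫ u in (1 - δ)..(1 + δ), (b u : ℂ) * osc (μ * P u)‖ ≤ K * (2 * δ) := by
    have := norm_integral_mul_osc_le (a := 1 - δ) (b := 1 + δ) (M := K) (by linarith) (q := b)
      (Ψ := fun u => μ * P u) (fun u hu => by
        have hu' : u ∈ Icc α β := ⟨m1.1.trans hu.1, hu.2.trans m2.2⟩
        refine (hb0' u hu').trans ?_
        have : |u - 1| ≤ β - α := abs_le.2 ⟨by linarith [hu'.1], by linarith [hu'.2]⟩
        have := mul_le_mul_of_nonneg_left this hM
        linarith)
    refine this.trans (le_of_eq (by ring))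
  refine (norm_add₃_le).trans ?_
  linarith

/-! ### The normalised phase and the reference integral -/

/-- `1 + u + ⋯ + u^{d-2}`. -/
def geomS (d : ℕ) (u : ℝ) : ℝ := ∑ i ∈ Finset.range (d - 1), u ^ i

/-- The quotient of `u^d/d - u + 1 - 1/d` by `(u-1)²`. -/
def geomQ (d : ℕ) (u : ℝ) : ℝ := (∑ k ∈ Finset.range d, ∑ i ∈ Finset.range k, u ^ i) / d

/-- The normalised phase `u^d/d - u + 1 - 1/d`. -/
def phaseP (d : ℕ) (u : ℝ) : ℝ := u ^ d / d - u + (1 - 1 / d)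

lemma phaseP_eq {d : ℕ} (hd : 2 ≤ d) (u : ℝ) : phaseP d u = (u - 1) ^ 2 * geomQ d u := by
  have hd0 : (d : ℝ) ≠ 0 := by positivity
  have h1 : (∑ k ∈ Finset.range d, ∑ i ∈ Finset.range k, u ^ i) * (u - 1) =
      ∑ k ∈ Finset.range d, (u ^ k - 1) := by
    rw [Finset.sum_mul]
    exact Finset.sum_congr rfl fun k _ => geom_sum_mul u k
  have h2 : (∑ k ∈ Finset.range d, (u ^ k - 1)) = (∑ k ∈ Finset.range d, u ^ k) - d := by
    rw [Finset.sum_sub_distrib]; simp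
  have h3 := geom_sum_mul u d
  unfold phaseP geomQ
  have : (u - 1) ^ 2 * ((∑ k ∈ Finset.range d, ∑ i ∈ Finset.range k, u ^ i) / d) =
      ((∑ k ∈ Finset.range d, ∑ i ∈ Finset.range k, u ^ i) * (u - 1)) * (u - 1) / d := by ring
  rw [this, h1, h2, sub_mul, h3]
  field_simp; ring

lemma hasDerivAt_phaseP {d : ℕ} (hd : 2 ≤ d) (u : ℝ) :
    HasDerivAt (phaseP d) ((u - 1) * geomS d u) u := by
  have hd0 : (d : ℝ) ≠ 0 := by positivity
  unfold phaseP
  have := (((hasDerivAt_pow d u).div_const (d : ℝ)).sub (hasDerivAt_id u)).add_const (1 - 1 / (d : ℝ))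
  convert! this using 1
  have h := geom_sum_mul u (d - 1)
  unfold geomS
  rw [mul_comm, h]
  field_simp

lemma contDiff_geomS (d : ℕ) {n : WithTop ℕ∞} : ContDiff ℝ n (geomS d) := by
  unfold geomS
  exact ContDiff.sum fun i _ => contDiff_id.pow i

lemma contDiff_geomQ (d : ℕ) {n : WithTop ℕ∞} : ContDiff ℝ n (geomQ d) := by
  unfold geomQ
  exact (ContDiff.sum fun k _ => ContDiff.sum fun i _ => contDiff_id.pow i).div_const _

lemma contDiff_phaseP (d : ℕ) {n : WithTop ℕ∞} : ContDiff ℝ n (phaseP d) := by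
  unfold phaseP
  exact (((contDiff_id.pow d).div_const _).sub contDiff_id).add contDiff_const

lemma one_le_geomS {d : ℕ} (hd : 2 ≤ d) {u : ℝ} (hu : 0 ≤ u) : 1 ≤ geomS d u := by
  unfold geomS
  have := Finset.single_le_sum (f := fun i => u ^ i) (s := Finset.range (d - 1))
    (fun i _ => pow_nonneg hu i) (Finset.mem_range.2 (by omega : 0 < d - 1))
  simpa using this

lemma geomQ_pos {d : ℕ} (hd : 2 ≤ d) {u : ℝ} (hu : 0 ≤ u) : 0 < geomQ d u := by
  unfold geomQ
  have hd0 : (0 : ℝ) < d := by positivity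
  have := Finset.single_le_sum (f := fun k => ∑ i ∈ Finset.range k, u ^ i) (s := Finset.range d)
    (fun k _ => Finset.sum_nonneg fun i _ => pow_nonneg hu i) (Finset.mem_range.2 (by omega : 1 < d))
  simp only [Finset.range_one, Finset.sum_singleton, pow_zero] at this
  exact div_pos (by linarith) hd0

/-- Consistent with P = (u-1)²Q and P' = (u-1)S, where both sides equal P''(1). It fixes the value 2
of `refAmp` at the critical point. -/
lemma geomS_one {d : ℕ} (hd : 2 ≤ d) : geomS d 1 = 2 * geomQ d 1 := by
  have hd0 : (d : ℝ) ≠ 0 := by positivity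
  unfold geomS geomQ
  simp only [one_pow, Finset.sum_const, Finset.card_range, nsmul_eq_mul, mul_one]
  have h := Finset.sum_range_id_mul_two d
  have h' : ((∑ k ∈ Finset.range d, k : ℕ) : ℝ) * 2 = d * ((d - 1 : ℕ) : ℝ) := by exact_mod_cast h
  rw [Nat.cast_sum] at h'
  field_simp
  linarith

/-- A smooth bump at `1` supported in `[1/2, 3/2]`. -/
def bumpOne : ContDiffBump (1 : ℝ) where
  rIn := 1 / 4
  rOut := 1 / 2
  rIn_pos := by norm_num
  rIn_lt_rOut := by norm_num

lemma bumpOne_eq_zero {u : ℝ} (hu : u ∉ Ioo (1 / 2 : ℝ) (3 / 2)) : bumpOne u = 0 := by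
  apply bumpOne.zero_of_le_dist
  rw [Real.dist_eq]
  simp only [bumpOne]
  by_contra h
  rw [not_le, abs_lt] at h
  exact hu ⟨by linarith [h.1], by linarith [h.2]⟩

lemma bumpOne_one : bumpOne 1 = 1 :=
  bumpOne.one_of_mem_closedBall (Metric.mem_closedBall_self (by norm_num [bumpOne]))

/-- The reference amplitude, with value `2` at the critical point. -/
def refAmp (d : ℕ) (u : ℝ) : ℝ := bumpOne u * geomS d u / geomQ d u

/-- `geomQ` is known to be positive only for u ≥ 0; for u < 0 the bump vanishes nearby, so zeros of
the denominator there do no harm. -/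
lemma contDiff_refAmp {d : ℕ} (hd : 2 ≤ d) {n : ℕ∞} : ContDiff ℝ n (refAmp d) := by
  rw [contDiff_iff_contDiffAt]
  intro u
  rcases le_or_gt 0 u with hu | hu
  · exact ((bumpOne.contDiffAt).mul (contDiff_geomS d).contDiffAt).div
      (contDiff_geomQ d).contDiffAt (geomQ_pos hd hu).ne'
  · have : refAmp d =ᶠ[nhds u] fun _ => 0 := by
      filter_upwards [Iio_mem_nhds hu] with v hv
      rw [refAmp, bumpOne_eq_zero (fun h => by linarith [h.1, mem_Iio.1 hv])]; simp
    exact contDiffAt_const.congr_of_eventuallyEq this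

lemma refAmp_one {d : ℕ} (hd : 2 ≤ d) : refAmp d 1 = 2 := by
  have := (geomQ_pos hd (zero_le_one (α := ℝ))).ne'
  rw [refAmp, bumpOne_one, geomS_one hd]; field_simp

lemma refAmp_eq_zero {d : ℕ} {u : ℝ} (hu : u ∉ Ioo (1 / 2 : ℝ) (3 / 2)) : refAmp d u = 0 := by
  rw [refAmp, bumpOne_eq_zero hu]; simp

/-- Uniform bound for oscillatory integrals whose amplitude vanishes at the critical point. -/
lemma exists_vanishing_bound {d : ℕ} (hd : 2 ≤ d) {α β : ℝ} (hα0 : 0 ≤ α) (hα : α < 1) (hβ : 1 < β) :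
    ∃ C : ℝ, 0 < C ∧ ∀ (b : ℝ → ℝ) (M μ : ℝ), ContDiff ℝ 2 b → b 1 = 0 →
      (∀ u, |deriv b u| ≤ M) → (∀ u, |deriv (deriv b) u| ≤ M) → μ ≠ 0 →
      ‖∫ u in α..β, (b u : ℂ) * osc (μ * phaseP d u)‖ ≤ C * M / |μ| := by
  have cS := (contDiff_geomS d (n := 2))
  have cS1 : ContDiff ℝ 1 (deriv (geomS d)) :=
    (contDiff_succ_iff_deriv.1 (cS : ContDiff ℝ (1 + 1) _)).2.2
  obtain ⟨D, hD⟩ := isCompact_Icc.exists_bound_of_continuousOn (s := Icc α β)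
    cS1.continuous.continuousOn
  have hD0 : 0 ≤ D := (norm_nonneg _).trans (hD 1 ⟨hα.le, hβ.le⟩)
  refine ⟨2 * (2 + (1 + D) * (β - α)), by
    have : 0 < β - α := by linarith
    positivity, ?_⟩
  intro b M μ hb hb1 hM1 hM2 hμ
  have cb1 : ContDiff ℝ 1 (deriv b) := (contDiff_succ_iff_deriv.1 (hb : ContDiff ℝ (1 + 1) _)).2.2
  have := norm_integral_osc_vanishing (P := phaseP d) (S := geomS d) (S₁ := deriv (geomS d))
    (b := b) (b₁ := deriv b) (b₂ := deriv (deriv b)) (M := M) (D := D) hα hβ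
    (fun u _ => hasDerivAt_phaseP hd u)
    (fun u _ => (cS.differentiable (by simp) u).hasDerivAt) cS1.continuous.continuousOn
    (fun u _ => (hb.differentiable (by simp) u).hasDerivAt)
    (fun u _ => (cb1.differentiable (by simp) u).hasDerivAt)
    (fun u hu => one_le_geomS hd (hα0.trans hu.1)) (fun u hu => hD u hu)
    (fun u _ => hM1 u) (fun u _ => hM2 u) hb1 hμ
  refine this.trans (le_of_eq (by ring))

lemma exists_deriv_bound {b : ℝ → ℝ} (hb : ContDiff ℝ 2 b) (hc : HasCompactSupport b) :
    ∃ M : ℝ, 0 ≤ M ∧ (∀ u, |b u| ≤ M) ∧ (∀ u, |deriv b u| ≤ M) ∧ ∀ u, |deriv (deriv b) u| ≤ M := by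
  have cb1 : ContDiff ℝ 1 (deriv b) := (contDiff_succ_iff_deriv.1 (hb : ContDiff ℝ (1 + 1) _)).2.2
  have cb2 : Continuous (deriv (deriv b)) :=
    (contDiff_succ_iff_deriv.1 (cb1.of_le (by norm_num) : ContDiff ℝ (0 + 1) _)).2.2.continuous
  obtain ⟨M0, h0⟩ := hc.exists_bound_of_continuous hb.continuous
  obtain ⟨M1, h1⟩ := hc.deriv.exists_bound_of_continuous cb1.continuous
  obtain ⟨M2, h2⟩ := hc.deriv.deriv.exists_bound_of_continuous cb2
  exact ⟨max M0 (max M1 M2), (norm_nonneg _).trans ((h0 0).trans (le_max_left _ _)),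
    fun v => (h0 v).trans (le_max_left _ _),
    fun v => (h1 v).trans ((le_max_left _ _).trans (le_max_right _ _)),
    fun v => (h2 v).trans ((le_max_right _ _).trans (le_max_right _ _))⟩

/-- The reference oscillatory integral. -/
def refInt (d : ℕ) (s μ : ℝ) : ℂ := ∫ u in (1 / 2 : ℝ)..(3 / 2), (refAmp d u : ℂ) * osc (s * μ * phaseP d u)

lemma hasDerivAt_refInt {d : ℕ} (hd : 2 ≤ d) (s μ : ℝ) :
    HasDerivAt (refInt d s)
      (∫ u in (1 / 2 : ℝ)..(3 / 2), (refAmp d u : ℂ) * (osc (s * μ * phaseP d u) * ((s * phaseP d u : ℝ) * Complex.I)))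
      μ := by
  have cr : Continuous (refAmp d) := (contDiff_refAmp hd (n := 0)).continuous
  have cp : Continuous (phaseP d) := (contDiff_phaseP d (n := 0)).continuous
  have hc : ∀ μ : ℝ, Continuous (fun u => (refAmp d u : ℂ) * osc (s * μ * phaseP d u)) := fun μ =>
    (Complex.continuous_ofReal.comp cr).mul (continuous_osc.comp (by fun_prop))
  have hc' : ∀ μ : ℝ, Continuous (fun u => (refAmp d u : ℂ) *
      (osc (s * μ * phaseP d u) * ((s * phaseP d u : ℝ) * Complex.I))) := fun μ =>
    (Complex.continuous_ofReal.comp cr).mul ((continuous_osc.comp (by fun_prop)).mul (by fun_prop))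
  refine (intervalIntegral.hasDerivAt_integral_of_dominated_loc_of_deriv_le
    (F := fun μ u => (refAmp d u : ℂ) * osc (s * μ * phaseP d u))
    (F' := fun μ u => (refAmp d u : ℂ) * (osc (s * μ * phaseP d u) * ((s * phaseP d u : ℝ) * Complex.I)))
    (bound := fun u => |refAmp d u| * |s * phaseP d u|) (s := univ) Filter.univ_mem
    (Filter.Eventually.of_forall fun μ => (hc μ).aestronglyMeasurable)
    ((hc μ).intervalIntegrable _ _) (hc' μ).aestronglyMeasurable
    (Filter.Eventually.of_forall fun u _ μ _ => ?_)
    (Continuous.intervalIntegrable (by fun_prop) _ _)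
    (Filter.Eventually.of_forall fun u _ μ _ => ?_)).2
  · simp only [norm_mul, norm_osc, Complex.norm_real, Complex.norm_I, one_mul, mul_one, Real.norm_eq_abs,
      abs_mul, le_refl]
  · have : HasDerivAt (fun μ => s * μ * phaseP d u) (s * phaseP d u) μ := by
      simpa using ((hasDerivAt_id μ).const_mul s).mul_const (phaseP d u)
    exact (hasDerivAt_osc_comp this).const_mul _

/-- Integration by parts in the Euler operator `μ d/dμ`. -/
lemma mul_deriv_refInt {d : ℕ} (hd : 2 ≤ d) (s μ : ℝ) :
    (μ : ℂ) * (∫ u in (1 / 2 : ℝ)..(3 / 2),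
      (refAmp d u : ℂ) * (osc (s * μ * phaseP d u) * ((s * phaseP d u : ℝ) * Complex.I))) =
    - ∫ u in (1 / 2 : ℝ)..(3 / 2), ((deriv (fun u => bumpOne u * (u - 1)) u : ℝ) : ℂ) * osc (s * μ * phaseP d u) := by
  set c : ℝ → ℝ := fun u => bumpOne u * (u - 1) with hc
  have cc : ContDiff ℝ 2 c := bumpOne.contDiff.mul (contDiff_id.sub contDiff_const)
  have cc1 : Continuous (deriv c) :=
    (contDiff_succ_iff_deriv.1 (cc.of_le (by norm_num) : ContDiff ℝ (0 + 1) _)).2.2.continuous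
  have cS : Continuous (geomS d) := (contDiff_geomS d (n := 0)).continuous
  have i1 := integral_mul_deriv_osc (a := 1 / 2) (b := 3 / 2) (q := c) (q' := deriv c)
    (Ψ := fun u => s * μ * phaseP d u) (Ψ' := fun u => s * μ * ((u - 1) * geomS d u))
    (fun u _ => (cc.differentiable (by simp) u).hasDerivAt)
    (fun u _ => (hasDerivAt_phaseP hd u).const_mul _) cc1.continuousOn
    (by fun_prop)
  have z1 : c (1 / 2) = 0 := by simp [hc, bumpOne_eq_zero]
  have z2 : c (3 / 2) = 0 := by simp [hc, bumpOne_eq_zero]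
  rw [z1, z2] at i1
  simp only [Complex.ofReal_zero, zero_mul, sub_zero, mul_zero, zero_add] at i1
  have e : (μ : ℂ) * (∫ u in (1 / 2 : ℝ)..(3 / 2),
      (refAmp d u : ℂ) * (osc (s * μ * phaseP d u) * ((s * phaseP d u : ℝ) * Complex.I))) =
      Complex.I * ∫ u in (1 / 2 : ℝ)..(3 / 2),
        ((c u * (s * μ * ((u - 1) * geomS d u)) : ℝ) : ℂ) * osc (s * μ * phaseP d u) := by
    rw [← intervalIntegral.integral_const_mul, ← intervalIntegral.integral_const_mul]
    apply intervalIntegral.integral_congr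
    intro u hu
    rw [uIcc_of_le (by norm_num)] at hu
    have hQ := (geomQ_pos hd (by linarith [hu.1] : (0 : ℝ) ≤ u)).ne'
    -- `refAmp` is designed for this identity: multiplying it by the phase P gives c P' with c =
    -- bump · (u-1), so the factor P created by differentiating in μ can be integrated by parts.
    have : refAmp d u * phaseP d u = c u * ((u - 1) * geomS d u) := by
      rw [phaseP_eq hd, refAmp, hc]; field_simp
    have h2 : (refAmp d u : ℂ) * (phaseP d u : ℂ) = (c u : ℂ) * (((u : ℂ) - 1) * (geomS d u : ℂ)) := by
      exact_mod_cast this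
    push_cast
    linear_combination (μ * s * Complex.I * osc (s * μ * phaseP d u)) * h2
  rw [e, i1, ← mul_assoc, Complex.I_mul_I, neg_one_mul]

/-- Asymptotics of the reference integral. -/
lemma exists_refInt_asymp {d : ℕ} (hd : 2 ≤ d) {s : ℝ} (hs : |s| = 1) :
    ∃ (κ : ℂ) (C : ℝ), 0 < C ∧ ∀ μ : ℝ, 0 < μ →
      ‖refInt d s μ - κ * ((μ ^ (-(1 / 2) : ℝ) : ℝ) : ℂ)‖ ≤ C / μ := by
  have hs0 : s ≠ 0 := fun h => by simp [h] at hs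
  set c : ℝ → ℝ := fun u => bumpOne u * (u - 1) with hc
  have cc : ContDiff ℝ 3 c := bumpOne.contDiff.mul (contDiff_id.sub contDiff_const)
  have cc1 : ContDiff ℝ 2 (deriv c) :=
    (contDiff_succ_iff_deriv.1 (cc : ContDiff ℝ (2 + 1) _)).2.2
  -- This is the amplitude of (1/2 + μ d/dμ) applied to `refInt`. It vanishes at 1 because `refAmp`
  -- takes the value 2 there and c'(1) = 1.
  set e : ℝ → ℝ := fun u => refAmp d u / 2 - deriv c u with he
  have ce : ContDiff ℝ 2 e := ((contDiff_refAmp hd (n := 2)).div_const 2).sub cc1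
  have hc_one : deriv c 1 = 1 := by
    have h1 : HasDerivAt c (deriv bumpOne 1 * (1 - 1) + bumpOne 1 * 1) 1 :=
      ((bumpOne.contDiff (n := 1)).differentiable (by simp) 1).hasDerivAt.mul
        ((hasDerivAt_id (1 : ℝ)).sub_const 1)
    rw [h1.deriv, bumpOne_one]; ring
  have he1 : e 1 = 0 := by simp only [he, refAmp_one hd, hc_one]; norm_num
  have hcs : HasCompactSupport c := bumpOne.hasCompactSupport.mul_right
  have hrs : HasCompactSupport (refAmp d) :=
    HasCompactSupport.intro (K := Icc (1 / 2 : ℝ) (3 / 2)) isCompact_Icc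
      fun u hu => refAmp_eq_zero fun h => hu ⟨h.1.le, h.2.le⟩
  have hes : HasCompactSupport e := by
    refine HasCompactSupport.sub ?_ hcs.deriv
    exact hrs.comp_left (g := fun x => x / 2) (by simp)
  obtain ⟨M, hM0, -, hM1, hM2⟩ := exists_deriv_bound ce hes
  obtain ⟨C₁, hC₁, hV⟩ := exists_vanishing_bound hd (α := 1 / 2) (β := 3 / 2) (by norm_num)
    (by norm_num) (by norm_num)
  set A : ℝ := C₁ * M + 1 with hA
  have hA0 : 0 < A := by positivity
  -- Its derivative is μ^{-1/2} times an integral of size O(1/μ), hence O(μ^{-3/2}). Integrability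
  -- at infinity makes G converge with error O(μ^{-1/2}); κ is that limit, and no explicit Fresnel
  -- integral is needed.
  set G : ℝ → ℂ := fun μ => ((μ ^ (1 / 2 : ℝ) : ℝ) : ℂ) * refInt d s μ with hG
  have hGd : ∀ μ : ℝ, 0 < μ → ∃ G', HasDerivAt G G' μ ∧ ‖G'‖ ≤ A * μ ^ (-(3 / 2) : ℝ) := by
    intro μ hμ
    have d1 : HasDerivAt (fun μ : ℝ => ((μ ^ (1 / 2 : ℝ) : ℝ) : ℂ))
        (((1 / 2 : ℝ) * μ ^ ((1 / 2 : ℝ) - 1) : ℝ) : ℂ) μ :=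
      (Real.hasDerivAt_rpow_const (Or.inl hμ.ne')).ofReal_comp
    have d2 := d1.mul (hasDerivAt_refInt hd s μ)
    refine ⟨_, d2, ?_⟩
    have hI : (refInt d s μ) / 2 + (μ : ℂ) * (∫ u in (1 / 2 : ℝ)..(3 / 2),
        (refAmp d u : ℂ) * (osc (s * μ * phaseP d u) * ((s * phaseP d u : ℝ) * Complex.I))) =
        ∫ u in (1 / 2 : ℝ)..(3 / 2), (e u : ℂ) * osc ((s * μ) * phaseP d u) := by
      rw [mul_deriv_refInt hd, refInt, ← sub_eq_add_neg, ← intervalIntegral.integral_div,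
        ← intervalIntegral.integral_sub]
      · congr 1; ext u; simp only [he]; push_cast; ring
      · have cr : Continuous (refAmp d) := (contDiff_refAmp hd (n := 0)).continuous
        have cp : Continuous (phaseP d) := (contDiff_phaseP d (n := 0)).continuous
        exact Continuous.intervalIntegrable (((Complex.continuous_ofReal.comp cr).mul
          (continuous_osc.comp (by fun_prop))).div_const 2) _ _
      · have cr : Continuous (deriv c) := cc1.continuous
        have cp : Continuous (phaseP d) := (contDiff_phaseP d (n := 0)).continuous
        exact Continuous.intervalIntegrable ((Complex.continuous_ofReal.comp cr).mul
          (continuous_osc.comp (by fun_prop))) _ _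
    have hr1 : μ ^ (1 / 2 : ℝ) = μ ^ ((1 / 2 : ℝ) - 1) * μ := by
      rw [← Real.rpow_add_one hμ.ne']; norm_num
    have hfac : ((((1 / 2 : ℝ) * μ ^ ((1 / 2 : ℝ) - 1) : ℝ) : ℂ) * refInt d s μ +
        ((μ ^ (1 / 2 : ℝ) : ℝ) : ℂ) * (∫ u in (1 / 2 : ℝ)..(3 / 2),
        (refAmp d u : ℂ) * (osc (s * μ * phaseP d u) * ((s * phaseP d u : ℝ) * Complex.I)))) =
        ((μ ^ ((1 / 2 : ℝ) - 1) : ℝ) : ℂ) *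
          ∫ u in (1 / 2 : ℝ)..(3 / 2), (e u : ℂ) * osc ((s * μ) * phaseP d u) := by
      rw [← hI, hr1]; push_cast; ring
    rw [hfac, norm_mul, Complex.norm_real, Real.norm_of_nonneg (by positivity)]
    have := hV e M (s * μ) ce he1 hM1 hM2 (mul_ne_zero hs0 hμ.ne')
    rw [abs_mul, hs, one_mul, abs_of_pos hμ] at this
    calc _ ≤ μ ^ ((1 / 2 : ℝ) - 1) * (C₁ * M / μ) := by gcongr
      _ ≤ μ ^ ((1 / 2 : ℝ) - 1) * (A / μ) := by gcongr; simp [hA]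
      _ = A * (μ ^ ((1 / 2 : ℝ) - 1) * μ ^ (-1 : ℝ)) := by rw [Real.rpow_neg_one]; ring
      _ = _ := by rw [← Real.rpow_add hμ]; norm_num
  have hGdiff : ∀ μ₁ μ₂ : ℝ, 0 < μ₁ → μ₁ ≤ μ₂ → ‖G μ₂ - G μ₁‖ ≤ 2 * A * μ₁ ^ (-(1 / 2) : ℝ) := by
    intro μ₁ μ₂ h1 h12
    choose! G' hG' hG'b using hGd
    have hpos : ∀ x ∈ Icc μ₁ μ₂, 0 < x := fun x hx => h1.trans_le hx.1
    have key := image_norm_le_of_norm_deriv_right_le_deriv_boundary'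
      (f := fun x => G x - G μ₁) (f' := G') (a := μ₁) (b := μ₂)
      (B := fun x => 2 * A * μ₁ ^ (-(1 / 2) : ℝ) - 2 * A * x ^ (-(1 / 2) : ℝ))
      (B' := fun x => A * x ^ (-(3 / 2) : ℝ))
      (fun x hx => ((hG' x (hpos x hx)).sub_const _).continuousAt.continuousWithinAt)
      (fun x hx => ((hG' x (hpos x ⟨hx.1, hx.2.le⟩)).sub_const _).hasDerivWithinAt)
      (by simp)
      (fun x hx => by
        have hx0 := hpos x hx
        exact (continuousAt_const.sub (continuousAt_const.mul
          (Real.continuousAt_rpow_const x _ (Or.inl hx0.ne')))).continuousWithinAt)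
      (fun x hx => by
        have hx0 := hpos x ⟨hx.1, hx.2.le⟩
        have := ((Real.hasDerivAt_rpow_const (x := x) (p := -(1 / 2)) (Or.inl hx0.ne')).const_mul
          (2 * A)).const_sub (2 * A * μ₁ ^ (-(1 / 2) : ℝ))
        convert! this.hasDerivWithinAt using 1
        rw [show (-(1 / 2) - 1 : ℝ) = -(3 / 2) by norm_num]; ring)
      (fun x hx => hG'b x (hpos x ⟨hx.1, hx.2.le⟩)) (right_mem_Icc.2 h12)
    refine key.trans ?_
    have : 0 ≤ 2 * A * μ₂ ^ (-(1 / 2) : ℝ) := by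
      have := (h1.trans_le h12); positivity
    linarith
  have htend : Filter.Tendsto (fun n : ℕ => 2 * A * ((n : ℝ) + 1) ^ (-(1 / 2) : ℝ)) Filter.atTop (nhds 0) := by
    have h1 : Filter.Tendsto (fun n : ℕ => ((n : ℝ) + 1)) Filter.atTop Filter.atTop :=
      Filter.tendsto_atTop_add_const_right _ _ tendsto_natCast_atTop_atTop
    have := ((tendsto_rpow_neg_atTop (by norm_num : (0 : ℝ) < 1 / 2)).comp h1).const_mul (2 * A)
    simpa using this
  have hcau : CauchySeq (fun n : ℕ => G ((n : ℝ) + 1)) := by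
    refine cauchySeq_of_le_tendsto_0' _ (fun n m hnm => ?_) htend
    rw [dist_comm, dist_eq_norm]
    exact hGdiff _ _ (by positivity) (by gcongr)
  obtain ⟨κ, hκ⟩ := cauchySeq_tendsto_of_complete hcau
  refine ⟨κ, 2 * A, by positivity, fun μ hμ => ?_⟩
  have hlim : ‖κ - G μ‖ ≤ 2 * A * μ ^ (-(1 / 2) : ℝ) := by
    refine le_of_tendsto (hκ.sub_const (G μ)).norm ?_
    obtain ⟨N, hN⟩ := exists_nat_ge μ
    filter_upwards [Filter.eventually_ge_atTop N] with n hn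
    refine hGdiff μ _ hμ ?_
    have : (N : ℝ) ≤ n := by exact_mod_cast hn
    linarith
  have hpp : ((μ ^ (-(1 / 2) : ℝ) : ℝ) : ℂ) * ((μ ^ (1 / 2 : ℝ) : ℝ) : ℂ) = 1 := by
    rw [← Complex.ofReal_mul, ← Real.rpow_add hμ]; norm_num
  have e1 : refInt d s μ - κ * ((μ ^ (-(1 / 2) : ℝ) : ℝ) : ℂ) =
      -(((μ ^ (-(1 / 2) : ℝ) : ℝ) : ℂ) * (κ - G μ)) := by
    simp only [hG]
    linear_combination (-(refInt d s μ)) * hpp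
  rw [e1, norm_neg, norm_mul, Complex.norm_real, Real.norm_of_nonneg (by positivity)]
  calc _ ≤ μ ^ (-(1 / 2) : ℝ) * (2 * A * μ ^ (-(1 / 2) : ℝ)) := by gcongr
    _ = 2 * A * (μ ^ (-(1 / 2) : ℝ) * μ ^ (-(1 / 2) : ℝ)) := by ring
    _ = 2 * A / μ := by
      rw [← Real.rpow_add hμ, show (-(1 / 2) + -(1 / 2) : ℝ) = -1 by norm_num, Real.rpow_neg_one]; rfl

/-! ### Asymptotics of the multiplier symbol -/

/-- The multiplier symbol attached to one branch of the curve. -/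
def symb (ρ₁ : ℝ → ℝ) (d : ℕ) (lam ξ η : ℝ) : ℂ :=
  ∫ t, (ρ₁ t : ℂ) * osc (-(2 * Real.pi * lam * (ξ * t + η * t ^ d)))

/-- The critical point of `ξ t - η t^d`. -/
def critPt (d : ℕ) (ξ η : ℝ) : ℝ := (ξ / (d * η)) ^ (1 / ((d : ℝ) - 1))

/-- First order non-stationary phase estimate. -/
lemma norm_integral_osc_nonstationary {P W W₁ b b₁ : ℝ → ℝ} {α β M D w μ : ℝ} (hαβ : α ≤ β)
    (hP : ∀ u ∈ Icc α β, HasDerivAt P (W u) u)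
    (hW : ∀ u ∈ Icc α β, HasDerivAt W (W₁ u) u) (hW₁ : ContinuousOn W₁ (Icc α β))
    (hb : ∀ u ∈ Icc α β, HasDerivAt b (b₁ u) u) (hb₁ : ContinuousOn b₁ (Icc α β))
    (hw : 0 < w) (hWw : ∀ u ∈ Icc α β, w ≤ W u) (hD : ∀ u ∈ Icc α β, |W₁ u| ≤ D)
    (hM0 : ∀ u ∈ Icc α β, |b u| ≤ M) (hM1 : ∀ u ∈ Icc α β, |b₁ u| ≤ M) (hμ : μ ≠ 0) :
    ‖∫ u in α..β, (b u : ℂ) * osc (μ * P u)‖ ≤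
      (2 * (M / w) + (M / w + M * D / w ^ 2) * (β - α)) / |μ| := by
  have hu : uIcc α β = Icc α β := uIcc_of_le hαβ
  have hWp : ∀ u ∈ Icc α β, 0 < W u := fun u hu => hw.trans_le (hWw u hu)
  have cont : ∀ {F F' : ℝ → ℝ}, (∀ v ∈ Icc α β, HasDerivAt F (F' v) v) → ContinuousOn F (Icc α β) :=
    fun h v hv => (h v hv).continuousAt.continuousWithinAt
  set q : ℝ → ℝ := fun u => b u / W u with hq
  set q₁ : ℝ → ℝ := fun u => (b₁ u * W u - b u * W₁ u) / W u ^ 2 with hq₁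
  have dq : ∀ u ∈ Icc α β, HasDerivAt q (q₁ u) u := fun u hu =>
    (hb u hu).div (hW u hu) (hWp u hu).ne'
  have cq₁ : ContinuousOn q₁ (Icc α β) :=
    ((hb₁.mul (cont hW)).sub ((cont hb).mul hW₁)).div ((cont hW).pow 2)
      fun u hu => pow_ne_zero 2 (hWp u hu).ne'
  have i1 := integral_mul_deriv_osc (a := α) (b := β) (q := q) (q' := q₁) (Ψ := fun u => μ * P u)
    (Ψ' := fun u => μ * W u) (hu ▸ dq) (hu ▸ fun u hu => (hP u hu).const_mul μ) (hu ▸ cq₁)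
    (hu ▸ continuousOn_const.mul (cont hW))
  have e1 : ∫ u in α..β, ((q u * (μ * W u) : ℝ) : ℂ) * osc (μ * P u) =
      (μ : ℂ) * ∫ u in α..β, (b u : ℂ) * osc (μ * P u) := by
    rw [← intervalIntegral.integral_const_mul]
    apply intervalIntegral.integral_congr
    intro u huv
    rw [hu] at huv
    dsimp only
    rw [show q u * (μ * W u) = μ * b u by
      simp only [hq]; have := (hWp u huv).ne'; field_simp]
    push_cast; ring
  rw [e1] at i1
  have bq : ∀ u ∈ Icc α β, |q u| ≤ M / w := fun u huv => by
    simp only [hq, abs_div, abs_of_pos (hWp u huv)]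
    have hM := (abs_nonneg _).trans (hM0 u huv)
    exact div_le_div₀ hM (hM0 u huv) hw (hWw u huv)
  have bq₁ : ∀ u ∈ Icc α β, |q₁ u| ≤ M / w + M * D / w ^ 2 := fun u huv => by
    have hp := hWp u huv
    have hM := (abs_nonneg _).trans (hM0 u huv)
    have hD0 := (abs_nonneg _).trans (hD u huv)
    have e : q₁ u = b₁ u / W u - b u * W₁ u / W u ^ 2 := by
      simp only [hq₁]; field_simp
    rw [e]
    refine (abs_sub _ _).trans (add_le_add ?_ ?_)
    · rw [abs_div, abs_of_pos hp]
      exact div_le_div₀ hM (hM1 u huv) hw (hWw u huv)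
    · rw [abs_div, abs_mul, abs_of_pos (by positivity : 0 < W u ^ 2)]
      have := hWw u huv
      exact div_le_div₀ (by positivity) (mul_le_mul (hM0 u huv) (hD u huv) (abs_nonneg _) hM)
        (by positivity) (by gcongr)
  rw [le_div_iff₀ (abs_pos.2 hμ), mul_comm]
  have : |μ| * ‖∫ u in α..β, (b u : ℂ) * osc (μ * P u)‖ =
      ‖(μ : ℂ) * ∫ u in α..β, (b u : ℂ) * osc (μ * P u)‖ := by
    rw [norm_mul, Complex.norm_real, Real.norm_eq_abs]
  rw [this, i1]
  have hβ := bq β (right_mem_Icc.2 hαβ)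
  have hα := bq α (left_mem_Icc.2 hαβ)
  have hI := norm_integral_mul_osc_le hαβ (Ψ := fun u => μ * P u) bq₁
  refine (norm_add_le _ _).trans (add_le_add ?_ ?_)
  · rw [norm_mul, norm_neg, Complex.norm_I, one_mul, two_mul]
    refine (norm_sub_le _ _).trans ?_
    simp only [norm_mul, norm_osc, mul_one, Complex.norm_real, Real.norm_eq_abs]
    gcongr
  · rw [norm_mul, Complex.norm_I, one_mul]; exact hI

lemma integral_eq_intervalIntegral {F : ℝ → ℂ} {α β : ℝ} (hαβ : α ≤ β)
    (h : ∀ u, u ∉ Ioc α β → F u = 0) : ∫ u, F u = ∫ u in α..β, F u := by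
  rw [intervalIntegral.integral_of_le hαβ, setIntegral_eq_integral_of_forall_compl_eq_zero h]



lemma hasCompactSupport_of_support {ρ₁ : ℝ → ℝ} (hρ_supp : Function.support ρ₁ ⊆ Set.Icc (1 / 2) 2) :
    HasCompactSupport ρ₁ :=
  HasCompactSupport.intro isCompact_Icc fun u hu => by
    by_contra h; exact hu (hρ_supp h)

/-- When both frequencies have the same sign s, the derivative ξ + dηt^{d-1} of the phase (without
s) is at least ξ ≥ 1/8 for t > 0. One integration by parts on [1/4, 3], which contains the support
of ρ₁, gives 1/lam. -/
lemma exists_symb_nonstationary {ρ₁ : ℝ → ℝ} (hρ_smooth : ContDiff ℝ ∞ ρ₁)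
    (hρ_supp : Function.support ρ₁ ⊆ Set.Icc (1 / 2) 2) (d : ℕ) :
    ∃ C : ℝ, 0 < C ∧ ∀ lam s ξ η : ℝ, 0 < lam → |s| = 1 → ξ ∈ Icc (1 / 8 : ℝ) (19 / 8) →
      η ∈ Icc (1 / 8 : ℝ) (19 / 8) → ‖symb ρ₁ d lam (s * ξ) (s * η)‖ ≤ C / lam := by
  have hρ2 : ContDiff ℝ 2 ρ₁ := contDiff_infty.1 hρ_smooth 2
  obtain ⟨M, hM, hM0, hM1, -⟩ := exists_deriv_bound hρ2 (hasCompactSupport_of_support hρ_supp)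
  have cρ1 : ContDiff ℝ 1 (deriv ρ₁) :=
    (contDiff_succ_iff_deriv.1 (hρ2 : ContDiff ℝ (1 + 1) _)).2.2
  set D : ℝ := d * ((d - 1 : ℕ) * 3 ^ (d - 1 - 1)) * (19 / 8) with hD
  set A : ℝ := 2 * (M / (1 / 8)) + (M / (1 / 8) + M * D / (1 / 8) ^ 2) * (3 - 1 / 4) with hA
  have hD0 : 0 ≤ D := by positivity
  have hA0 : 0 ≤ A := by
    have : (0 : ℝ) ≤ 3 - 1 / 4 := by norm_num
    positivity
  refine ⟨A + 1, by positivity, ?_⟩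
  intro lam s ξ η hlam hs hξ hη
  have hs0 : s ≠ 0 := fun h => by simp [h] at hs
  have hη0 : 0 ≤ η := by linarith [hη.1]
  have hμ : -(2 * Real.pi * lam * s) ≠ 0 := by
    have := Real.pi_pos
    exact neg_ne_zero.2 (mul_ne_zero (by positivity) hs0)
  have e : symb ρ₁ d lam (s * ξ) (s * η) = ∫ t in (1 / 4 : ℝ)..3, (ρ₁ t : ℂ) *
      osc (-(2 * Real.pi * lam * s) * (ξ * t + η * t ^ d)) := by
    unfold symb
    rw [← integral_eq_intervalIntegral (by norm_num)]
    · congr 1; ext t; congr 2; ring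
    · intro u hu
      have : ρ₁ u = 0 := by
        by_contra h
        have := hρ_supp h
        exact hu ⟨by linarith [this.1], by linarith [this.2]⟩
      simp [this]
  rw [e]
  have key := norm_integral_osc_nonstationary (α := 1 / 4) (β := 3) (M := M) (D := D) (w := 1 / 8)
    (P := fun t => ξ * t + η * t ^ d) (W := fun t => ξ + η * (d * t ^ (d - 1)))
    (W₁ := fun t => η * (d * ((d - 1 : ℕ) * t ^ (d - 1 - 1))))
    (b := ρ₁) (b₁ := deriv ρ₁) (by norm_num)
    (fun u _ => by
      have := ((hasDerivAt_id u).const_mul ξ).add ((hasDerivAt_pow d u).const_mul η)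
      convert! this using 1; simp)
    (fun u _ => (((hasDerivAt_pow (d - 1) u).const_mul (d : ℝ)).const_mul η).const_add ξ)
    (by fun_prop) (fun u _ => (hρ2.differentiable (by simp) u).hasDerivAt)
    cρ1.continuous.continuousOn (by norm_num)
    (fun u hu => by
      have : 0 ≤ u := by linarith [hu.1]
      have : 0 ≤ η * (d * u ^ (d - 1)) := by positivity
      linarith [hξ.1])
    (fun u hu => by
      have h0 : 0 ≤ u := by linarith [hu.1]
      have := hu.2; have := hη.2
      rw [abs_of_nonneg (by positivity), hD, mul_comm]
      gcongr)
    (fun u _ => hM0 u) (fun u _ => hM1 u) hμ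
  refine key.trans ?_
  rw [abs_neg, abs_mul, hs, mul_one, abs_of_pos (by have := Real.pi_pos; positivity)]
  have hpi := Real.pi_gt_three
  refine div_le_div₀ (by positivity) (by linarith) hlam ?_
  nlinarith

/-- Since ξ/(dη) lies in [1/(19d), 19] and 1/(d-1) is in (0, 1], the critical point stays in the
same range. The last identity is the critical equation dηt^{d-1} = ξ, in the form used for rescaling
the phase. -/
lemma critPt_facts {d : ℕ} (hd : 2 ≤ d) {ξ η : ℝ} (hξ : ξ ∈ Icc (1 / 8 : ℝ) (19 / 8))
    (hη : η ∈ Icc (1 / 8 : ℝ) (19 / 8)) :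
    0 < critPt d ξ η ∧ critPt d ξ η ≤ 19 ∧ 1 / (19 * d) ≤ critPt d ξ η ∧
      η * critPt d ξ η ^ d = ξ * critPt d ξ η / d := by
  have hξ0 : 0 < ξ := by linarith [hξ.1]
  have hη0 : 0 < η := by linarith [hη.1]
  have hd0 : (0 : ℝ) < d := by positivity
  have hd2 : (2 : ℝ) ≤ d := by exact_mod_cast hd
  have hd1 : (0 : ℝ) < (d : ℝ) - 1 := by linarith
  have hz : 0 < ξ / (d * η) := by positivity
  have he0 : 0 ≤ 1 / ((d : ℝ) - 1) := by positivity
  have he1 : 1 / ((d : ℝ) - 1) ≤ 1 := by rw [div_le_one hd1]; linarith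
  have hpos : 0 < critPt d ξ η := Real.rpow_pos_of_pos hz _
  have hz1 : ξ / (d * η) ≤ 19 := by
    rw [div_le_iff₀ (by positivity)]
    nlinarith [hξ.2, hη.1, mul_le_mul hd2 hη.1 (by norm_num) hd0.le]
  have hz2 : 1 / (19 * d) ≤ ξ / (d * η) := by
    rw [div_le_div_iff₀ (by positivity) (by positivity)]
    nlinarith [hξ.1, hη.2, mul_le_mul_of_nonneg_left (by linarith [hξ.1, hη.2] : η ≤ 19 * ξ) hd0.le]
  refine ⟨hpos, ?_, ?_, ?_⟩
  · calc critPt d ξ η ≤ (19 : ℝ) ^ (1 / ((d : ℝ) - 1)) := Real.rpow_le_rpow hz.le hz1 he0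
      _ ≤ (19 : ℝ) ^ (1 : ℝ) := Real.rpow_le_rpow_of_exponent_le (by norm_num) he1
      _ = 19 := Real.rpow_one _
  · have h19 : 1 / (19 * (d : ℝ)) ≤ 1 := by
      rw [div_le_one (by positivity)]; linarith
    calc 1 / (19 * (d : ℝ)) = (1 / (19 * (d : ℝ))) ^ (1 : ℝ) := (Real.rpow_one _).symm
      _ ≤ (1 / (19 * (d : ℝ))) ^ (1 / ((d : ℝ) - 1)) :=
        Real.rpow_le_rpow_of_exponent_ge (by positivity) h19 he1
      _ ≤ critPt d ξ η := Real.rpow_le_rpow (by positivity) hz2 he0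
  · have h1 : critPt d ξ η ^ (d - 1) = ξ / (d * η) := by
      rw [critPt, ← Real.rpow_natCast, ← Real.rpow_mul hz.le, Nat.cast_sub (by omega), Nat.cast_one,
        one_div, inv_mul_cancel₀ hd1.ne', Real.rpow_one]
    have h2 : critPt d ξ η ^ d = critPt d ξ η ^ (d - 1) * critPt d ξ η := by
      rw [← pow_succ]; congr 1; omega
    rw [h2, h1]; field_simp

/-- Leading order stationary phase for the symbol. -/
lemma exists_symb_stationary {ρ₁ : ℝ → ℝ} (hρ_smooth : ContDiff ℝ ∞ ρ₁)
    (hρ_supp : Function.support ρ₁ ⊆ Set.Icc (1 / 2) 2) {d : ℕ} (hd : 2 ≤ d) {s : ℝ} (hs : |s| = 1) :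
    ∃ (κ : ℂ) (C : ℝ), 0 < C ∧ ∀ lam ξ η : ℝ, 0 < lam → ξ ∈ Icc (1 / 8 : ℝ) (19 / 8) →
      η ∈ Icc (1 / 8 : ℝ) (19 / 8) →
      ‖symb ρ₁ d lam (-s * ξ) (s * η) - κ * ((lam ^ (-(1 / 2) : ℝ) : ℝ) : ℂ) *
        ((ξ ^ (-(1 / 2) : ℝ) * (critPt d ξ η ^ (1 / 2 : ℝ) * ρ₁ (critPt d ξ η)) : ℝ) : ℂ) *
        osc (s * (2 * Real.pi * lam * (1 - 1 / d) * (ξ * critPt d ξ η)))‖ ≤ C / lam := by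
  have hρ2 : ContDiff ℝ 2 ρ₁ := contDiff_infty.1 hρ_smooth 2
  have hρ1 : ContDiff ℝ 1 (deriv ρ₁) :=
    (contDiff_succ_iff_deriv.1 (hρ2 : ContDiff ℝ (1 + 1) _)).2.2
  obtain ⟨M, hM, hM0, hM1, hM2⟩ := exists_deriv_bound hρ2 (hasCompactSupport_of_support hρ_supp)
  have hr2 : ContDiff ℝ 2 (refAmp d) := contDiff_refAmp hd
  have hr1 : ContDiff ℝ 1 (deriv (refAmp d)) :=
    (contDiff_succ_iff_deriv.1 (hr2 : ContDiff ℝ (1 + 1) _)).2.2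
  obtain ⟨N, hN, -, hN1, hN2⟩ := exists_deriv_bound hr2
    (HasCompactSupport.intro (K := Icc (1 / 2 : ℝ) (3 / 2)) isCompact_Icc
      fun u hu => refAmp_eq_zero fun h => hu ⟨h.1.le, h.2.le⟩)
  obtain ⟨κ₀, C₁, hC₁, hE⟩ := exists_refInt_asymp hd (s := -s) (by rwa [abs_neg])
  have hd0 : (0 : ℝ) < d := by positivity
  -- Chosen so that [1/40, β] contains every u with t₀u in [1/2, 2]: t₀ ≤ 19 gives the lower end,
  -- and t₀ ≥ 1/(19d) gives t₀β > 2.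
  set β : ℝ := 38 * d + 2 with hβ
  have hβ1 : 3 / 2 ≤ β := by rw [hβ]; linarith
  obtain ⟨C₂, hC₂, hV⟩ := exists_vanishing_bound hd (α := 1 / 40) (β := β) (by norm_num)
    (by norm_num) (by linarith)
  -- 361 = 19² bounds the factor t₀² in the second derivative of u ↦ ρ₁(t₀u).
  set M' : ℝ := 361 * M + M / 2 * N with hM'
  refine ⟨κ₀ / 2 * (((2 * Real.pi) ^ (-(1 / 2) : ℝ) : ℝ) : ℂ), 2 * (C₂ * M' + M / 2 * C₁) + 1,
    by positivity, ?_⟩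
  intro lam ξ η hlam hξ hη
  obtain ⟨ht0, ht19, htlow, hcrit⟩ := critPt_facts hd hξ hη
  set t₀ := critPt d ξ η with hT
  have hξ0 : 0 < ξ := by linarith [hξ.1]
  have hpi := Real.pi_pos
  set μ : ℝ := 2 * Real.pi * lam * ξ * t₀ with hμ
  have hμ0 : 0 < μ := by positivity
  have hs0 : s ≠ 0 := fun h => by simp [h] at hs
  set θ : ℝ := s * (2 * Real.pi * lam * (1 - 1 / d) * (ξ * t₀)) with hθ
  -- Subtracting this multiple of `refAmp` makes the amplitude vanish at u = 1. The argument also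
  -- covers critical points outside the support of ρ₁, where the leading term is simply zero.
  set b : ℝ → ℝ := fun u => ρ₁ (t₀ * u) - ρ₁ t₀ / 2 * refAmp d u with hb
  -- Under t = t₀u the critical equation turns the phase into θ - sμP(u), with θ the critical value
  -- and μ = 2π lam ξ t₀.
  have e1 : symb ρ₁ d lam (-s * ξ) (s * η) =
      t₀ * (osc θ * ∫ u in (1 / 40 : ℝ)..β, (ρ₁ (t₀ * u) : ℂ) * osc (-s * μ * phaseP d u)) := by
    have h1 : ∫ u, (fun t => (ρ₁ t : ℂ) *
        osc (-(2 * Real.pi * lam * (-s * ξ * t + s * η * t ^ d)))) (t₀ * u) =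
        |t₀⁻¹| • symb ρ₁ d lam (-s * ξ) (s * η) := by
      exact Measure.integral_comp_mul_left (fun t : ℝ => (ρ₁ t : ℂ) *
        osc (-(2 * Real.pi * lam * (-s * ξ * t + s * η * t ^ d)))) t₀
    rw [← integral_eq_intervalIntegral (by linarith), ← integral_const_mul (osc θ)]
    · have h2 : ∀ u, osc θ * ((ρ₁ (t₀ * u) : ℂ) * osc (-s * μ * phaseP d u)) =
          (fun t => (ρ₁ t : ℂ) *
            osc (-(2 * Real.pi * lam * (-s * ξ * t + s * η * t ^ d)))) (t₀ * u) := by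
        intro u
        dsimp only
        rw [mul_left_comm, ← osc_add]
        congr 2
        have : s * η * (t₀ * u) ^ d = s * (ξ * t₀ / d) * u ^ d := by
          rw [mul_pow, ← hcrit]; ring
        rw [this, hθ, hμ, phaseP]
        field_simp; ring
      simp only [h2]
      rw [h1, abs_of_pos (by positivity), Complex.real_smul, ← mul_assoc, ← Complex.ofReal_mul,
        mul_inv_cancel₀ ht0.ne', Complex.ofReal_one, one_mul]
    · intro u hu
      have : ρ₁ (t₀ * u) = 0 := by
        by_contra h
        obtain ⟨h1, h2⟩ := hρ_supp h
        apply hu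
        constructor
        · by_contra hc
          have : t₀ * u ≤ 19 * (1 / 40) := by
            have hu0 : 0 < u := by
              by_contra h'; nlinarith
            exact mul_le_mul ht19 (not_lt.1 hc) hu0.le (by norm_num)
          linarith
        · by_contra hc
          have h3 : 1 / (19 * (d : ℝ)) * β ≤ t₀ * u :=
            mul_le_mul htlow (not_le.1 hc).le (by linarith) ht0.le
          have h4 : 2 < 1 / (19 * (d : ℝ)) * β := by
            rw [hβ, one_div, inv_mul_eq_div, lt_div_iff₀ (by positivity)]; linarith
          linarith
      simp [this]
  have e2 : ∫ u in (1 / 40 : ℝ)..β, (refAmp d u : ℂ) * osc (-s * μ * phaseP d u) =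
      refInt d (-s) μ := by
    unfold refInt
    have hz : ∀ u, u ∉ Ioc (1 / 2 : ℝ) (3 / 2) →
        (refAmp d u : ℂ) * osc (-s * μ * phaseP d u) = 0 := fun u hu => by
      rw [refAmp_eq_zero fun h => hu ⟨h.1, h.2.le⟩]; simp
    rw [← integral_eq_intervalIntegral (by norm_num) hz,
      ← integral_eq_intervalIntegral (by linarith)]
    exact fun u hu => hz u fun h => hu ⟨by linarith [h.1], by linarith [h.2]⟩
  have cp : Continuous (phaseP d) := (contDiff_phaseP d (n := 0)).continuous
  have e3 : ∫ u in (1 / 40 : ℝ)..β, (ρ₁ (t₀ * u) : ℂ) * osc (-s * μ * phaseP d u) =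
      (∫ u in (1 / 40 : ℝ)..β, (b u : ℂ) * osc (-s * μ * phaseP d u)) +
        ((ρ₁ t₀ / 2 : ℝ) : ℂ) * refInt d (-s) μ := by
    rw [← e2, ← intervalIntegral.integral_const_mul, ← intervalIntegral.integral_add]
    · congr 1; ext u; simp only [hb]; push_cast; ring
    · have hc : Continuous b := (hρ2.continuous.comp (by fun_prop)).sub
        (continuous_const.mul hr2.continuous)
      exact Continuous.intervalIntegrable ((Complex.continuous_ofReal.comp hc).mul
        (continuous_osc.comp (by fun_prop))) _ _
    · exact Continuous.intervalIntegrable (continuous_const.mul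
        ((Complex.continuous_ofReal.comp hr2.continuous).mul
        (continuous_osc.comp (by fun_prop)))) _ _
  have hbC : ContDiff ℝ 2 b := (hρ2.comp (contDiff_const.mul contDiff_id)).sub
    (contDiff_const.mul hr2)
  have hdb : deriv b = fun u => t₀ * deriv ρ₁ (t₀ * u) - ρ₁ t₀ / 2 * deriv (refAmp d) u := by
    ext u
    have h1 : HasDerivAt (fun u => ρ₁ (t₀ * u)) (deriv ρ₁ (t₀ * u) * t₀) u :=
      HasDerivAt.comp u (hρ2.differentiable (by simp) (t₀ * u)).hasDerivAt
        (by simpa using (hasDerivAt_id u).const_mul t₀)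
    have h2 : HasDerivAt b (deriv ρ₁ (t₀ * u) * t₀ - ρ₁ t₀ / 2 * deriv (refAmp d) u) u :=
      h1.sub ((hr2.differentiable (by simp) u).hasDerivAt.const_mul (ρ₁ t₀ / 2))
    rw [h2.deriv]
    ring
  have hddb : deriv (deriv b) = fun u => t₀ * (t₀ * deriv (deriv ρ₁) (t₀ * u)) -
      ρ₁ t₀ / 2 * deriv (deriv (refAmp d)) u := by
    rw [hdb]
    ext u
    have h1 : HasDerivAt (fun u => deriv ρ₁ (t₀ * u)) (deriv (deriv ρ₁) (t₀ * u) * t₀) u :=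
      HasDerivAt.comp u (hρ1.differentiable (by simp) (t₀ * u)).hasDerivAt
        (by simpa using (hasDerivAt_id u).const_mul t₀)
    have h2 : HasDerivAt (fun u => t₀ * deriv ρ₁ (t₀ * u) - ρ₁ t₀ / 2 * deriv (refAmp d) u)
        (t₀ * (deriv (deriv ρ₁) (t₀ * u) * t₀) - ρ₁ t₀ / 2 * deriv (deriv (refAmp d)) u) u :=
      (h1.const_mul t₀).sub
        ((hr1.differentiable (by simp) u).hasDerivAt.const_mul (ρ₁ t₀ / 2))
    rw [h2.deriv]
    ring
  have hρt : |ρ₁ t₀ / 2| ≤ M / 2 := by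
    rw [abs_div, Nat.abs_ofNat]; have := hM0 t₀; linarith
  have hb1 : ∀ u, |deriv b u| ≤ M' := fun u => by
    rw [hdb]
    refine (abs_sub _ _).trans (add_le_add ?_ ?_)
    · rw [abs_mul, abs_of_pos ht0]
      calc _ ≤ 19 * M := mul_le_mul ht19 (hM1 _) (abs_nonneg _) (by norm_num)
        _ ≤ _ := by linarith
    · rw [abs_mul]; exact mul_le_mul hρt (hN1 u) (abs_nonneg _) (by positivity)
  have hb2 : ∀ u, |deriv (deriv b) u| ≤ M' := fun u => by
    rw [hddb]
    refine (abs_sub _ _).trans (add_le_add ?_ ?_)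
    · rw [abs_mul, abs_mul, abs_of_pos ht0]
      calc _ ≤ 19 * (19 * M) := by
            gcongr; exact hM2 _
        _ ≤ _ := by linarith
    · rw [abs_mul]; exact mul_le_mul hρt (hN2 u) (abs_nonneg _) (by positivity)
  have k1 := hV b M' (-s * μ) hbC (by simp only [hb, refAmp_one hd, mul_one]; ring) hb1 hb2
    (mul_ne_zero (neg_ne_zero.2 hs0) hμ0.ne')
  rw [abs_mul, abs_neg, hs, one_mul, abs_of_pos hμ0] at k1
  have k2 := hE μ hμ0
  have hmain : κ₀ / 2 * (((2 * Real.pi) ^ (-(1 / 2) : ℝ) : ℝ) : ℂ) *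
      ((lam ^ (-(1 / 2) : ℝ) : ℝ) : ℂ) *
        ((ξ ^ (-(1 / 2) : ℝ) * (t₀ ^ (1 / 2 : ℝ) * ρ₁ t₀) : ℝ) : ℂ) * osc θ =
      t₀ * (osc θ * (((ρ₁ t₀ / 2 : ℝ) : ℂ) * (κ₀ * ((μ ^ (-(1 / 2) : ℝ) : ℝ) : ℂ)))) := by
    have h1 : μ ^ (-(1 / 2) : ℝ) = (2 * Real.pi) ^ (-(1 / 2) : ℝ) * lam ^ (-(1 / 2) : ℝ) *
        ξ ^ (-(1 / 2) : ℝ) * t₀ ^ (-(1 / 2) : ℝ) := by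
      rw [hμ, Real.mul_rpow (by positivity) ht0.le, Real.mul_rpow (by positivity) hξ0.le,
        Real.mul_rpow (by positivity) hlam.le]
    have h2 : t₀ ^ (1 / 2 : ℝ) = t₀ * t₀ ^ (-(1 / 2) : ℝ) := by
      nth_rewrite 2 [← Real.rpow_one t₀]
      rw [← Real.rpow_add ht0]; norm_num
    rw [h1, h2]; push_cast; ring
  rw [hmain, e1, e3]
  have hfin : (t₀ : ℂ) * (osc θ * ((∫ u in (1 / 40 : ℝ)..β, (b u : ℂ) * osc (-s * μ * phaseP d u)) +
        ((ρ₁ t₀ / 2 : ℝ) : ℂ) * refInt d (-s) μ)) -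
      t₀ * (osc θ * (((ρ₁ t₀ / 2 : ℝ) : ℂ) * (κ₀ * ((μ ^ (-(1 / 2) : ℝ) : ℝ) : ℂ)))) =
      t₀ * (osc θ * ((∫ u in (1 / 40 : ℝ)..β, (b u : ℂ) * osc (-s * μ * phaseP d u)) +
        ((ρ₁ t₀ / 2 : ℝ) : ℂ) * (refInt d (-s) μ - κ₀ * ((μ ^ (-(1 / 2) : ℝ) : ℝ) : ℂ)))) := by ring
  rw [hfin, norm_mul, norm_mul, norm_osc, one_mul, Complex.norm_real, Real.norm_of_nonneg ht0.le]
  have k3 : ‖(∫ u in (1 / 40 : ℝ)..β, (b u : ℂ) * osc (-s * μ * phaseP d u)) +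
        ((ρ₁ t₀ / 2 : ℝ) : ℂ) * (refInt d (-s) μ - κ₀ * ((μ ^ (-(1 / 2) : ℝ) : ℝ) : ℂ))‖ ≤
      (C₂ * M' + M / 2 * C₁) / μ := by
    refine (norm_add_le _ _).trans ?_
    rw [add_div, norm_mul, Complex.norm_real, mul_div_assoc (M / 2)]
    exact add_le_add k1 (mul_le_mul hρt k2 (norm_nonneg _) (by positivity))
  have hX : 0 ≤ C₂ * M' + M / 2 * C₁ := by positivity
  calc _ ≤ t₀ * ((C₂ * M' + M / 2 * C₁) / μ) := by gcongr
    _ = (C₂ * M' + M / 2 * C₁) / (2 * Real.pi * lam * ξ) := by rw [hμ]; field_simp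
    _ ≤ (C₂ * M' + M / 2 * C₁) / (lam / 2) := by
      gcongr
      have h3 := Real.pi_gt_three
      have h8 := hξ.1
      have : (3 : ℝ) * (1 / 8) ≤ Real.pi * ξ := by gcongr
      nlinarith
    _ = 2 * (C₂ * M' + M / 2 * C₁) / lam := by field_simp
    _ ≤ _ := by gcongr; linarith

/-! ### Separation of variables in the amplitude -/

lemma memLp_of_norm_le_mul {f g : ℝ → ℂ} {c : ℝ} (hf : Measurable f) (hg : MemLp g 2 volume)
    (h : ∀ x, ‖f x‖ ≤ c * ‖g x‖) : MemLp f 2 volume :=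
  MemLp.of_le_mul hg hf.aestronglyMeasurable (Filter.Eventually.of_forall h)

lemma integrable_triForm {f g h : ℝ → ℂ} (hf : Measurable f) (hg : Measurable g)
    (hh : Measurable h) (hf1 : Integrable f) (hg2 : MemLp g 2 volume) (hh2 : MemLp h 2 volume)
    (ε : ℝ) {M : ℝ → ℝ → ℂ} {B : ℝ} (hMm : Measurable (Function.uncurry M))
    (hM : ∀ x y, ‖M x y‖ ≤ B) :
    Integrable (fun q : ℝ × ℝ => f q.1 * g q.2 * h (q.2 + ε * q.1) * M q.1 q.2)
      (volume.prod volume) :=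
  (integrable_tri hf hg hh hf1 hg2 hh2 ε).mul_bdd (c := B) hMm.aestronglyMeasurable
    (Filter.Eventually.of_forall fun q => hM q.1 q.2)

lemma schwartz_eq_integral_osc (Θ : 𝓢(ℝ, ℂ)) (r : ℝ) :
    Θ r = ∫ v, (𝓕 Θ : 𝓢(ℝ, ℂ)) v * osc (2 * Real.pi * v * r) := by
  have h : (𝓕⁻ (𝓕 Θ : 𝓢(ℝ, ℂ)) : 𝓢(ℝ, ℂ)) r = Θ r := by rw [FourierTransform.fourierInv_fourier_eq]
  rw [← h, SchwartzMap.fourierInv_coe, Real.fourierInv_eq']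
  refine integral_congr_ae (Filter.Eventually.of_forall fun v => ?_)
  simp only [smul_eq_mul, osc]
  rw [mul_comm]
  congr 3
  simp; ring

/-- The model estimate is stable under multiplication of the symbol by a Schwartz function of an
affine combination of `log x` and `log y`. -/
theorem exists_amplitude_bound {a b : ℝ} (ha : |a| ≤ 2) (hb : |b| ≤ 2) (ha0 : a ≠ 0) (ha1 : a ≠ 1)
    (hb0 : b ≠ 0) (Θ : 𝓢(ℝ, ℂ)) (γ₁ γ₂ γ₃ : ℝ) :
    ∃ C : ℝ, 0 < C ∧ ∀ (lam ε : ℝ) (f g h : ℝ → ℂ), lam ≠ 0 → ε ≠ 0 → |ε| ≤ 1 / 100 →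
      |ε| * |b - 1| * (2 * 40 ^ 14) ≤ |a - 1| → Measurable f → Measurable g → Measurable h →
      MemLp f 2 volume → MemLp g 2 volume → MemLp h 2 volume →
      Function.support f ⊆ Icc (1 / 8) (19 / 8) → Function.support g ⊆ Icc (1 / 8) (19 / 8) →
      ‖triForm ε (fun x y => modelPhase a b lam x y *
          Θ (γ₁ * Real.log x + γ₂ * Real.log y + γ₃)) f g h‖ ≤
        C * (|lam| * |ε|) ^ (-(1 / 6) : ℝ) * (l2 f * l2 g * l2 h) := by
  obtain ⟨C, hC, hmodel⟩ := exists_model_bound ha hb ha0 ha1 hb0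
  set A : 𝓢(ℝ, ℂ) := 𝓕 Θ with hA
  have hAi : Integrable A := A.integrable
  refine ⟨(∫ v, ‖A v‖) * C + 1, by positivity, ?_⟩
  intro lam ε f g h hlam hε hε1 hε2 hfm hgm hhm hf hg hh hfs hgs
  have hf1 := integrable_of_support hf hfs
  set F : ℝ × ℝ → ℂ := fun q => f q.1 * g q.2 * h (q.2 + ε * q.1) * modelPhase a b lam q.1 q.2
    with hF
  have hFi : Integrable F (volume.prod volume) :=
    integrable_triForm hfm hgm hhm hf1 hg hh ε (measurable_modelPhase a b lam)
      fun x y => (norm_osc _).le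
  set r : ℝ × ℝ → ℝ := fun q => γ₁ * Real.log q.1 + γ₂ * Real.log q.2 + γ₃ with hr
  have hrm : Measurable r := by fun_prop
  set D : ℝ := C * (|lam| * |ε|) ^ (-(1 / 6) : ℝ) * (l2 f * l2 g * l2 h) with hD
  have hD0 : 0 ≤ D := by
    have := l2_nonneg f; have := l2_nonneg g; have := l2_nonneg h; positivity
  have hInt : Integrable (fun z : (ℝ × ℝ) × ℝ =>
      F z.1 * A z.2 * osc (2 * Real.pi * z.2 * r z.1)) ((volume.prod volume).prod volume) := by
    refine (hFi.mul_prod hAi).mul_bdd (c := 1) ?_ (Filter.Eventually.of_forall fun z => (norm_osc _).le)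
    exact (measurable_osc.comp (by fun_prop)).aestronglyMeasurable
  have e1 : triForm ε (fun x y => modelPhase a b lam x y *
      Θ (γ₁ * Real.log x + γ₂ * Real.log y + γ₃)) f g h =
      ∫ v, ∫ q, F q * A v * osc (2 * Real.pi * v * r q) ∂(volume.prod volume) := by
    rw [← integral_integral_swap hInt]
    unfold triForm
    congr 1; ext q
    dsimp only
    rw [schwartz_eq_integral_osc Θ, ← hA, ← mul_assoc, ← integral_const_mul]
    congr 1; ext v
    simp only [hF, hr]; ring
  -- For each Fourier variable v the exponential of γ₁ log x + γ₂ log y + γ₃ splits, and its factors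
  -- modulate f and g without changing supports or absolute values. The model bound is thus uniform
  -- in v, and the L¹ norm of the transform of Θ enters the constant.
  have e2 : ∀ v, ∫ q, F q * A v * osc (2 * Real.pi * v * r q) ∂(volume.prod volume) =
      A v * osc (2 * Real.pi * v * γ₃) * triForm ε (modelPhase a b lam)
        (fun x => f x * osc (2 * Real.pi * v * (γ₁ * Real.log x)))
        (fun y => g y * osc (2 * Real.pi * v * (γ₂ * Real.log y))) h := by
    intro v
    unfold triForm
    rw [← integral_const_mul]
    congr 1; ext q
    have : osc (2 * Real.pi * v * r q) = osc (2 * Real.pi * v * (γ₁ * Real.log q.1)) *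
        osc (2 * Real.pi * v * (γ₂ * Real.log q.2)) * osc (2 * Real.pi * v * γ₃) := by
      rw [← osc_add, ← osc_add]; congr 1; simp only [hr]; ring
    rw [this]; simp only [hF]; ring
  have e3 : ∀ v, ‖∫ q, F q * A v * osc (2 * Real.pi * v * r q) ∂(volume.prod volume)‖ ≤
      ‖A v‖ * D := by
    intro v
    rw [e2, norm_mul, norm_mul, norm_osc, mul_one]
    refine mul_le_mul_of_nonneg_left ?_ (norm_nonneg _)
    have tw : ∀ (u : ℝ → ℂ) (γ : ℝ), Measurable u → MemLp u 2 volume →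
        Function.support u ⊆ Icc (1 / 8) (19 / 8) →
        Measurable (fun x => u x * osc (2 * Real.pi * v * (γ * Real.log x))) ∧
        MemLp (fun x => u x * osc (2 * Real.pi * v * (γ * Real.log x))) 2 volume ∧
        Function.support (fun x => u x * osc (2 * Real.pi * v * (γ * Real.log x))) ⊆
          Icc (1 / 8) (19 / 8) ∧
        l2 (fun x => u x * osc (2 * Real.pi * v * (γ * Real.log x))) ≤ l2 u := by
      intro u γ hu hu2 hus
      have hm : Measurable (fun x => u x * osc (2 * Real.pi * v * (γ * Real.log x))) :=
        hu.mul (measurable_osc.comp (by fun_prop))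
      have hn : ∀ x, ‖u x * osc (2 * Real.pi * v * (γ * Real.log x))‖ ≤ 1 * ‖u x‖ := fun x => by
        rw [norm_mul, norm_osc, mul_one, one_mul]
      refine ⟨hm, memLp_of_norm_le_mul hm hu2 hn, fun x hx => hus fun h0 => hx ?_, ?_⟩
      · simp [h0]
      · exact l2_mono hu2 fun x => by simpa using hn x
    obtain ⟨m1, m2, m3, m4⟩ := tw f γ₁ hfm hf hfs
    obtain ⟨n1, n2, n3, n4⟩ := tw g γ₂ hgm hg hgs
    refine (hmodel lam ε _ _ h hlam hε hε1 hε2 m1 n1 hhm m2 n2 hh m3 n3).trans ?_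
    have := l2_nonneg f; have := l2_nonneg h
    rw [hD]; gcongr
    exact l2_nonneg _
  rw [e1]
  calc _ ≤ ∫ v, ‖A v‖ * D := norm_integral_le_of_norm_le (hAi.norm.mul_const D)
        (Filter.Eventually.of_forall e3)
    _ = (∫ v, ‖A v‖) * D := integral_mul_const _ _
    _ ≤ ((∫ v, ‖A v‖) * C + 1) * (|lam| * |ε|) ^ (-(1 / 6) : ℝ) * (l2 f * l2 g * l2 h) := by
      have : 0 ≤ (|lam| * |ε|) ^ (-(1 / 6) : ℝ) * (l2 f * l2 g * l2 h) := by
        have := l2_nonneg f; have := l2_nonneg g; have := l2_nonneg h; positivity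
      rw [hD]; nlinarith

/-! ### Decay in the positive quadrant -/

/-- Decay of the trilinear forms with symbols `M lam` on functions living on `[1/8, 19/8]`. -/
def PosDecay (ε₀ : ℝ) (M : ℝ → ℝ → ℝ → ℂ) : Prop :=
  ∃ C : ℝ, 0 < C ∧ ∀ (lam ε : ℝ) (f g h : ℝ → ℂ), 1 ≤ lam → ε ≠ 0 → |ε| ≤ ε₀ →
    Measurable f → Measurable g → Measurable h →
    MemLp f 2 volume → MemLp g 2 volume → MemLp h 2 volume →
    Function.support f ⊆ Icc (1 / 8) (19 / 8) → Function.support g ⊆ Icc (1 / 8) (19 / 8) →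
    ‖triForm ε (M lam) f g h‖ ≤
      C * (lam ^ (-(1 / 2) : ℝ) * (lam * |ε|) ^ (-(1 / 6) : ℝ)) * (l2 f * l2 g * l2 h)

/-- An error of size `1 / lam` in the symbol is admissible. -/
lemma inv_le_decay {lam ε : ℝ} (hlam : 1 ≤ lam) (hε : ε ≠ 0) (hε1 : |ε| ≤ 1) :
    1 / lam ≤ lam ^ (-(1 / 2) : ℝ) * (lam * |ε|) ^ (-(1 / 6) : ℝ) := by
  have h0 : 0 < lam := by linarith
  have h1 : lam ^ (-(1 / 6) : ℝ) ≤ (lam * |ε|) ^ (-(1 / 6) : ℝ) :=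
    Real.rpow_le_rpow_of_nonpos (by positivity) (by nlinarith [abs_nonneg ε]) (by norm_num)
  have h2 : lam ^ (-(1 / 2) : ℝ) ≤ lam ^ (-(1 / 6) : ℝ) :=
    Real.rpow_le_rpow_of_exponent_le hlam (by norm_num)
  have h3 : 1 / lam = lam ^ (-(1 / 2) : ℝ) * lam ^ (-(1 / 2) : ℝ) := by
    rw [← Real.rpow_add h0, one_div, ← Real.rpow_neg_one]; norm_num
  rw [h3]
  gcongr
  exact h2.trans h1

lemma posDecay_of_bound {ε₀ : ℝ} (hε₀ : ε₀ ≤ 1) {M : ℝ → ℝ → ℝ → ℂ} {C : ℝ} (hC : 0 < C)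
    (hM : ∀ lam x y, 0 < lam → x ∈ Icc (1 / 8 : ℝ) (19 / 8) → y ∈ Icc (1 / 8 : ℝ) (19 / 8) →
      ‖M lam x y‖ ≤ C / lam) : PosDecay ε₀ M := by
  refine ⟨2 * C, by positivity, ?_⟩
  intro lam ε f g h hlam hε hε1 hfm hgm hhm hf hg hh hfs hgs
  have h0 : 0 < lam := by linarith
  have := l2_nonneg f; have := l2_nonneg g; have := l2_nonneg h
  calc _ ≤ C / lam * ((∫ x, ‖f x‖) * (l2 g * l2 h)) :=
        norm_triForm_le hfm hgm hhm (integrable_of_support hf hfs) hg hh ε (by positivity)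
          fun x y hx hy => hM lam x y h0 (hfs hx) (hgs hy)
    _ ≤ C / lam * ((2 * l2 f) * (l2 g * l2 h)) := by
        gcongr; exact integral_norm_le hf hfs
    _ = 2 * C * (1 / lam) * (l2 f * l2 g * l2 h) := by ring
    _ ≤ _ := by gcongr; exact inv_le_decay hlam hε (hε1.trans hε₀)

lemma PosDecay.add {ε₀ : ℝ} {M N : ℝ → ℝ → ℝ → ℂ} (hM : PosDecay ε₀ M) (hN : PosDecay ε₀ N)
    (hMi : ∀ lam, Measurable (Function.uncurry (M lam)))
    (hNi : ∀ lam, Measurable (Function.uncurry (N lam)))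
    {B : ℝ → ℝ} (hMb : ∀ lam, 1 ≤ lam → ∀ x ∈ Icc (1 / 8 : ℝ) (19 / 8), ∀ y ∈ Icc (1 / 8 : ℝ) (19 / 8),
      ‖M lam x y‖ ≤ B lam)
    (hNb : ∀ lam, 1 ≤ lam → ∀ x ∈ Icc (1 / 8 : ℝ) (19 / 8), ∀ y ∈ Icc (1 / 8 : ℝ) (19 / 8),
      ‖N lam x y‖ ≤ B lam) :
    PosDecay ε₀ (fun lam x y => M lam x y + N lam x y) := by
  obtain ⟨C, hC, hM⟩ := hM
  obtain ⟨D, hD, hN⟩ := hN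
  refine ⟨C + D, by positivity, ?_⟩
  intro lam ε f g h hlam hε hε1 hfm hgm hhm hf hg hh hfs hgs
  have key : ∀ {P : ℝ → ℝ → ℂ}, Measurable (Function.uncurry P) →
      (∀ x ∈ Icc (1 / 8 : ℝ) (19 / 8), ∀ y ∈ Icc (1 / 8 : ℝ) (19 / 8), ‖P x y‖ ≤ B lam) →
      Integrable (fun q : ℝ × ℝ => f q.1 * g q.2 * h (q.2 + ε * q.1) * P q.1 q.2)
        (volume.prod volume) := by
    intro P hP hPb
    have hS : MeasurableSet (Icc (1 / 8 : ℝ) (19 / 8) ×ˢ Icc (1 / 8 : ℝ) (19 / 8)) :=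
      measurableSet_Icc.prod measurableSet_Icc
    -- The bounds are assumed on the square only, since the leading symbol contains x^{-1/2},
    -- unbounded near 0. Cutting the symbol to the square leaves the integrand unchanged.
    set Q : ℝ → ℝ → ℂ := fun x y =>
      (Icc (1 / 8 : ℝ) (19 / 8) ×ˢ Icc (1 / 8 : ℝ) (19 / 8)).indicator (Function.uncurry P) (x, y)
      with hQ
    have hQm : Measurable (Function.uncurry Q) := hP.indicator hS
    have hQb : ∀ x y, ‖Q x y‖ ≤ |B lam| := fun x y => by
      simp only [hQ]
      by_cases hz : (x, y) ∈ Icc (1 / 8 : ℝ) (19 / 8) ×ˢ Icc (1 / 8 : ℝ) (19 / 8)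
      · rw [indicator_of_mem hz]; exact (hPb x hz.1 y hz.2).trans (le_abs_self _)
      · rw [indicator_of_notMem hz]; simp
    refine (integrable_triForm hfm hgm hhm (integrable_of_support hf hfs) hg hh ε hQm hQb).congr
      (Filter.Eventually.of_forall fun q => ?_)
    dsimp only
    by_cases z1 : f q.1 = 0
    · simp [z1]
    by_cases z2 : g q.2 = 0
    · simp [z2]
    have hz : (q.1, q.2) ∈ Icc (1 / 8 : ℝ) (19 / 8) ×ˢ Icc (1 / 8 : ℝ) (19 / 8) := ⟨hfs z1, hgs z2⟩
    simp only [hQ]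
    rw [indicator_of_mem hz]; rfl
  have e : triForm ε (fun x y => M lam x y + N lam x y) f g h =
      triForm ε (M lam) f g h + triForm ε (N lam) f g h := by
    unfold triForm
    rw [← integral_add (key (hMi lam) (hMb lam hlam)) (key (hNi lam) (hNb lam hlam))]
    congr 1; ext q; ring
  rw [e]
  refine (norm_add_le _ _).trans ((add_le_add
    (hM lam ε f g h hlam hε hε1 hfm hgm hhm hf hg hh hfs hgs)
    (hN lam ε f g h hlam hε hε1 hfm hgm hhm hf hg hh hfs hgs)).trans (le_of_eq ?_))
  ring

/-- Decay for the leading stationary phase contribution. -/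
theorem posDecay_leading {a b : ℝ} (ha : |a| ≤ 2) (hb : |b| ≤ 2) (ha0 : a ≠ 0) (ha1 : a ≠ 1)
    (hb0 : b ≠ 0) (Θ : 𝓢(ℝ, ℂ)) (γ₁ γ₂ γ₃ : ℝ) {c : ℝ} (hc : c ≠ 0) (κ : ℂ) {p q : ℝ → ℂ}
    (hp : Measurable p) (hq : Measurable q) {P : ℝ} (hpP : ∀ x ∈ Icc (1 / 8 : ℝ) (19 / 8), ‖p x‖ ≤ P)
    (hqP : ∀ x ∈ Icc (1 / 8 : ℝ) (19 / 8), ‖q x‖ ≤ P)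
    {ε₀ : ℝ} (hε₀ : ε₀ ≤ 1 / 100) (hε₁ : ε₀ * |b - 1| * (2 * 40 ^ 14) ≤ |a - 1|) :
    PosDecay ε₀ (fun lam x y => κ * ((lam ^ (-(1 / 2) : ℝ) : ℝ) : ℂ) * (p x * q y) *
      (modelPhase a b (c * lam) x y * Θ (γ₁ * Real.log x + γ₂ * Real.log y + γ₃))) := by
  obtain ⟨C, hC, hA⟩ := exists_amplitude_bound ha hb ha0 ha1 hb0 Θ γ₁ γ₂ γ₃
  have hP : 0 ≤ P := (norm_nonneg _).trans (hpP 1 (by norm_num))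
  refine ⟨‖κ‖ * C * |c| ^ (-(1 / 6) : ℝ) * P ^ 2 + 1, by positivity, ?_⟩
  intro lam ε f g h hlam hε hε1 hfm hgm hhm hf hg hh hfs hgs
  have h0 : 0 < lam := by linarith
  have tw : ∀ (u w : ℝ → ℂ), Measurable u → MemLp u 2 volume →
      Function.support u ⊆ Icc (1 / 8) (19 / 8) → Measurable w →
      (∀ x ∈ Icc (1 / 8 : ℝ) (19 / 8), ‖w x‖ ≤ P) →
      Measurable (fun x => w x * u x) ∧ MemLp (fun x => w x * u x) 2 volume ∧
      Function.support (fun x => w x * u x) ⊆ Icc (1 / 8) (19 / 8) ∧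
      l2 (fun x => w x * u x) ≤ P * l2 u := by
    intro u w hu hu2 hus hw hwP
    have hn : ∀ x, ‖w x * u x‖ ≤ P * ‖u x‖ := fun x => by
      by_cases hx : u x = 0
      · simp [hx]
      · rw [norm_mul]; exact mul_le_mul_of_nonneg_right (hwP x (hus hx)) (norm_nonneg _)
    exact ⟨hw.mul hu, memLp_of_norm_le_mul (hw.mul hu) hu2 hn,
      fun x hx => hus fun h0 => hx (by simp [h0]), l2_le_mul hP hu2 hn⟩
  obtain ⟨m1, m2, m3, m4⟩ := tw f p hfm hf hfs hp hpP
  obtain ⟨n1, n2, n3, n4⟩ := tw g q hgm hg hgs hq hqP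
  have key := hA (c * lam) ε _ _ h (mul_ne_zero hc h0.ne') hε (hε1.trans hε₀)
    (le_trans (by gcongr) hε₁) m1 n1 hhm m2 n2 hh m3 n3
  have e : triForm ε (fun x y => κ * ((lam ^ (-(1 / 2) : ℝ) : ℝ) : ℂ) * (p x * q y) *
      (modelPhase a b (c * lam) x y * Θ (γ₁ * Real.log x + γ₂ * Real.log y + γ₃))) f g h =
      κ * ((lam ^ (-(1 / 2) : ℝ) : ℝ) : ℂ) * triForm ε (fun x y => modelPhase a b (c * lam) x y *
        Θ (γ₁ * Real.log x + γ₂ * Real.log y + γ₃)) (fun x => p x * f x) (fun x => q x * g x) h := by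
    unfold triForm
    rw [← integral_const_mul]
    congr 1; ext z; ring
  have := l2_nonneg f; have := l2_nonneg g; have := l2_nonneg h
  have hl : 0 ≤ lam ^ (-(1 / 2) : ℝ) := by positivity
  rw [e, norm_mul, norm_mul, Complex.norm_real, Real.norm_of_nonneg hl]
  have hsplit : (|c * lam| * |ε|) ^ (-(1 / 6) : ℝ) =
      |c| ^ (-(1 / 6) : ℝ) * (lam * |ε|) ^ (-(1 / 6) : ℝ) := by
    rw [abs_mul, abs_of_pos h0, mul_assoc, Real.mul_rpow (abs_nonneg _) (by positivity)]
  rw [hsplit] at key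
  have hX : 0 ≤ (lam * |ε|) ^ (-(1 / 6) : ℝ) := by positivity
  calc _ ≤ ‖κ‖ * lam ^ (-(1 / 2) : ℝ) * (C * (|c| ^ (-(1 / 6) : ℝ) * (lam * |ε|) ^ (-(1 / 6) : ℝ)) *
        ((P * l2 f) * (P * l2 g) * l2 h)) := by
        refine mul_le_mul_of_nonneg_left (key.trans ?_) (by positivity)
        gcongr
        exact l2_nonneg _
    _ = (‖κ‖ * C * |c| ^ (-(1 / 6) : ℝ) * P ^ 2) *
        ((lam ^ (-(1 / 2) : ℝ) * (lam * |ε|) ^ (-(1 / 6) : ℝ)) * (l2 f * l2 g * l2 h)) := by ring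
    _ ≤ (‖κ‖ * C * |c| ^ (-(1 / 6) : ℝ) * P ^ 2 + 1) *
        ((lam ^ (-(1 / 2) : ℝ) * (lam * |ε|) ^ (-(1 / 6) : ℝ)) * (l2 f * l2 g * l2 h)) := by
        gcongr; linarith
    _ = _ := by ring

lemma measurable_symb {ρ₁ : ℝ → ℝ} (hρ : Continuous ρ₁) (d : ℕ) (lam : ℝ) :
    Measurable (Function.uncurry (symb ρ₁ d lam)) := by
  have h : StronglyMeasurable (fun q : ℝ × ℝ =>
      ∫ t, (ρ₁ t : ℂ) * osc (-(2 * Real.pi * lam * (q.1 * t + q.2 * t ^ d)))) := by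
    refine StronglyMeasurable.integral_prod_right (f := fun (q : ℝ × ℝ) (t : ℝ) =>
      (ρ₁ t : ℂ) * osc (-(2 * Real.pi * lam * (q.1 * t + q.2 * t ^ d)))) ?_
    refine Continuous.stronglyMeasurable ?_
    simp only [Function.uncurry_def]
    exact (Complex.continuous_ofReal.comp (hρ.comp continuous_snd)).mul
      (continuous_osc.comp (by fun_prop))
  exact h.measurable

lemma norm_symb_le (ρ₁ : ℝ → ℝ) (d : ℕ) (lam ξ η : ℝ) : ‖symb ρ₁ d lam ξ η‖ ≤ ∫ t, ‖ρ₁ t‖ := by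
  refine (norm_integral_le_integral_norm _).trans (le_of_eq ?_)
  congr 1; ext t
  rw [norm_mul, norm_osc, mul_one, Complex.norm_real]

/-- The amplitude `t ↦ t^{1/2} ρ₁(t)` in logarithmic coordinates. -/
lemma exists_log_amplitude {ρ₁ : ℝ → ℝ} (hρ_smooth : ContDiff ℝ ∞ ρ₁)
    (hρ_supp : Function.support ρ₁ ⊆ Set.Icc (1 / 2) 2) :
    ∃ Θ : 𝓢(ℝ, ℂ), ∀ t : ℝ, 0 < t → Θ (Real.log t) = ((t ^ (1 / 2 : ℝ) * ρ₁ t : ℝ) : ℂ) := by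
  -- The support of ρ₁ stays away from 0, so in the variable r = log t the amplitude is smooth with
  -- compact support, hence Schwartz.
  set F : ℝ → ℂ := fun r => ((Real.exp (r / 2) * ρ₁ (Real.exp r) : ℝ) : ℂ) with hF
  have hs : ContDiff ℝ ∞ F := by
    refine Complex.ofRealCLM.contDiff.comp ?_
    exact (Real.contDiff_exp.comp (contDiff_id.div_const 2)).mul
      (hρ_smooth.comp Real.contDiff_exp)
  have hc : HasCompactSupport F := by
    refine HasCompactSupport.intro (K := Icc (Real.log (1 / 2)) (Real.log 2)) isCompact_Icc ?_
    intro r hr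
    have : ρ₁ (Real.exp r) = 0 := by
      by_contra h
      obtain ⟨h1, h2⟩ := hρ_supp h
      exact hr ⟨(Real.log_le_iff_le_exp (by norm_num)).2 h1,
        (Real.le_log_iff_exp_le (by norm_num)).2 h2⟩
    simp [hF, this]
  refine ⟨hc.toSchwartzMap hs, fun t ht => ?_⟩
  change F (Real.log t) = _
  simp only [hF]
  rw [Real.exp_log ht, Real.rpow_def_of_pos ht]
  congr 3; ring_nf

/-- Linearity in the logarithms is what lets the amplitude, a function of the critical point alone,
be separated by Fourier inversion. -/
lemma critPt_log {d : ℕ} (hd : 2 ≤ d) {ξ η : ℝ} (hξ : 0 < ξ) (hη : 0 < η) :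
    Real.log (critPt d ξ η) = 1 / ((d : ℝ) - 1) * Real.log ξ + -(1 / ((d : ℝ) - 1)) * Real.log η +
      -(1 / ((d : ℝ) - 1)) * Real.log d := by
  have hd0 : (0 : ℝ) < d := by positivity
  rw [critPt, Real.log_rpow (by positivity), Real.log_div hξ.ne' (by positivity),
    Real.log_mul hd0.ne' hη.ne']
  ring

/-- The critical value of the phase is a multiple of ξ t₀; in this form it is a model phase with
exponents 1 + β and -β, where β = 1/(d-1). -/
lemma mul_critPt {d : ℕ} (hd : 2 ≤ d) {ξ η : ℝ} (hξ : 0 < ξ) (hη : 0 < η) :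
    ξ * critPt d ξ η = (d : ℝ) ^ (-(1 / ((d : ℝ) - 1))) *
      (ξ ^ (1 + 1 / ((d : ℝ) - 1)) * η ^ (-(1 / ((d : ℝ) - 1)))) := by
  have hd0 : (0 : ℝ) < d := by positivity
  rw [critPt, Real.div_rpow hξ.le (by positivity), Real.mul_rpow hd0.le hη.le,
    Real.rpow_add hξ, Real.rpow_one, Real.rpow_neg hd0.le, Real.rpow_neg hη.le]
  field_simp

/-- The frequency ratio below which the model estimate applies. -/
def epsBound (d : ℕ) : ℝ := 1 / (d * (2 * 40 ^ 14))

lemma epsBound_le {d : ℕ} (hd : 2 ≤ d) : epsBound d ≤ 1 / 100 := by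
  have hd2 : (2 : ℝ) ≤ d := by exact_mod_cast hd
  unfold epsBound
  refine one_div_le_one_div_of_le (by norm_num) ?_
  nlinarith

/-- The symbol minus its leading part is `O(1 / lam)`, the leading part being written in terms of
`modelPhase`. -/
lemma exists_symb_leading {ρ₁ : ℝ → ℝ} (hρ_smooth : ContDiff ℝ ∞ ρ₁)
    (hρ_supp : Function.support ρ₁ ⊆ Set.Icc (1 / 2) 2) {d : ℕ} (hd : 2 ≤ d) {s : ℝ} (hs : |s| = 1) :
    ∃ (κ : ℂ) (C c γ : ℝ) (Θ : 𝓢(ℝ, ℂ)), 0 < C ∧ c ≠ 0 ∧ ∀ lam ξ η : ℝ, 0 < lam →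
      ξ ∈ Icc (1 / 8 : ℝ) (19 / 8) → η ∈ Icc (1 / 8 : ℝ) (19 / 8) →
      ‖symb ρ₁ d lam (-s * ξ) (s * η) - κ * ((lam ^ (-(1 / 2) : ℝ) : ℝ) : ℂ) *
        ((ξ ^ (-(1 / 2) : ℝ) : ℝ) : ℂ) *
        (modelPhase (1 + 1 / ((d : ℝ) - 1)) (-(1 / ((d : ℝ) - 1))) (c * lam) ξ η *
          Θ (1 / ((d : ℝ) - 1) * Real.log ξ + -(1 / ((d : ℝ) - 1)) * Real.log η + γ))‖ ≤
        C / lam := by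
  obtain ⟨κ, C, hC, hst⟩ := exists_symb_stationary hρ_smooth hρ_supp hd hs
  obtain ⟨Θ, hΘ⟩ := exists_log_amplitude hρ_smooth hρ_supp
  have hd0 : (0 : ℝ) < d := by positivity
  have hd2 : (2 : ℝ) ≤ d := by exact_mod_cast hd
  have hs0 : s ≠ 0 := fun h => by simp [h] at hs
  have hd1 : 1 - 1 / (d : ℝ) ≠ 0 := by
    have : 1 / (d : ℝ) ≤ 1 / 2 := one_div_le_one_div_of_le (by norm_num) hd2
    linarith
  have hpi := Real.pi_pos
  refine ⟨κ, C, s * (2 * Real.pi * (1 - 1 / d) * (d : ℝ) ^ (-(1 / ((d : ℝ) - 1)))),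
    -(1 / ((d : ℝ) - 1)) * Real.log d, Θ, hC, ?_, ?_⟩
  · have : (d : ℝ) ^ (-(1 / ((d : ℝ) - 1))) ≠ 0 := by positivity
    refine mul_ne_zero hs0 (mul_ne_zero (mul_ne_zero ?_ hd1) this)
    positivity
  intro lam ξ η hlam hξ hη
  have hξ0 : 0 < ξ := by linarith [hξ.1]
  have hη0 : 0 < η := by linarith [hη.1]
  refine le_trans (le_of_eq ?_) (hst lam ξ η hlam hξ hη)
  congr 2
  rw [← critPt_log hd hξ0 hη0, hΘ _ (critPt_facts hd hξ hη).1, modelPhase,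
    mul_critPt hd hξ0 hη0, Complex.ofReal_mul (ξ ^ (-(1 / 2) : ℝ))]
  have e : s * (2 * Real.pi * (1 - 1 / d) * (d : ℝ) ^ (-(1 / ((d : ℝ) - 1)))) * lam *
      (ξ ^ (1 + 1 / ((d : ℝ) - 1)) * η ^ (-(1 / ((d : ℝ) - 1)))) =
      s * (2 * Real.pi * lam * (1 - 1 / d) * ((d : ℝ) ^ (-(1 / ((d : ℝ) - 1))) *
      (ξ ^ (1 + 1 / ((d : ℝ) - 1)) * η ^ (-(1 / ((d : ℝ) - 1)))))) := by ring
  rw [e]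
  ring

lemma norm_rpow_neg_half_le {x : ℝ} (hx : x ∈ Icc (1 / 8 : ℝ) (19 / 8)) :
    ‖((x ^ (-(1 / 2) : ℝ) : ℝ) : ℂ)‖ ≤ 8 := by
  have hx0 : 0 < x := by linarith [hx.1]
  rw [Complex.norm_real, Real.norm_of_nonneg (by positivity)]
  calc x ^ (-(1 / 2) : ℝ) ≤ (1 / 8 : ℝ) ^ (-(1 / 2) : ℝ) :=
        Real.rpow_le_rpow_of_nonpos (by norm_num) hx.1 (by norm_num)
    _ ≤ (1 / 8 : ℝ) ^ (-1 : ℝ) :=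
        Real.rpow_le_rpow_of_exponent_ge (by norm_num) (by norm_num) (by norm_num)
    _ = 8 := by rw [Real.rpow_neg_one]; norm_num

/-- Transfers decay from the leading term to the full symbol, because an O(1/lam) discrepancy
already meets the target bound. -/
lemma posDecay_of_approx {ε₀ : ℝ} (hε₀ : ε₀ ≤ 1) {M N : ℝ → ℝ → ℝ → ℂ} {C B : ℝ} (hC : 0 < C)
    (hN : PosDecay ε₀ N) (hMm : ∀ lam, Measurable (Function.uncurry (M lam)))
    (hNm : ∀ lam, Measurable (Function.uncurry (N lam))) (hMB : ∀ lam x y, ‖M lam x y‖ ≤ B)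
    (hMN : ∀ lam x y, 0 < lam → x ∈ Icc (1 / 8 : ℝ) (19 / 8) → y ∈ Icc (1 / 8 : ℝ) (19 / 8) →
      ‖M lam x y - N lam x y‖ ≤ C / lam) : PosDecay ε₀ M := by
  have h1 : PosDecay ε₀ (fun lam x y => M lam x y - N lam x y) := posDecay_of_bound hε₀ hC hMN
  have hb : ∀ lam, 1 ≤ lam → ∀ x ∈ Icc (1 / 8 : ℝ) (19 / 8), ∀ y ∈ Icc (1 / 8 : ℝ) (19 / 8),
      ‖M lam x y - N lam x y‖ ≤ B + C := fun lam hl x hx y hy => by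
    have hB : 0 ≤ B := (norm_nonneg _).trans (hMB lam x y)
    have : C / lam ≤ C := div_le_self hC.le hl
    linarith [hMN lam x y (by linarith) hx hy]
  have h2 := h1.add hN (B := fun _ => B + C) (fun lam => (hMm lam).sub (hNm lam)) hNm hb
    (fun lam hl x hx y hy => by
      have e : N lam x y = M lam x y - (M lam x y - N lam x y) := by ring
      rw [e]
      refine (norm_sub_le _ _).trans (add_le_add (hMB lam x y) ?_)
      have : C / lam ≤ C := div_le_self hC.le hl
      linarith [hMN lam x y (by linarith) hx hy])
  simpa using h2

/-- With β = 1/(d-1) the quotient (1+β)/β equals d. This makes `epsBound` the exact threshold in the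
smallness condition for the exponents a = 1 + β, b = -β. -/
lemma symb_exponent_facts {d : ℕ} (hd : 2 ≤ d) :
    0 < 1 / ((d : ℝ) - 1) ∧ 1 / ((d : ℝ) - 1) ≤ 1 ∧
      epsBound d * (1 + 1 / ((d : ℝ) - 1)) * (2 * 40 ^ 14) = 1 / ((d : ℝ) - 1) := by
  have hd2 : (2 : ℝ) ≤ d := by exact_mod_cast hd
  have hd1 : (0 : ℝ) < (d : ℝ) - 1 := by linarith
  refine ⟨by positivity, by rw [div_le_one hd1]; linarith, ?_⟩
  unfold epsBound
  field_simp
  ring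

lemma measurable_modelPhase_mul (Θ : 𝓢(ℝ, ℂ)) (a b γ₁ γ₂ γ lam : ℝ) :
    Measurable (fun q : ℝ × ℝ =>
      modelPhase a b lam q.1 q.2 * Θ (γ₁ * Real.log q.1 + γ₂ * Real.log q.2 + γ)) :=
  (measurable_modelPhase a b lam).mul (Θ.continuous.measurable.comp (by fun_prop))

lemma measurable_symb_comp {ρ₁ : ℝ → ℝ} (hρ : Continuous ρ₁) (d : ℕ) (lam : ℝ)
    {u v : ℝ × ℝ → ℝ} (hu : Measurable u) (hv : Measurable v) :
    Measurable (fun q => symb ρ₁ d lam (u q) (v q)) := by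
  have hm := measurable_symb hρ d lam
  have h := hm.comp (hu.prodMk hv)
  simpa only [Function.comp_def, Function.uncurry_apply_pair] using h

lemma measurable_rpow_neg_half : Measurable (fun x : ℝ => ((x ^ (-(1 / 2) : ℝ) : ℝ) : ℂ)) := by
  fun_prop

lemma posDecay_symb_opposite {ρ₁ : ℝ → ℝ} (hρ_smooth : ContDiff ℝ ∞ ρ₁)
    (hρ_supp : Function.support ρ₁ ⊆ Set.Icc (1 / 2) 2) {d : ℕ} (hd : 2 ≤ d) {s : ℝ}
    (hs : |s| = 1) : PosDecay (epsBound d) (fun lam x y => symb ρ₁ d lam (-s * x) (s * y)) := by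
  have hε1 : epsBound d ≤ 1 := (epsBound_le hd).trans (by norm_num)
  obtain ⟨κ, C, c, γ, Θ, hC, hc, hb⟩ := exists_symb_leading hρ_smooth hρ_supp hd hs
  obtain ⟨hβ0, hβ1, hβε⟩ := symb_exponent_facts hd
  generalize 1 / ((d : ℝ) - 1) = β at *
  have a1 : |1 + β| ≤ 2 := by rw [abs_of_pos (by linarith)]; linarith
  have a2 : |-β| ≤ 2 := by rw [abs_neg, abs_of_pos hβ0]; linarith
  have a3 : |1 + β - 1| = β := by rw [add_sub_cancel_left, abs_of_pos hβ0]
  have a4 : |-β - 1| = 1 + β := by rw [abs_of_neg (by linarith)]; ring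
  have hL := posDecay_leading a1 a2 (by linarith) (by linarith) (by linarith) Θ β (-β) γ hc κ
    measurable_rpow_neg_half (q := fun _ => 1) measurable_const (P := 8)
    (fun x hx => norm_rpow_neg_half_le hx) (fun x _ => by simp)
    (epsBound_le hd) (by rw [a3, a4, hβε])
  refine posDecay_of_approx hε1 hC hL
    (fun lam => measurable_symb_comp hρ_smooth.continuous d lam (by fun_prop) (by fun_prop))
    (fun lam => ?_) (fun lam x y => norm_symb_le _ _ _ _ _) fun lam x y hl hx hy => ?_
  · simp only [Function.uncurry_def]
    exact (measurable_const.mul ((measurable_rpow_neg_half.comp measurable_fst).mul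
      measurable_const)).mul (measurable_modelPhase_mul Θ _ _ _ _ _ _)
  · simpa only [mul_one] using hb lam x y hl hx hy

/-- Needed for j ≤ 0, where the shear involves the other variable. The exponents become a = -β and b
= 1 + β, still with a different from 0 and 1; the smallness condition is weaker because |b-1| = β <
1 + β = |a-1|. -/
lemma posDecay_symb_opposite_swap {ρ₁ : ℝ → ℝ} (hρ_smooth : ContDiff ℝ ∞ ρ₁)
    (hρ_supp : Function.support ρ₁ ⊆ Set.Icc (1 / 2) 2) {d : ℕ} (hd : 2 ≤ d) {s : ℝ}
    (hs : |s| = 1) : PosDecay (epsBound d) (fun lam x y => symb ρ₁ d lam (-s * y) (s * x)) := by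
  have hε1 : epsBound d ≤ 1 := (epsBound_le hd).trans (by norm_num)
  obtain ⟨κ, C, c, γ, Θ, hC, hc, hb⟩ := exists_symb_leading hρ_smooth hρ_supp hd hs
  obtain ⟨hβ0, hβ1, hβε⟩ := symb_exponent_facts hd
  generalize 1 / ((d : ℝ) - 1) = β at *
  have a1 : |1 + β| ≤ 2 := by rw [abs_of_pos (by linarith)]; linarith
  have a2 : |-β| ≤ 2 := by rw [abs_neg, abs_of_pos hβ0]; linarith
  have a3 : |1 + β - 1| = β := by rw [add_sub_cancel_left, abs_of_pos hβ0]
  have a4 : |-β - 1| = 1 + β := by rw [abs_of_neg (by linarith)]; ring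
  have a7 : epsBound d * β * (2 * 40 ^ 14) ≤ 1 + β := by
    have h0 : 0 ≤ epsBound d := by unfold epsBound; positivity
    have h1 : epsBound d * β * (2 * 40 ^ 14) ≤ epsBound d * (1 + β) * (2 * 40 ^ 14) := by
      gcongr; linarith
    linarith
  have hL := posDecay_leading a2 a1 (by linarith) (by linarith) (by linarith) Θ (-β) β γ hc κ
    (p := fun _ => 1) measurable_const measurable_rpow_neg_half (P := 8)
    (fun x _ => by simp) (fun x hx => norm_rpow_neg_half_le hx)
    (epsBound_le hd) (by rw [a3, a4]; exact a7)
  refine posDecay_of_approx hε1 hC hL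
    (fun lam => measurable_symb_comp hρ_smooth.continuous d lam (by fun_prop) (by fun_prop))
    (fun lam => ?_) (fun lam x y => norm_symb_le _ _ _ _ _) fun lam x y hl hx hy => ?_
  · simp only [Function.uncurry_def]
    exact (measurable_const.mul (measurable_const.mul (measurable_rpow_neg_half.comp
      measurable_snd))).mul (measurable_modelPhase_mul Θ _ _ _ _ _ _)
  · simp only [one_mul]
    refine le_trans (le_of_eq ?_) (hb lam y x hl hy hx)
    rw [modelPhase, modelPhase, mul_comm (x ^ (-β)), add_comm (-β * Real.log x)]

theorem posDecay_symb {ρ₁ : ℝ → ℝ} (hρ_smooth : ContDiff ℝ ∞ ρ₁)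
    (hρ_supp : Function.support ρ₁ ⊆ Set.Icc (1 / 2) 2) {d : ℕ} (hd : 2 ≤ d) {s₁ s₂ : ℝ}
    (hs₁ : s₁ = 1 ∨ s₁ = -1) (hs₂ : s₂ = 1 ∨ s₂ = -1) :
    PosDecay (epsBound d) (fun lam x y => symb ρ₁ d lam (s₁ * x) (s₂ * y)) ∧
    PosDecay (epsBound d) (fun lam x y => symb ρ₁ d lam (s₁ * y) (s₂ * x)) := by
  have hε1 : epsBound d ≤ 1 := (epsBound_le hd).trans (by norm_num)
  have habs : |s₂| = 1 := by rcases hs₂ with h | h <;> simp [h]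
  by_cases hss : s₁ = s₂
  · subst hss
    obtain ⟨C, hC, hb⟩ := exists_symb_nonstationary hρ_smooth hρ_supp d
    exact ⟨posDecay_of_bound hε1 hC fun lam x y hl hx hy => hb lam s₁ x y hl habs hx hy,
      posDecay_of_bound hε1 hC fun lam x y hl hx hy => hb lam s₁ y x hl habs hy hx⟩
  have hneg : s₁ = -s₂ := by
    rcases hs₁ with h | h <;> rcases hs₂ with h' | h' <;> subst h <;> subst h' <;> simp at hss ⊢
  rw [hneg]
  exact ⟨posDecay_symb_opposite hρ_smooth hρ_supp hd habs,
    posDecay_symb_opposite_swap hρ_smooth hρ_supp hd habs⟩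

/-! ### Reduction from the annulus to the positive quadrant -/

/-- The annulus `1/8 ≤ |ξ| ≤ 19/8` carrying the multiplier `𝓕 Φ₁`. -/
def innerAnnulus : Set ℝ := {ξ | 1 / 8 ≤ |ξ| ∧ |ξ| ≤ 19 / 8}

lemma innerAnnulus_subset : innerAnnulus ⊆ Icc (-(19 / 8)) (19 / 8) := fun _ hx => abs_le.1 hx.2

/-- Decay of the trilinear forms with symbols `M lam` on functions living on the annulus. -/
def AnnDecay (ε₀ : ℝ) (M : ℝ → ℝ → ℝ → ℂ) : Prop :=
  ∃ C : ℝ, 0 < C ∧ ∀ (lam ε : ℝ) (f g h : ℝ → ℂ), 1 ≤ lam → ε ≠ 0 → |ε| ≤ ε₀ →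
    Measurable f → Measurable g → Measurable h →
    MemLp f 2 volume → MemLp g 2 volume → MemLp h 2 volume →
    Function.support f ⊆ innerAnnulus → Function.support g ⊆ innerAnnulus →
    ‖triForm ε (M lam) f g h‖ ≤
      C * (lam ^ (-(1 / 2) : ℝ) * (lam * |ε|) ^ (-(1 / 6) : ℝ)) * (l2 f * l2 g * l2 h)

lemma ne_zero_of_sign {s : ℝ} (hs : s = 1 ∨ s = -1) : s ≠ 0 := by
  rcases hs with h | h <;> simp [h]

lemma measurePreserving_sign {s : ℝ} (hs : s = 1 ∨ s = -1) :
    MeasurePreserving (fun x : ℝ => s * x) volume volume := by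
  refine ⟨by fun_prop, ?_⟩
  rw [Real.map_volume_mul_left (ne_zero_of_sign hs)]
  rcases hs with rfl | rfl <;> simp

/-- Reflecting both variables, and h along with y, preserves the structure y + εx at the price of
replacing ε by ±ε; for this reason the decay statements allow negative ε. -/
lemma triForm_reflect {s₁ s₂ : ℝ} (hs₁ : s₁ = 1 ∨ s₁ = -1) (hs₂ : s₂ = 1 ∨ s₂ = -1) (ε : ℝ)
    (M : ℝ → ℝ → ℂ) (f g h : ℝ → ℂ) :
    triForm ε M f g h = triForm (ε * (s₁ * s₂)) (fun x y => M (s₁ * x) (s₂ * y))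
      (fun x => f (s₁ * x)) (fun y => g (s₂ * y)) (fun y => h (s₂ * y)) := by
  have hp := (measurePreserving_sign hs₁).prod (measurePreserving_sign hs₂)
  have he : MeasurableEmbedding (Prod.map (fun x : ℝ => s₁ * x) (fun x : ℝ => s₂ * x)) :=
    (MeasurableEquiv.prodCongr (MeasurableEquiv.mulLeft₀ s₁ (ne_zero_of_sign hs₁))
      (MeasurableEquiv.mulLeft₀ s₂ (ne_zero_of_sign hs₂))).measurableEmbedding
  unfold triForm
  rw [← hp.integral_comp he]
  congr 1; ext q
  simp only [Prod.map_fst, Prod.map_snd]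
  have : s₂ * q.2 + ε * (s₁ * q.1) = s₂ * (q.2 + ε * (s₁ * s₂) * q.1) := by
    rcases hs₂ with rfl | rfl <;> ring
  rw [this]

/-- The part of `u` on the half-line of sign `s`. -/
def halfPart (s : ℝ) (u : ℝ → ℂ) : ℝ → ℂ := {x : ℝ | 0 < s * x}.indicator u

lemma measurable_halfPart (s : ℝ) {u : ℝ → ℂ} (hu : Measurable u) : Measurable (halfPart s u) :=
  hu.indicator (measurableSet_lt measurable_const (by fun_prop))

lemma memLp_halfPart (s : ℝ) {u : ℝ → ℂ} (hu : MemLp u 2 volume) : MemLp (halfPart s u) 2 volume :=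
  hu.indicator (measurableSet_lt measurable_const (by fun_prop))

lemma support_halfPart (s : ℝ) {u : ℝ → ℂ} {S : Set ℝ} (hus : Function.support u ⊆ S) :
    Function.support (halfPart s u) ⊆ S := by
  rw [halfPart, support_indicator]
  exact inter_subset_right.trans hus

lemma halfPart_add {u : ℝ → ℂ} (hus : Function.support u ⊆ innerAnnulus) (x : ℝ) :
    u x = halfPart 1 u x + halfPart (-1) u x := by
  simp only [halfPart, indicator, mem_ofPred_eq, one_mul, neg_mul, neg_pos]
  rcases lt_trichotomy x 0 with h | h | h
  · simp [h, h.not_gt]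
  · have : u x = 0 := by
      by_contra hc
      have := (hus hc).1
      rw [h] at this; norm_num at this
    simp [this]
  · simp [h, h.not_gt]

lemma halfPart_reflect {s : ℝ} (hs : s = 1 ∨ s = -1) {u : ℝ → ℂ} (hu : Measurable u)
    (hu2 : MemLp u 2 volume) (hus : Function.support u ⊆ innerAnnulus) :
    Measurable (fun x => halfPart s u (s * x)) ∧ MemLp (fun x => halfPart s u (s * x)) 2 volume ∧
      Function.support (fun x => halfPart s u (s * x)) ⊆ Icc (1 / 8) (19 / 8) ∧
      l2 (fun x => halfPart s u (s * x)) ≤ l2 u := by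
  have hp := measurePreserving_sign hs
  have hm := measurable_halfPart s hu
  refine ⟨hm.comp (by fun_prop), (memLp_halfPart s hu2).comp_measurePreserving hp, ?_, ?_⟩
  · intro x hx
    have h1 := support_halfPart s hus hx
    have h2 : 0 < s * (s * x) := by
      by_contra hc
      exact hx (indicator_of_notMem (s := {x : ℝ | 0 < s * x}) hc u)
    have h3 : s * (s * x) = x := by rcases hs with rfl | rfl <;> ring
    rw [h3] at h2
    have h4 : |s * x| = x := by rcases hs with rfl | rfl <;> simp [abs_of_pos h2]
    rw [innerAnnulus, mem_ofPred_eq, h4] at h1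
    exact h1
  · have : eLpNorm (halfPart s u ∘ fun x => s * x) 2 volume = eLpNorm (halfPart s u) 2 volume :=
      eLpNorm_comp_measurePreserving hm.aestronglyMeasurable hp
    have e : l2 (fun x => halfPart s u (s * x)) = l2 (halfPart s u) := by
      unfold l2; rw [← this]; rfl
    rw [e]
    refine l2_mono hu2 fun x => ?_
    exact norm_indicator_le_norm_self _ _

lemma l2_reflect {s : ℝ} (hs : s = 1 ∨ s = -1) {u : ℝ → ℂ} (hu : Measurable u) :
    l2 (fun x => u (s * x)) = l2 u := by
  have : eLpNorm (u ∘ fun x => s * x) 2 volume = eLpNorm u 2 volume :=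
    eLpNorm_comp_measurePreserving hu.aestronglyMeasurable (measurePreserving_sign hs)
  unfold l2; rw [← this]; rfl

theorem annDecay_of_posDecay {ε₀ : ℝ} {M : ℝ → ℝ → ℝ → ℂ} {B : ℝ}
    (hMm : ∀ lam, Measurable (Function.uncurry (M lam))) (hMB : ∀ lam x y, ‖M lam x y‖ ≤ B)
    (hM : ∀ s₁ s₂ : ℝ, (s₁ = 1 ∨ s₁ = -1) → (s₂ = 1 ∨ s₂ = -1) →
      PosDecay ε₀ (fun lam x y => M lam (s₁ * x) (s₂ * y))) : AnnDecay ε₀ M := by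
  have key : ∀ s₁ s₂ : ℝ, (s₁ = 1 ∨ s₁ = -1) → (s₂ = 1 ∨ s₂ = -1) →
      ∃ C : ℝ, 0 < C ∧ ∀ (lam ε : ℝ) (f g h : ℝ → ℂ), 1 ≤ lam → ε ≠ 0 → |ε| ≤ ε₀ →
      Measurable f → Measurable g → Measurable h →
      MemLp f 2 volume → MemLp g 2 volume → MemLp h 2 volume →
      Function.support f ⊆ innerAnnulus → Function.support g ⊆ innerAnnulus →
      ‖triForm ε (M lam) (halfPart s₁ f) (halfPart s₂ g) h‖ ≤
        C * ((lam ^ (-(1 / 2) : ℝ) * (lam * |ε|) ^ (-(1 / 6) : ℝ)) * (l2 f * l2 g * l2 h)) := by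
    intro s₁ s₂ hs₁ hs₂
    obtain ⟨C, hC, hb⟩ := hM s₁ s₂ hs₁ hs₂
    refine ⟨C, hC, ?_⟩
    intro lam ε f g h hlam hε hε1 hfm hgm hhm hf hg hh hfs hgs
    obtain ⟨m1, m2, m3, m4⟩ := halfPart_reflect hs₁ hfm hf hfs
    obtain ⟨n1, n2, n3, n4⟩ := halfPart_reflect hs₂ hgm hg hgs
    have habs : |ε * (s₁ * s₂)| = |ε| := by
      rcases hs₁ with rfl | rfl <;> rcases hs₂ with rfl | rfl <;> simp
    have h0 : 0 < lam := by linarith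
    have k := hb lam (ε * (s₁ * s₂)) _ _ (fun y => h (s₂ * y)) hlam
      (mul_ne_zero hε (mul_ne_zero (ne_zero_of_sign hs₁) (ne_zero_of_sign hs₂)))
      (habs.le.trans hε1) m1 n1 (hhm.comp (by fun_prop)) m2 n2
      (hh.comp_measurePreserving (measurePreserving_sign hs₂)) m3 n3
    rw [triForm_reflect hs₁ hs₂]
    refine k.trans ?_
    rw [habs, l2_reflect hs₂ hhm, mul_assoc]
    have := l2_nonneg f; have := l2_nonneg g; have := l2_nonneg h
    gcongr
    exact l2_nonneg _
  have p1 : (1 : ℝ) = 1 ∨ (1 : ℝ) = -1 := Or.inl rfl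
  have p2 : (-1 : ℝ) = 1 ∨ (-1 : ℝ) = -1 := Or.inr rfl
  obtain ⟨C₁, hC₁, k₁⟩ := key 1 1 p1 p1
  obtain ⟨C₂, hC₂, k₂⟩ := key 1 (-1) p1 p2
  obtain ⟨C₃, hC₃, k₃⟩ := key (-1) 1 p2 p1
  obtain ⟨C₄, hC₄, k₄⟩ := key (-1) (-1) p2 p2
  refine ⟨C₁ + C₂ + C₃ + C₄, by positivity, ?_⟩
  intro lam ε f g h hlam hε hε1 hfm hgm hhm hf hg hh hfs hgs
  set F : ℝ → ℝ → ℝ × ℝ → ℂ := fun s₁ s₂ q => halfPart s₁ f q.1 * halfPart s₂ g q.2 *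
      h (q.2 + ε * q.1) * M lam q.1 q.2 with hF
  have hInt : ∀ s₁ s₂ : ℝ, Integrable (F s₁ s₂) (volume.prod volume) := fun s₁ s₂ =>
    integrable_triForm (measurable_halfPart s₁ hfm) (measurable_halfPart s₂ hgm) hhm
      (integrable_of_support (memLp_halfPart s₁ hf)
        ((support_halfPart s₁ hfs).trans innerAnnulus_subset))
      (memLp_halfPart s₂ hg) hh ε (hMm lam) (hMB lam)
  have e : triForm ε (M lam) f g h =
      triForm ε (M lam) (halfPart 1 f) (halfPart 1 g) h +
      triForm ε (M lam) (halfPart 1 f) (halfPart (-1) g) h +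
      triForm ε (M lam) (halfPart (-1) f) (halfPart 1 g) h +
      triForm ε (M lam) (halfPart (-1) f) (halfPart (-1) g) h := by
    have hsum : (fun q : ℝ × ℝ => f q.1 * g q.2 * h (q.2 + ε * q.1) * M lam q.1 q.2) =
        F 1 1 + F 1 (-1) + F (-1) 1 + F (-1) (-1) := by
      ext q
      simp only [Pi.add_apply, F]
      rw [halfPart_add hfs q.1, halfPart_add hgs q.2]; ring
    unfold triForm
    rw [hsum, integral_add' (((hInt _ _).add (hInt _ _)).add (hInt _ _)) (hInt _ _),
      integral_add' ((hInt _ _).add (hInt _ _)) (hInt _ _), integral_add' (hInt _ _) (hInt _ _)]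
  rw [e]
  refine (norm_add₄_le).trans ?_
  have j₁ := k₁ lam ε f g h hlam hε hε1 hfm hgm hhm hf hg hh hfs hgs
  have j₂ := k₂ lam ε f g h hlam hε hε1 hfm hgm hhm hf hg hh hfs hgs
  have j₃ := k₃ lam ε f g h hlam hε hε1 hfm hgm hhm hf hg hh hfs hgs
  have j₄ := k₄ lam ε f g h hlam hε hε1 hfm hgm hhm hf hg hh hfs hgs
  linarith

/-- The symbol of the full curve, with the odd extension of `ρ₁` as density. -/
def fullSymb (ρ₁ : ℝ → ℝ) (d : ℕ) (lam ξ η : ℝ) : ℂ :=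
  symb ρ₁ d lam ξ η - symb ρ₁ d lam (-1 * ξ) ((-1) ^ d * η)

lemma AnnDecay.sub {ε₀ : ℝ} {M N : ℝ → ℝ → ℝ → ℂ} {B : ℝ} (hM : AnnDecay ε₀ M)
    (hN : AnnDecay ε₀ N) (hMm : ∀ lam, Measurable (Function.uncurry (M lam)))
    (hNm : ∀ lam, Measurable (Function.uncurry (N lam))) (hMB : ∀ lam x y, ‖M lam x y‖ ≤ B)
    (hNB : ∀ lam x y, ‖N lam x y‖ ≤ B) : AnnDecay ε₀ (fun lam x y => M lam x y - N lam x y) := by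
  obtain ⟨C, hC, hM⟩ := hM
  obtain ⟨D, hD, hN⟩ := hN
  refine ⟨C + D, by positivity, ?_⟩
  intro lam ε f g h hlam hε hε1 hfm hgm hhm hf hg hh hfs hgs
  have hf1 := integrable_of_support hf (hfs.trans innerAnnulus_subset)
  have e : triForm ε (fun x y => M lam x y - N lam x y) f g h =
      triForm ε (M lam) f g h - triForm ε (N lam) f g h := by
    unfold triForm
    rw [← integral_sub (integrable_triForm hfm hgm hhm hf1 hg hh ε (hMm lam) (hMB lam))
      (integrable_triForm hfm hgm hhm hf1 hg hh ε (hNm lam) (hNB lam))]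
    congr 1; ext q; ring
  rw [e]
  refine (norm_sub_le _ _).trans ((add_le_add
    (hM lam ε f g h hlam hε hε1 hfm hgm hhm hf hg hh hfs hgs)
    (hN lam ε f g h hlam hε hε1 hfm hgm hhm hf hg hh hfs hgs)).trans (le_of_eq ?_))
  ring

/-- The branch t < 0 is the branch t > 0 at frequencies (-ξ, (-1)^d η). Signs compose, so each of
the two branches restricted to each quadrant is covered by `posDecay_symb`. -/
theorem annDecay_fullSymb {ρ₁ : ℝ → ℝ} (hρ_smooth : ContDiff ℝ ∞ ρ₁)
    (hρ_supp : Function.support ρ₁ ⊆ Set.Icc (1 / 2) 2) {d : ℕ} (hd : 2 ≤ d) :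
    AnnDecay (epsBound d) (fullSymb ρ₁ d) ∧
      AnnDecay (epsBound d) (fun lam x y => fullSymb ρ₁ d lam y x) := by
  have hρ := hρ_smooth.continuous
  have hmul : ∀ {s t : ℝ}, (s = 1 ∨ s = -1) → (t = 1 ∨ t = -1) → (s * t = 1 ∨ s * t = -1) := by
    rintro s t (rfl | rfl) (rfl | rfl) <;> simp
  have key : ∀ σ₁ σ₂ : ℝ, (σ₁ = 1 ∨ σ₁ = -1) → (σ₂ = 1 ∨ σ₂ = -1) →
      AnnDecay (epsBound d) (fun lam x y => symb ρ₁ d lam (σ₁ * x) (σ₂ * y)) ∧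
      AnnDecay (epsBound d) (fun lam x y => symb ρ₁ d lam (σ₁ * y) (σ₂ * x)) := by
    intro σ₁ σ₂ h₁ h₂
    constructor
    · refine annDecay_of_posDecay (fun lam => measurable_symb_comp hρ d lam (by fun_prop)
        (by fun_prop)) (fun lam x y => norm_symb_le _ _ _ _ _) fun s₁ s₂ hs₁ hs₂ => ?_
      have := (posDecay_symb hρ_smooth hρ_supp hd (hmul h₁ hs₁) (hmul h₂ hs₂)).1
      simpa only [mul_assoc] using this
    · refine annDecay_of_posDecay (fun lam => measurable_symb_comp hρ d lam (by fun_prop)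
        (by fun_prop)) (fun lam x y => norm_symb_le _ _ _ _ _) fun s₁ s₂ hs₁ hs₂ => ?_
      have := (posDecay_symb hρ_smooth hρ_supp hd (hmul h₁ hs₂) (hmul h₂ hs₁)).2
      simpa only [mul_assoc] using this
  have k1 := key 1 1 (Or.inl rfl) (Or.inl rfl)
  have k2 := key (-1) ((-1) ^ d) (Or.inr rfl) (neg_one_pow_eq_or ℝ d)
  constructor
  · have := k1.1.sub k2.1
      (fun lam => measurable_symb_comp hρ d lam (by fun_prop) (by fun_prop))
      (fun lam => measurable_symb_comp hρ d lam (by fun_prop) (by fun_prop))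
      (fun lam x y => norm_symb_le _ _ _ _ _) (fun lam x y => norm_symb_le _ _ _ _ _)
    simp only [one_mul] at this
    exact this
  · have := k1.2.sub k2.2
      (fun lam => measurable_symb_comp hρ d lam (by fun_prop) (by fun_prop))
      (fun lam => measurable_symb_comp hρ d lam (by fun_prop) (by fun_prop))
      (fun lam x y => norm_symb_le _ _ _ _ _) (fun lam x y => norm_symb_le _ _ _ _ _)
    simp only [one_mul] at this
    exact this

/-! ### Inverse Fourier integrals and Plancherel -/

lemma fourierInv_eq_osc (f : ℝ → ℂ) (x : ℝ) :
    𝓕⁻ f x = ∫ v, f v * osc (2 * Real.pi * (v * x)) := by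
  rw [Real.fourierInv_eq']
  congr 1; ext v
  rw [smul_eq_mul, mul_comm, osc]
  congr 3
  simp [mul_comm]

lemma norm_fourierInv_le (f : ℝ → ℂ) (x : ℝ) : ‖𝓕⁻ f x‖ ≤ ∫ v, ‖f v‖ := by
  rw [fourierInv_eq_osc]
  refine (norm_integral_le_integral_norm _).trans (le_of_eq ?_)
  congr 1; ext t
  rw [norm_mul, norm_osc, mul_one]

lemma continuous_fourierInv {f : ℝ → ℂ} (hf : Integrable f) : Continuous (𝓕⁻ f) := by
  have e : 𝓕⁻ f = fun x => ∫ v, f v * osc (2 * Real.pi * (v * x)) :=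
    funext fun x => fourierInv_eq_osc f x
  rw [e]
  refine continuous_of_dominated (bound := fun v => ‖f v‖) (fun x => ?_) (fun x => ?_) hf.norm ?_
  · exact hf.1.mul (continuous_osc.comp (by fun_prop)).aestronglyMeasurable
  · exact Filter.Eventually.of_forall fun v => by rw [norm_mul, norm_osc, mul_one]
  · exact Filter.Eventually.of_forall fun v =>
      continuous_const.mul (continuous_osc.comp (by fun_prop))

lemma integral_fourierInv_mul_eq {f g : ℝ → ℂ} (hf : Integrable f) (hg : Integrable g) :
    ∫ x, 𝓕⁻ f x * g x = ∫ v, f v * 𝓕⁻ g v := by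
  have hInt : Integrable (fun z : ℝ × ℝ => g z.1 * f z.2 * osc (2 * Real.pi * (z.2 * z.1)))
      (volume.prod volume) :=
    (hg.mul_prod hf).mul_bdd (c := 1) (continuous_osc.comp (by fun_prop)).aestronglyMeasurable
      (Filter.Eventually.of_forall fun z => (norm_osc _).le)
  calc ∫ x, 𝓕⁻ f x * g x = ∫ x, ∫ v, g x * f v * osc (2 * Real.pi * (v * x)) := by
        congr 1; ext x
        rw [fourierInv_eq_osc, ← integral_mul_const]
        congr 1; ext v; ring
    _ = ∫ v, ∫ x, g x * f v * osc (2 * Real.pi * (v * x)) := integral_integral_swap hInt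
    _ = _ := by
        congr 1; ext v
        rw [fourierInv_eq_osc, ← integral_const_mul]
        congr 1; ext x
        rw [mul_comm v x]; ring

/-- On `L¹ ∩ L²` the inverse Fourier integral represents the `L²` inverse Fourier transform. -/
lemma fourierInv_toLp_ae_eq {f : ℝ → ℂ} (hf1 : Integrable f) (hf2 : MemLp f 2 volume) :
    (𝓕⁻ (hf2.toLp f) : Lp ℂ 2 (volume : Measure ℝ)) =ᵐ[volume] 𝓕⁻ f := by
  set G : Lp ℂ 2 (volume : Measure ℝ) := 𝓕⁻ (hf2.toLp f) with hG
  refine ae_eq_of_integral_contDiff_smul_eq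
    ((Lp.memLp G).locallyIntegrable (by norm_num))
    (continuous_fourierInv hf1).locallyIntegrable ?_
  -- Compare both functions on smooth compactly supported tests: the L² transform through tempered
  -- distributions, the integral through Fubini.
  intro g hg hgc
  have hgc' : HasCompactSupport (fun x => (g x : ℂ)) := hgc.comp_left (g := fun r : ℝ => (r : ℂ)) (by simp)
  set φ : 𝓢(ℝ, ℂ) := hgc'.toSchwartzMap (Complex.ofRealCLM.contDiff.comp hg) with hφ
  have hφg : ∀ x, φ x = (g x : ℂ) := fun x => rfl
  have h1 := congrArg (fun T => T φ) (Lp.fourierInv_toTemperedDistribution_eq (hf2.toLp f))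
  simp only [TemperedDistribution.fourierInv_apply, Lp.toTemperedDistribution_apply] at h1
  rw [← hG] at h1
  have h2 : ∫ x, g x • G x = ∫ x, φ x • G x := by
    congr 1
  have h3 : ∫ x, g x • 𝓕⁻ f x = ∫ x, 𝓕⁻ f x * φ x := by
    congr 1; ext x; rw [hφg, Complex.real_smul, mul_comm]
  rw [h2, ← h1, h3, integral_fourierInv_mul_eq hf1 φ.integrable]
  refine integral_congr_ae ?_
  filter_upwards [hf2.coeFn_toLp] with x hx
  rw [hx, smul_eq_mul, mul_comm, SchwartzMap.fourierInv_coe]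

lemma memLp_fourierInv {f : ℝ → ℂ} (hf1 : Integrable f) (hf2 : MemLp f 2 volume) :
    MemLp (𝓕⁻ f) 2 volume :=
  (memLp_congr_ae (fourierInv_toLp_ae_eq hf1 hf2)).1 (Lp.memLp _)

lemma l2_fourierInv {f : ℝ → ℂ} (hf1 : Integrable f) (hf2 : MemLp f 2 volume) :
    l2 (𝓕⁻ f) = l2 f := by
  have h1 : ‖(𝓕⁻ (hf2.toLp f) : Lp ℂ 2 (volume : Measure ℝ))‖ = ‖hf2.toLp f‖ :=
    (Lp.fourierTransformₗᵢ ℝ ℂ).symm.norm_map _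
  rw [Lp.norm_def, Lp.norm_toLp, eLpNorm_congr_ae (fourierInv_toLp_ae_eq hf1 hf2)] at h1
  exact h1

/-! ### Fourier representation of the curve average -/

lemma rho_eq {ρ₁ : ℝ → ℝ} (hρ_supp : Function.support ρ₁ ⊆ Set.Icc (1 / 2) 2) (t : ℝ) :
    rho ρ₁ t = ρ₁ t - ρ₁ (-t) := by
  have h0 : ∀ u, u ≤ 0 → ρ₁ u = 0 := fun u hu => by
    by_contra h; have := (hρ_supp h).1; linarith
  unfold rho
  rcases lt_trichotomy t 0 with h | h | h
  · simp [h, h.not_gt, h0 t h.le]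
  · subst h; simp [h0 0 le_rfl]
  · simp [h, h0 (-t) (by linarith)]

lemma integrable_bump {ρ₁ : ℝ → ℝ} (hρ : Continuous ρ₁)
    (hρ_supp : Function.support ρ₁ ⊆ Set.Icc (1 / 2) 2) : Integrable ρ₁ :=
  hρ.integrable_of_hasCompactSupport (hasCompactSupport_of_support hρ_supp)

lemma integrable_rho {ρ₁ : ℝ → ℝ} (hρ : Continuous ρ₁)
    (hρ_supp : Function.support ρ₁ ⊆ Set.Icc (1 / 2) 2) : Integrable (fun t => (rho ρ₁ t : ℂ)) := by
  have h := integrable_bump hρ hρ_supp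
  simp only [rho_eq hρ_supp]
  exact (h.sub h.comp_neg).ofReal

lemma integral_rho_osc {ρ₁ : ℝ → ℝ} (hρ : Continuous ρ₁)
    (hρ_supp : Function.support ρ₁ ⊆ Set.Icc (1 / 2) 2) (d : ℕ) (lam ξ η : ℝ) :
    ∫ t, (rho ρ₁ t : ℂ) * osc (-(2 * Real.pi * lam * (ξ * t + η * t ^ d))) =
      fullSymb ρ₁ d lam ξ η := by
  have hi := integrable_bump hρ hρ_supp
  have hc : Continuous fun t : ℝ => osc (-(2 * Real.pi * lam * (ξ * t + η * t ^ d))) :=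
    continuous_osc.comp (by fun_prop)
  have hb : ∀ u : ℝ → ℝ, Integrable u → Integrable fun t =>
      (u t : ℂ) * osc (-(2 * Real.pi * lam * (ξ * t + η * t ^ d))) := fun u hu =>
    hu.ofReal.mul_bdd (c := 1) hc.aestronglyMeasurable
      (Filter.Eventually.of_forall fun z => (norm_osc _).le)
  have e : ∀ t, (rho ρ₁ t : ℂ) * osc (-(2 * Real.pi * lam * (ξ * t + η * t ^ d))) =
      (ρ₁ t : ℂ) * osc (-(2 * Real.pi * lam * (ξ * t + η * t ^ d))) -
      (ρ₁ (-t) : ℂ) * osc (-(2 * Real.pi * lam * (ξ * t + η * t ^ d))) := fun t => by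
    rw [rho_eq hρ_supp]; push_cast; ring
  simp only [e]
  rw [integral_sub (hb _ hi) (hb _ hi.comp_neg), fullSymb]
  congr 1
  rw [symb, ← integral_neg_eq_self]
  congr 1; ext t
  rw [neg_neg, show ξ * -t + η * (-t) ^ d = -1 * ξ * t + (-1) ^ d * η * t ^ d by
    rw [neg_pow t d]; ring]

/-- The average over the curve occurring in the operators `B`. -/
def curveAvg (ρ₁ : ℝ → ℝ) (d : ℕ) (lam a b : ℝ) (u v : ℝ → ℂ) (x : ℝ) : ℂ :=
  ∫ t : ℝ, u (a * x - lam * t) * v (b * x - lam * t ^ d) * (rho ρ₁ t : ℂ)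

lemma integrable_curveAvg_kernel {ρ₁ : ℝ → ℝ} (hρ : Continuous ρ₁)
    (hρ_supp : Function.support ρ₁ ⊆ Set.Icc (1 / 2) 2) (d : ℕ) (lam a b : ℝ) {F G W : ℝ → ℂ}
    (hF : Integrable F) (hG : Integrable G) (hW : Integrable W) :
    Integrable (fun z : ℝ × ℝ => 𝓕⁻ F (a * z.1 - lam * z.2) * 𝓕⁻ G (b * z.1 - lam * z.2 ^ d) *
      (rho ρ₁ z.2 : ℂ) * W z.1) (volume.prod volume) := by
  have h1 := hW.mul_prod (integrable_rho hρ hρ_supp)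
  have hc : Continuous fun z : ℝ × ℝ =>
      𝓕⁻ F (a * z.1 - lam * z.2) * 𝓕⁻ G (b * z.1 - lam * z.2 ^ d) :=
    ((continuous_fourierInv hF).comp (by fun_prop)).mul
      ((continuous_fourierInv hG).comp (by fun_prop))
  refine (h1.mul_bdd (c := (∫ v, ‖F v‖) * ∫ v, ‖G v‖) hc.aestronglyMeasurable
    (Filter.Eventually.of_forall fun z => ?_)).congr (Filter.Eventually.of_forall fun z => ?_)
  · rw [norm_mul]
    exact mul_le_mul (norm_fourierInv_le _ _) (norm_fourierInv_le _ _) (norm_nonneg _)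
      (integral_nonneg fun _ => norm_nonneg _)
  · dsimp only; ring

lemma integrable_curveAvg_mul {ρ₁ : ℝ → ℝ} (hρ : Continuous ρ₁)
    (hρ_supp : Function.support ρ₁ ⊆ Set.Icc (1 / 2) 2) (d : ℕ) (lam a b : ℝ) {F G W : ℝ → ℂ}
    (hF : Integrable F) (hG : Integrable G) (hW : Integrable W) :
    Integrable fun x => curveAvg ρ₁ d lam a b (𝓕⁻ F) (𝓕⁻ G) x * W x := by
  have h := (integrable_curveAvg_kernel hρ hρ_supp d lam a b hF hG hW).integral_prod_left
  simp only [integral_mul_const] at h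
  exact h

/-- Fourier representation of the curve average. -/
lemma integral_curveAvg_mul {ρ₁ : ℝ → ℝ} (hρ : Continuous ρ₁)
    (hρ_supp : Function.support ρ₁ ⊆ Set.Icc (1 / 2) 2) (d : ℕ) (lam a b : ℝ) {F G W : ℝ → ℂ}
    (hF : Integrable F) (hG : Integrable G) (hW : Integrable W) :
    ∫ x, curveAvg ρ₁ d lam a b (𝓕⁻ F) (𝓕⁻ G) x * W x =
      ∫ q : ℝ × ℝ, F q.1 * G q.2 * 𝓕⁻ W (a * q.1 + b * q.2) * fullSymb ρ₁ d lam q.1 q.2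
        ∂(volume.prod volume) := by
  set P : ℝ × ℝ → ℝ × ℝ → ℝ := fun z q =>
    2 * Real.pi * (q.1 * (a * z.1 - lam * z.2)) + 2 * Real.pi * (q.2 * (b * z.1 - lam * z.2 ^ d))
    with hP
  -- With F, G, W and ρ integrable, the integrand in (x,t,ξ,η) is absolutely integrable. For fixed
  -- frequencies the x-integral gives the inverse transform of W, and the t-integral gives the
  -- symbol.
  set S : ℝ × ℝ → ℝ × ℝ → ℂ := fun z q =>
    (W z.1 * (rho ρ₁ z.2 : ℂ)) * (F q.1 * G q.2) * osc (P z q) with hS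
  have hInt : Integrable (Function.uncurry S) ((volume.prod volume).prod (volume.prod volume)) := by
    refine ((hW.mul_prod (integrable_rho hρ hρ_supp)).mul_prod (hF.mul_prod hG)).mul_bdd (c := 1)
      (Continuous.aestronglyMeasurable ?_) (Filter.Eventually.of_forall fun z => (norm_osc _).le)
    exact continuous_osc.comp (by fun_prop)
  have e1 : ∫ x, curveAvg ρ₁ d lam a b (𝓕⁻ F) (𝓕⁻ G) x * W x =
      ∫ z : ℝ × ℝ, 𝓕⁻ F (a * z.1 - lam * z.2) * 𝓕⁻ G (b * z.1 - lam * z.2 ^ d) *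
      (rho ρ₁ z.2 : ℂ) * W z.1 ∂(volume.prod volume) := by
    rw [integral_prod _ (integrable_curveAvg_kernel hρ hρ_supp d lam a b hF hG hW)]
    congr 1; ext x
    dsimp only
    rw [integral_mul_const]; rfl
  have e2 : ∀ z : ℝ × ℝ, 𝓕⁻ F (a * z.1 - lam * z.2) * 𝓕⁻ G (b * z.1 - lam * z.2 ^ d) *
      (rho ρ₁ z.2 : ℂ) * W z.1 = ∫ q, S z q ∂(volume.prod volume) := by
    intro z
    rw [fourierInv_eq_osc, fourierInv_eq_osc, ← integral_prod_mul, mul_assoc, ← integral_mul_const]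
    congr 1; ext q
    simp only [hS, hP, osc_add]; ring
  have e3 : ∀ q : ℝ × ℝ, ∫ z, S z q ∂(volume.prod volume) =
      F q.1 * G q.2 * 𝓕⁻ W (a * q.1 + b * q.2) * fullSymb ρ₁ d lam q.1 q.2 := by
    intro q
    rw [fourierInv_eq_osc, ← integral_rho_osc hρ hρ_supp, mul_assoc, ← integral_prod_mul,
      ← integral_const_mul]
    congr 1; ext z
    have : osc (P z q) = osc (2 * Real.pi * (z.1 * (a * q.1 + b * q.2))) *
        osc (-(2 * Real.pi * lam * (q.1 * z.2 + q.2 * z.2 ^ d))) := by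
      rw [← osc_add]; congr 1; simp only [hP]; ring
    simp only [hS, this]; ring
  rw [e1]
  simp only [e2]
  rw [integral_integral_swap hInt]
  simp only [e3]

/-! ### The smooth cutoff and the reduction to Fourier data -/

lemma integral_phi {φ : 𝓢(ℝ, ℝ)} (hφ_zero : 𝓕 (fun x : ℝ => ((φ x : ℝ) : ℂ)) 0 = 1) :
    ∫ x, φ x = 1 := by
  rw [Real.fourier_eq'] at hφ_zero
  simp only [inner_zero_right, mul_zero, Complex.ofReal_zero, zero_mul, Complex.exp_zero,
    one_smul] at hφ_zero
  exact_mod_cast hφ_zero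

lemma integrable_dil (φ : 𝓢(ℝ, ℝ)) (k : ℤ) : Integrable (dil φ k) :=
  ((φ.integrable (μ := volume)).comp_mul_left' (by positivity)).const_mul _

lemma integral_dil {φ : 𝓢(ℝ, ℝ)} (hφ_zero : 𝓕 (fun x : ℝ => ((φ x : ℝ) : ℂ)) 0 = 1) (k : ℤ) :
    ∫ x, dil φ k x = 1 := by
  have h2 : (0 : ℝ) < (2 : ℝ) ^ (-k) := by positivity
  unfold dil
  rw [integral_const_mul, Measure.integral_comp_mul_left (fun x => φ x), integral_phi hφ_zero,
    abs_of_pos (by positivity), smul_eq_mul, mul_one, mul_inv_cancel₀ h2.ne']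

lemma smoothInd_nonneg {φ : 𝓢(ℝ, ℝ)} (hφ_nonneg : ∀ x, 0 ≤ φ x) (k n : ℤ) (x : ℝ) :
    0 ≤ smoothInd φ k n x :=
  integral_nonneg fun y => mul_nonneg (by positivity) (hφ_nonneg _)

lemma smoothInd_le_one {φ : 𝓢(ℝ, ℝ)} (hφ_nonneg : ∀ x, 0 ≤ φ x)
    (hφ_zero : 𝓕 (fun x : ℝ => ((φ x : ℝ) : ℂ)) 0 = 1) (k n : ℤ) (x : ℝ) :
    smoothInd φ k n x ≤ 1 := by
  calc smoothInd φ k n x ≤ ∫ y, dil φ k (x - y) :=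
        setIntegral_le_integral ((integrable_dil φ k).comp_sub_left x)
          (Filter.Eventually.of_forall fun y => mul_nonneg (by positivity) (hφ_nonneg _))
    _ = 1 := by rw [integral_sub_left_eq_self, integral_dil hφ_zero]

lemma integrable_smoothInd (φ : 𝓢(ℝ, ℝ)) (k n : ℤ) : Integrable (smoothInd φ k n) := by
  have hm : MeasurableSet (dyadic k n) := measurableSet_Icc
  have h1 : Integrable ((dyadic k n).indicator (fun _ => (1 : ℝ))) := by
    refine (integrable_indicator_iff hm).2 ?_
    exact integrableOn_const (by simp [dyadic, Real.volume_Icc]) (by simp)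
  have h := h1.integrable_convolution (ContinuousLinearMap.mul ℝ ℝ) (integrable_dil φ k)
  refine h.congr (Filter.Eventually.of_forall fun x => ?_)
  rw [convolution_def, smoothInd, ← integral_indicator hm]
  refine integral_congr_ae (Filter.Eventually.of_forall fun y => ?_)
  by_cases hy : y ∈ dyadic k n
  · simp only [indicator_of_mem hy, ContinuousLinearMap.mul_apply', one_mul]
  · simp only [indicator_of_notMem hy, ContinuousLinearMap.mul_apply', zero_mul]

lemma annulus_subset : annulus ⊆ Icc (-(39 / 16)) (39 / 16) := fun _ hx => abs_le.1 hx.2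

lemma fourierInv_congr_ae {f g : ℝ → ℂ} (h : f =ᵐ[volume] g) : 𝓕⁻ f = 𝓕⁻ g := by
  ext x
  rw [fourierInv_eq_osc, fourierInv_eq_osc]
  exact integral_congr_ae (by filter_upwards [h] with v hv; rw [hv])

lemma measurableSet_innerAnnulus : MeasurableSet innerAnnulus :=
  measurableSet_Icc.preimage (f := fun x : ℝ => |x|) (by fun_prop)

/-- The Fourier restriction of `𝓕⁻ f` as the inverse Fourier transform of a function on the
annulus. -/
lemma exists_R_eq_fourierInv (Φ₁ : 𝓢(ℝ, ℂ))
    (hΦ_supp : Function.support (𝓕 (Φ₁ : ℝ → ℂ)) ⊆ {ξ : ℝ | 1 / 8 ≤ |ξ| ∧ |ξ| ≤ 19 / 8})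
    {f : ℝ → ℂ} (hf : MemLp f 2 volume) (hfs : Function.support f ⊆ annulus) :
    ∃ F : ℝ → ℂ, Measurable F ∧ MemLp F 2 volume ∧ Integrable F ∧
      Function.support F ⊆ innerAnnulus ∧ l2 F ≤ (∫ x, ‖Φ₁ x‖) * l2 f ∧ R Φ₁ (𝓕⁻ f) = 𝓕⁻ F := by
  have hf1 : Integrable f := integrable_of_support hf (hfs.trans annulus_subset)
  set F₀ : ℝ → ℂ := fun ξ => f ξ * 𝓕 (Φ₁ : ℝ → ℂ) ξ with hF₀
  have hc : Continuous (𝓕 (Φ₁ : ℝ → ℂ)) := by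
    rw [← SchwartzMap.fourier_coe]; exact (𝓕 Φ₁).continuous
  have hb : ∀ ξ, ‖𝓕 (Φ₁ : ℝ → ℂ) ξ‖ ≤ ∫ x, ‖Φ₁ x‖ := fun ξ =>
    VectorFourier.norm_fourierIntegral_le_integral_norm _ _ _ _ _
  have hn : ∀ ξ, ‖F₀ ξ‖ ≤ (∫ x, ‖Φ₁ x‖) * ‖f ξ‖ := fun ξ => by
    rw [hF₀, norm_mul, mul_comm]
    exact mul_le_mul_of_nonneg_right (hb ξ) (norm_nonneg _)
  have hF₀m : AEStronglyMeasurable F₀ volume := hf.1.mul hc.aestronglyMeasurable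
  have hF₀2 : MemLp F₀ 2 volume := MemLp.of_le_mul hf hF₀m (Filter.Eventually.of_forall hn)
  have hF₀s : Function.support F₀ ⊆ innerAnnulus := fun ξ hξ =>
    hΦ_supp fun h => hξ (by simp [hF₀, h])
  -- A Borel representative is chosen because f is only almost everywhere measurable; the indicator
  -- restores the support condition at every point.
  set F : ℝ → ℂ := innerAnnulus.indicator (hF₀m.mk F₀) with hF
  have hae : F₀ =ᵐ[volume] F := by
    filter_upwards [hF₀m.ae_eq_mk] with ξ hξ
    by_cases h : ξ ∈ innerAnnulus
    · rw [hF, indicator_of_mem h, hξ]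
    · rw [hF, indicator_of_notMem h]
      by_contra hc; exact h (hF₀s hc)
  have hFs : Function.support F ⊆ innerAnnulus := support_indicator_subset
  have hF2 : MemLp F 2 volume := (memLp_congr_ae hae).1 hF₀2
  refine ⟨F, (hF₀m.stronglyMeasurable_mk.measurable).indicator measurableSet_innerAnnulus, hF2,
    integrable_of_support hF2 (hFs.trans innerAnnulus_subset), hFs, ?_, ?_⟩
  · have : l2 F = l2 F₀ := by unfold l2; rw [eLpNorm_congr_ae hae]
    rw [this]
    exact l2_le_mul (integral_nonneg fun _ => norm_nonneg _) hf hn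
  · rw [← fourierInv_congr_ae hae]
    ext x
    exact R_fourierInv Φ₁ f hf1 x

/-- The localised third factor. -/
lemma localized_facts {φ : 𝓢(ℝ, ℝ)} (hφ_nonneg : ∀ x, 0 ≤ φ x)
    (hφ_zero : 𝓕 (fun x : ℝ => ((φ x : ℝ) : ℂ)) 0 = 1) (k n : ℤ) {f : ℝ → ℂ}
    (hf : MemLp f 2 volume) (hfs : Function.support f ⊆ annulus) :
    Integrable (fun x => (smoothInd φ k n x : ℂ) * conj (𝓕⁻ f x)) ∧
      MemLp (𝓕⁻ (fun x => (smoothInd φ k n x : ℂ) * conj (𝓕⁻ f x))) 2 volume ∧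
      l2 (𝓕⁻ (fun x => (smoothInd φ k n x : ℂ) * conj (𝓕⁻ f x))) ≤ l2 f := by
  have hf1 : Integrable f := integrable_of_support hf (hfs.trans annulus_subset)
  have hcont := continuous_fourierInv hf1
  have hcc : Continuous fun x => conj (𝓕⁻ f x) := Complex.continuous_conj.comp hcont
  have hi := (integrable_smoothInd φ k n).ofReal (𝕜 := ℂ)
  have h1 : Integrable (fun x => (smoothInd φ k n x : ℂ) * conj (𝓕⁻ f x)) :=
    hi.mul_bdd (c := ∫ v, ‖f v‖) hcc.aestronglyMeasurable
      (Filter.Eventually.of_forall fun x => by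
        rw [RCLike.norm_conj]; exact norm_fourierInv_le f x)
  have hle : ∀ x, ‖(smoothInd φ k n x : ℂ) * conj (𝓕⁻ f x)‖ ≤ ‖𝓕⁻ f x‖ := fun x => by
    rw [norm_mul, RCLike.norm_conj, Complex.norm_real,
      Real.norm_of_nonneg (smoothInd_nonneg hφ_nonneg k n x)]
    exact mul_le_of_le_one_left (norm_nonneg _) (smoothInd_le_one hφ_nonneg hφ_zero k n x)
  have hF2 := memLp_fourierInv hf1 hf
  have h2 : MemLp (fun x => (smoothInd φ k n x : ℂ) * conj (𝓕⁻ f x)) 2 volume :=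
    MemLp.of_le hF2 h1.1 (Filter.Eventually.of_forall hle)
  refine ⟨h1, memLp_fourierInv h1 h2, ?_⟩
  -- Plancherel is used twice, with the pointwise bound by |𝓕⁻ f| in between.
  rw [l2_fourierInv h1 h2, ← l2_fourierInv hf1 hf]
  exact l2_mono hF2 hle

theorem exists_pairing_bound {ρ₁ : ℝ → ℝ} (hρ_smooth : ContDiff ℝ ∞ ρ₁)
    (hρ_supp : Function.support ρ₁ ⊆ Set.Icc (1 / 2) 2) {d : ℕ} (hd : 2 ≤ d) :
    ∃ C : ℝ, 0 < C ∧ ∀ (lam ε : ℝ) (F G W : ℝ → ℂ), 1 ≤ lam → 0 < ε → ε ≤ epsBound d →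
      Measurable F → Measurable G → MemLp F 2 volume → MemLp G 2 volume →
      Function.support F ⊆ innerAnnulus → Function.support G ⊆ innerAnnulus →
      Integrable W → MemLp (𝓕⁻ W) 2 volume →
      ‖∫ x, curveAvg ρ₁ d lam ε 1 (𝓕⁻ F) (𝓕⁻ G) x * W x‖ ≤
        C * (lam ^ (-(1 / 2) : ℝ) * (lam * ε) ^ (-(1 / 6) : ℝ)) * (l2 F * l2 G * l2 (𝓕⁻ W)) ∧
      ‖∫ x, curveAvg ρ₁ d lam 1 ε (𝓕⁻ F) (𝓕⁻ G) x * W x‖ ≤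
        C * (lam ^ (-(1 / 2) : ℝ) * (lam * ε) ^ (-(1 / 6) : ℝ)) * (l2 F * l2 G * l2 (𝓕⁻ W)) := by
  obtain ⟨⟨C₁, hC₁, h₁⟩, C₂, hC₂, h₂⟩ := annDecay_fullSymb hρ_smooth hρ_supp hd
  refine ⟨C₁ + C₂, by positivity, ?_⟩
  intro lam ε F G W hlam hε hε1 hFm hGm hF hG hFs hGs hW hW2
  have hρ := hρ_smooth.continuous
  have h0 : 0 < lam := by linarith
  have hF1 := integrable_of_support hF (hFs.trans innerAnnulus_subset)
  have hG1 := integrable_of_support hG (hGs.trans innerAnnulus_subset)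
  have hWm : Measurable (𝓕⁻ W) := (continuous_fourierInv hW).measurable
  have hab : |ε| = ε := abs_of_pos hε
  have := l2_nonneg F; have := l2_nonneg G; have := l2_nonneg (𝓕⁻ W)
  constructor
  · have e : ∫ x, curveAvg ρ₁ d lam ε 1 (𝓕⁻ F) (𝓕⁻ G) x * W x =
        triForm ε (fullSymb ρ₁ d lam) F G (𝓕⁻ W) := by
      rw [integral_curveAvg_mul hρ hρ_supp d lam ε 1 hF1 hG1 hW, triForm]
      congr 1; ext q
      rw [one_mul, add_comm (ε * q.1)]
    rw [e]
    have k := h₁ lam ε F G (𝓕⁻ W) hlam hε.ne' (hab.le.trans hε1) hFm hGm hWm hF hG hW2 hFs hGs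
    rw [hab] at k
    refine k.trans ?_
    gcongr
    linarith
  -- Here the third factor is evaluated at ξ + εη. Exchanging the variables restores the shape of
  -- `triForm`, with F and G interchanged and the symbol transposed.
  · have e : ∫ x, curveAvg ρ₁ d lam 1 ε (𝓕⁻ F) (𝓕⁻ G) x * W x =
        triForm ε (fun x y => fullSymb ρ₁ d lam y x) G F (𝓕⁻ W) := by
      rw [integral_curveAvg_mul hρ hρ_supp d lam 1 ε hF1 hG1 hW, triForm, ← integral_prod_swap]
      congr 1; ext q
      simp only [Prod.fst_swap, Prod.snd_swap]
      rw [one_mul, mul_comm (F q.2)]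
    rw [e]
    have k := h₂ lam ε G F (𝓕⁻ W) hlam hε.ne' (hab.le.trans hε1) hGm hFm hWm hG hF hW2 hGs hFs
    rw [hab, mul_comm (l2 G)] at k
    refine k.trans ?_
    gcongr
    linarith

/-! ### Dyadic bookkeeping and the final estimate -/

lemma B_of_pos {j : ℤ} (hj : 0 < j) (d : ℕ) (ρ₁ : ℝ → ℝ) (Φ₁ : 𝓢(ℝ, ℂ)) (φ : 𝓢(ℝ, ℝ)) (m : ℕ)
    (n : ℤ) (f g : ℝ → ℂ) (x : ℝ) :
    B d ρ₁ Φ₁ φ j m n f g x = (((2 : ℝ) ^ (-(((d : ℝ) - 1) * j / 2)) : ℝ) : ℂ) *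
      curveAvg ρ₁ d (2 ^ m) ((2 : ℝ) ^ (-(((d : ℝ) - 1) * j))) 1 (R Φ₁ f) (R Φ₁ g) x *
      (smoothInd φ (((d : ℤ) - 1) * |j| + m) n x : ℂ) := by
  rw [B, if_pos hj, curveAvg, one_mul]

lemma B_of_nonpos {j : ℤ} (hj : ¬ 0 < j) (d : ℕ) (ρ₁ : ℝ → ℝ) (Φ₁ : 𝓢(ℝ, ℂ)) (φ : 𝓢(ℝ, ℝ)) (m : ℕ)
    (n : ℤ) (f g : ℝ → ℂ) (x : ℝ) :
    B d ρ₁ Φ₁ φ j m n f g x = (((2 : ℝ) ^ (((d : ℝ) - 1) * j / 2) : ℝ) : ℂ) *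
      curveAvg ρ₁ d (2 ^ m) 1 ((2 : ℝ) ^ (((d : ℝ) - 1) * j)) (R Φ₁ f) (R Φ₁ g) x *
      (smoothInd φ (((d : ℤ) - 1) * |j| + m) n x : ℂ) := by
  rw [B, if_neg hj, curveAvg, one_mul]

/-- Where the lower bound on |j| enters. It suffices that J ≥ 100: then (d-1)J ≥ d + 98, while d ≤
2^d and 2 · 40^14 ≤ 2^98. -/
lemma two_rpow_neg_le_epsBound {d : ℕ} (hd : 2 ≤ d) {J : ℝ} (hJ : (2 : ℝ) ^ 100 ≤ J) :
    (2 : ℝ) ^ (-(((d : ℝ) - 1) * J)) ≤ epsBound d := by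
  have hd2 : (2 : ℝ) ≤ d := by exact_mod_cast hd
  have hJ' : (100 : ℝ) ≤ J := le_trans (by norm_num) hJ
  have h1 : (d : ℝ) + 98 ≤ ((d : ℝ) - 1) * J := by nlinarith
  have h2 : (d : ℝ) * (2 * 40 ^ 14) ≤ (2 : ℝ) ^ (((d : ℝ) - 1) * J) := by
    calc (d : ℝ) * (2 * 40 ^ 14) ≤ (2 : ℝ) ^ d * (2 : ℝ) ^ 98 := by
          gcongr
          · exact_mod_cast Nat.lt_two_pow_self.le
          · norm_num
      _ = (2 : ℝ) ^ ((d : ℝ) + 98) := by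
          rw [Real.rpow_add (by norm_num), Real.rpow_natCast]
          norm_cast
      _ ≤ _ := Real.rpow_le_rpow_of_exponent_le (by norm_num) h1
  rw [Real.rpow_neg (by norm_num), epsBound, one_div]
  exact inv_anti₀ (by positivity) h2

lemma two_rpow_bookkeeping (K : ℝ) (m : ℕ) :
    (2 : ℝ) ^ (-(K / 2)) * (((2 : ℝ) ^ m) ^ (-(1 / 2) : ℝ) *
      ((2 : ℝ) ^ m * (2 : ℝ) ^ (-K)) ^ (-(1 / 6) : ℝ)) =
      (2 : ℝ) ^ ((-K - m) / 2) * (2 : ℝ) ^ (-((m - K) / 6)) := by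
  rw [← Real.rpow_natCast, ← Real.rpow_add (by norm_num), ← Real.rpow_mul (by norm_num),
    ← Real.rpow_mul (by norm_num), ← Real.rpow_add (by norm_num), ← Real.rpow_add (by norm_num),
    ← Real.rpow_add (by norm_num)]
  congr 1; ring

end CurveTrilinear

open CurveTrilinear MeasureTheory in
theorem mainTheorem6
    (d : ℕ) (hd : 2 ≤ d)
    (L : ℝ) (hL : (2 : ℝ) ^ 100 < L)
    (ρ₁ : ℝ → ℝ) (hρ_smooth : ContDiff ℝ ∞ ρ₁)
    (hρ_supp : Function.support ρ₁ ⊆ Set.Icc (1 / 2) 2)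
    (Φ₁ : 𝓢(ℝ, ℂ))
    (hΦ_one : ∀ ξ : ℝ, 3 / 8 ≤ |ξ| → |ξ| ≤ 17 / 8 → 𝓕 (Φ₁ : ℝ → ℂ) ξ = 1)
    (hΦ_supp : Function.support (𝓕 (Φ₁ : ℝ → ℂ)) ⊆ {ξ : ℝ | 1 / 8 ≤ |ξ| ∧ |ξ| ≤ 19 / 8})
    (φ : 𝓢(ℝ, ℝ)) (hφ_nonneg : ∀ x, 0 ≤ φ x)
    (hφ_supp : Function.support (𝓕 (fun x : ℝ => ((φ x : ℝ) : ℂ))) ⊆ Set.Icc (-(1 / 100)) (1 / 100))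
    (hφ_zero : 𝓕 (fun x : ℝ => ((φ x : ℝ) : ℂ)) 0 = 1) :
    ∃ C : ℝ, ∀ (j : ℤ) (m : ℕ) (n : ℤ),
      L ≤ |(j : ℝ)| → |(j : ℝ)| ≤ (m : ℝ) / ((d : ℝ) - 1) →
      ∀ f₁ f₂ f₃ : ℝ → ℂ,
        MeasureTheory.MemLp f₁ 2 MeasureTheory.volume →
        MeasureTheory.MemLp f₂ 2 MeasureTheory.volume →
        MeasureTheory.MemLp f₃ 2 MeasureTheory.volume →
        Function.support f₁ ⊆ CurveTrilinear.annulus →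
        Function.support f₂ ⊆ CurveTrilinear.annulus →
        Function.support f₃ ⊆ CurveTrilinear.annulus →
        MeasureTheory.Integrable
            (CurveTrilinear.LambdaIntegrand d ρ₁ Φ₁ φ j m n f₁ f₂ f₃) MeasureTheory.volume ∧
        ‖CurveTrilinear.Lambda d ρ₁ Φ₁ φ j m n f₁ f₂ f₃‖ ≤
          C * (2 : ℝ) ^ ((-(((d : ℝ) - 1) * |(j : ℝ)|) - m) / 2) *
            (2 : ℝ) ^ (-(((m : ℝ) - ((d : ℝ) - 1) * |(j : ℝ)|) / 6)) *
            (MeasureTheory.eLpNorm f₁ 2 MeasureTheory.volume).toReal *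
            (MeasureTheory.eLpNorm f₂ 2 MeasureTheory.volume).toReal *
            (MeasureTheory.eLpNorm f₃ 2 MeasureTheory.volume).toReal := by
  obtain ⟨C, hC, hpair⟩ := exists_pairing_bound hρ_smooth hρ_supp hd
  set A : ℝ := ∫ x, ‖Φ₁ x‖ with hA
  have hA0 : 0 ≤ A := integral_nonneg fun _ => norm_nonneg _
  refine ⟨C * A ^ 2, ?_⟩
  intro j m n hjL hjm f₁ f₂ f₃ hf₁ hf₂ hf₃ hs₁ hs₂ hs₃
  obtain ⟨F, hFm, hF, hF1, hFs, hFl, hFR⟩ := exists_R_eq_fourierInv Φ₁ hΦ_supp hf₁ hs₁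
  obtain ⟨G, hGm, hG, hG1, hGs, hGl, hGR⟩ := exists_R_eq_fourierInv Φ₁ hΦ_supp hf₂ hs₂
  obtain ⟨hW, hW2, hWl⟩ := localized_facts hφ_nonneg hφ_zero (((d : ℤ) - 1) * |j| + m) n hf₃ hs₃
  set W : ℝ → ℂ := fun x => (smoothInd φ (((d : ℤ) - 1) * |j| + m) n x : ℂ) *
    (starRingEnd ℂ) (𝓕⁻ f₃ x) with hWdef
  set K : ℝ := ((d : ℝ) - 1) * |(j : ℝ)| with hK
  set ε : ℝ := (2 : ℝ) ^ (-K) with hε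
  have hε0 : 0 < ε := by positivity
  have hε1 : ε ≤ epsBound d := two_rpow_neg_le_epsBound hd (hL.le.trans hjL)
  have hlam : (1 : ℝ) ≤ 2 ^ m := one_le_pow₀ (by norm_num)
  have hb := hpair (2 ^ m) ε F G W hlam hε0 hε1 hFm hGm hF hG hFs hGs hW hW2
  -- Both signs of j have the same prefactor 2^{-K/2}; only the pair of dilations (a,b), equal to
  -- (ε,1) or (1,ε), differs.
  have key : ∀ a b : ℝ, ‖∫ x, curveAvg ρ₁ d (2 ^ m) a b (𝓕⁻ F) (𝓕⁻ G) x * W x‖ ≤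
        C * (((2 : ℝ) ^ m) ^ (-(1 / 2) : ℝ) * (2 ^ m * ε) ^ (-(1 / 6) : ℝ)) *
          (l2 F * l2 G * l2 (𝓕⁻ W)) →
      (∀ x, LambdaIntegrand d ρ₁ Φ₁ φ j m n f₁ f₂ f₃ x = (((2 : ℝ) ^ (-(K / 2)) : ℝ) : ℂ) *
        (curveAvg ρ₁ d (2 ^ m) a b (𝓕⁻ F) (𝓕⁻ G) x * W x)) →
      Integrable (LambdaIntegrand d ρ₁ Φ₁ φ j m n f₁ f₂ f₃) volume ∧
      ‖Lambda d ρ₁ Φ₁ φ j m n f₁ f₂ f₃‖ ≤ C * A ^ 2 * (2 : ℝ) ^ ((-K - m) / 2) *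
        (2 : ℝ) ^ (-(((m : ℝ) - K) / 6)) * l2 f₁ * l2 f₂ * l2 f₃ := by
    intro a b hbound hrepr
    refine ⟨?_, ?_⟩
    · rw [funext hrepr]
      exact (integrable_curveAvg_mul hρ_smooth.continuous hρ_supp d _ a b hF1 hG1 hW).const_mul _
    · rw [Lambda, funext hrepr, integral_const_mul, norm_mul, Complex.norm_real,
        Real.norm_of_nonneg (by positivity)]
      have := l2_nonneg f₁; have := l2_nonneg f₂; have := l2_nonneg f₃
      have := l2_nonneg F; have := l2_nonneg G; have := l2_nonneg (𝓕⁻ W)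
      calc _ ≤ (2 : ℝ) ^ (-(K / 2)) * (C * (((2 : ℝ) ^ m) ^ (-(1 / 2) : ℝ) *
            (2 ^ m * ε) ^ (-(1 / 6) : ℝ)) * ((A * l2 f₁) * (A * l2 f₂) * l2 f₃)) := by
            refine mul_le_mul_of_nonneg_left (hbound.trans ?_) (by positivity)
            gcongr
        _ = C * A ^ 2 * ((2 : ℝ) ^ (-(K / 2)) * (((2 : ℝ) ^ m) ^ (-(1 / 2) : ℝ) *
            (2 ^ m * ε) ^ (-(1 / 6) : ℝ))) * l2 f₁ * l2 f₂ * l2 f₃ := by ring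
        _ = _ := by rw [hε, two_rpow_bookkeeping]; ring
  by_cases hj : 0 < j
  · have hjK : ((d : ℝ) - 1) * j = K := by
      rw [hK, abs_of_pos (by exact_mod_cast hj)]
    refine key ε 1 hb.1 fun x => ?_
    rw [LambdaIntegrand, B_of_pos hj, hFR, hGR, hjK]
    simp only [hWdef]; ring
  · have hjK : ((d : ℝ) - 1) * j = -K := by
      rw [hK, abs_of_nonpos (by exact_mod_cast not_lt.1 hj)]; ring
    refine key 1 ε hb.2 fun x => ?_
    rw [LambdaIntegrand, B_of_nonpos hj, hFR, hGR, hjK, neg_div]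
    simp only [hWdef]; ring

end
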